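/- Let $n\ge 0$, let $U\subset\mathbb{C}^n$ be an open neighbourhood of $0$, and let $F:U\to F(U)$ be a biholomorphism onto an open subset of $\mathbb{C}^n$ such that $F(0)=0$, the closure of $F(U)$ is compact and contained in $U$, and $F$ is contracting, i.e. all eigenvalues of its linear part $L=DF(0)$ have modulus $<1$. If $U$ is not connected, assume also that every forward orbit of $F$ enters the connected component of $U$ that contains $0$. The Hopf manifold of $F$ is the quotient $M$ of $U\setminus\{0\}$ by the equivalence relation generated by $z\sim F(z)$, with projection $\pi:U\setminus\{0\}\to M$. Write $\mathbb{C}^n=\bigoplus_\lambda E_\lambda$ for the decomposition into the generalized eigenspaces of $L$, where $\lambda$ runs over the distinct eigenvalues of $L$. A polynomial map $Q:\mathbb{C}^n\to\mathbb{C}^n$ with $Q(0)=0$ is of type $s=(s_\lambda)_\lambda$, $s_\lambda\in\mathbb{Z}_{\ge0}$, if $Q(\sum_\lambda a_\lambda t_\lambda)=\bigl(\prod_\lambda a_\lambda^{s_\lambda}\bigr)Q(\sum_\lambda t_\lambda)$ for all $a_\lambda\in\mathbb{C}$, $t_\lambda\in E_\lambda$. A polynomial map fixing $0$ is sub-resonant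 relative to $L$ if for every eigenvalue $\mu$ its component in $E_\mu$ is a finite sum of maps of types $s$ with $\ln|\mu|\le\sum_\lambda s_\lambda\ln|\lambda|$. Let $SR^*(L)$ be the set of sub-resonant maps whose derivative at $0$ is invertible, and let $G$ be the group of transformations of $\mathbb{C}^n$ generated by $SR^*(L)$ and the translations. Then: 1. $X=\mathbb{C}^n$ is a holomorphic homogeneous $G$-space: $G$ carries the structure of a (finite-dimensional, Hausdorff, second countable) complex Lie group for which the action $G\times X\to X$ is holomorphic, and this action is transitive. 2. $M$ is a Hausdorff, second countable space, and it carries a holomorphic $(G,X)$-structure: an atlas of $X$-valued charts whose changes of charts coincide, near every point of their domain, with elements of $G$. The complex structure that this atlas defines on $M$ is the quotient one, i.e. $\pi$ is a local biholomorphism. -/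

import Mathlib

open scoped Topology Manifold ContDiff

/-- The space `ℂⁿ`. -/
abbrev Cn (n : ℕ) : Type := EuclideanSpace ℂ (Fin n)

/-! ### Sub-resonance type polynomials -/

/-- A polynomial map `ℂⁿ → ℂⁿ`: every coordinate is a polynomial function. -/
def IsPolynomialMap {n : ℕ} (P : Cn n → Cn n) : Prop :=
  ∀ i : Fin n, ∃ p : MvPolynomial (Fin n) ℂ, ∀ z : Cn n, P z i = MvPolynomial.eval (fun k => z k) p

/-- `P` is homogeneous of type `s = (s_λ)_λ` relative to `L`, where `λ` runs over the (distinct)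
eigenvalues of `L`: `P (∑ a_λ t_λ) = (∏ a_λ ^ s_λ) P (∑ t_λ)` for all scalars `a_λ` and all `t_λ` in
the characteristic (generalized eigen-) space of `L` for `λ`. -/
def IsOfType {n : ℕ} (L : Module.End ℂ (Cn n)) (s : L.Eigenvalues → ℕ) (P : Cn n → Cn n) : Prop :=
  ∀ (a : L.Eigenvalues → ℂ) (t : L.Eigenvalues → Cn n),
    (∀ j : L.Eigenvalues, t j ∈ L.maxGenEigenspace (j : ℂ)) →
      P (∑ j, a j • t j) = (∏ j, a j ^ s j) • P (∑ j, t j)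

/-- A sub-resonant term relative to `L`: a polynomial map fixing `0`, with values in the
characteristic space of one eigenvalue `i`, homogeneous of a type `s` that satisfies
`ln |i| ≤ ∑_j s_j ln |j|`. -/
def IsSubResonantTerm {n : ℕ} (L : Module.End ℂ (Cn n)) (Q : Cn n → Cn n) : Prop :=
  IsPolynomialMap Q ∧ Q 0 = 0 ∧
    ∃ (i : L.Eigenvalues) (s : L.Eigenvalues → ℕ),
      (∀ z, Q z ∈ L.maxGenEigenspace (i : ℂ)) ∧ IsOfType L s Q ∧
        Real.log ‖(i : ℂ)‖ ≤ ∑ j : L.Eigenvalues, (s j : ℝ) * Real.log ‖(j : ℂ)‖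

/-- `SR(L)`: the maps all of whose components in the characteristic spaces of `L` are finite sums of
sub-resonant terms. -/
def SR {n : ℕ} (L : Module.End ℂ (Cn n)) : Submodule ℂ (Cn n → Cn n) :=
  Submodule.span ℂ {Q | IsSubResonantTerm L Q}

/-- `SR*(L)`: the elements of `SR(L)` whose derivative at the origin is invertible. -/
def SRstar {n : ℕ} (L : Module.End ℂ (Cn n)) : Set (Cn n → Cn n) :=
  {P | P ∈ SR L ∧ IsUnit (fderiv ℂ P 0)}

/-- The group `G = ⟨SR*(L), ℂⁿ⟩` of transformations of `ℂⁿ` generated by `SR*(L)` and by the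
translations. -/
def subResonantAffineGroup {n : ℕ} (L : Module.End ℂ (Cn n)) : Subgroup (Equiv.Perm (Cn n)) :=
  Subgroup.closure
    ({g | (g : Cn n → Cn n) ∈ SRstar L} ∪ Set.range fun τ : Cn n => Equiv.addRight τ)

/-! ### Holomorphic homogeneous spaces and `(G, X)`-structures -/

/-- `X = ℂⁿ` is a holomorphic homogeneous `G`-space for the transformation group `G`: the group `G` is
a (finite-dimensional, Hausdorff, second countable) complex Lie group for which the action
`G × X → X` is holomorphic, and the action is transitive. -/
def IsHolomorphicHomogeneousSpace {n : ℕ} (G : Subgroup (Equiv.Perm (Cn n))) : Prop :=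
  (∃ (m : ℕ) (_ : TopologicalSpace G) (_ : ChartedSpace (Cn m) G),
    T2Space G ∧ SecondCountableTopology G ∧ LieGroup 𝓘(ℂ, Cn m) ω G ∧
      ContMDiff (𝓘(ℂ, Cn m).prod 𝓘(ℂ, Cn n)) 𝓘(ℂ, Cn n) ω
        (fun p : G × Cn n => (p.1 : Equiv.Perm (Cn n)) p.2)) ∧
  ∀ x y : Cn n, ∃ g ∈ G, g x = y

/-- The pseudogroup of a transformation group `G` of `X`: the homeomorphisms between open subsets of
`X` that coincide near every point of their domain with an element of `G`. A charted space with this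
structure groupoid (`HasGroupoid`) is a `(G, X)`-structure. -/
def transformationGroupoid {X : Type*} [TopologicalSpace X] (G : Subgroup (Equiv.Perm X)) :
    StructureGroupoid X where
  members := {e | ∀ x ∈ e.source, ∃ g ∈ G, ∀ᶠ y in 𝓝 x, e y = g y}
  trans' := by
    intro e e' he he' x hx
    rw [OpenPartialHomeomorph.trans_source] at hx
    obtain ⟨g, hg, hgx⟩ := he x hx.1
    obtain ⟨g', hg', hgx'⟩ := he' (e x) hx.2
    refine ⟨g' * g, G.mul_mem hg' hg, ?_⟩
    filter_upwards [hgx, (e.continuousAt hx.1).eventually hgx'] with y hy hy'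
    rw [OpenPartialHomeomorph.coe_trans, Function.comp_apply, hy', hy, Equiv.Perm.mul_apply]
  symm' := by
    intro e he y hy
    obtain ⟨g, hg, hgx⟩ := he (e.symm y) (e.map_target hy)
    refine ⟨g⁻¹, G.inv_mem hg, ?_⟩
    filter_upwards [(e.symm.continuousAt hy).eventually hgx, e.open_target.mem_nhds hy] with w hw hwt
    rw [Equiv.Perm.eq_inv_iff_eq, ← hw, e.right_inv hwt]
  id_mem' := fun x _ => ⟨1, G.one_mem, Filter.Eventually.of_forall fun _ => rfl⟩
  locality' := by
    intro e he x hx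
    obtain ⟨s, hs, hxs, h⟩ := he x hx
    exact h x (by rw [OpenPartialHomeomorph.restr_source, hs.interior_eq]; exact ⟨hx, hxs⟩)
  mem_of_eqOnSource' := by
    intro e e' he hee' x hx
    obtain ⟨g, hg, hgx⟩ := he x (hee'.1 ▸ hx)
    refine ⟨g, hg, ?_⟩
    filter_upwards [hgx, e'.open_source.mem_nhds hx] with y hy hys
    rw [hee'.2 hys, hy]

/-! ### Hopf manifolds -/

/-- The linear part of `F` at the origin. -/
noncomputable def linearPart {n : ℕ} (F : Cn n → Cn n) : Module.End ℂ (Cn n) :=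
  (fderiv ℂ F 0 : Cn n →ₗ[ℂ] Cn n)

/-- `F : U → F(U)` is a contracting biholomorphism fixing the origin, where `U = F.source` is an open
neighbourhood of the origin in `ℂⁿ`, `F(U) = F.target`, and `F(U)` is relatively compact in `U`. -/
structure IsHopfContraction {n : ℕ} (F : OpenPartialHomeomorph (Cn n) (Cn n)) : Prop where
  zero_mem : (0 : Cn n) ∈ F.source
  map_zero : F 0 = 0
  holomorphic : DifferentiableOn ℂ F F.source
  holomorphic_symm : DifferentiableOn ℂ F.symm F.target
  contracting : ∀ μ : ℂ, (linearPart F).HasEigenvalue μ → ‖μ‖ < 1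
  isCompact_closure : IsCompact (closure F.target)
  closure_subset : closure F.target ⊆ F.source
  /-- Automatic if `U` is connected. It excludes components of `U` that `F` permutes away from the
  origin; there `F` would have periodic points and the quotient would not be a manifold. -/
  orbit_mem_component :
    ∀ z ∈ F.source, ∃ k : ℕ, F^[k] z ∈ connectedComponentIn F.source 0

/-- The open set `U ∖ {0}`, where `U = F.source`. -/
def puncturedSource {n : ℕ} (F : OpenPartialHomeomorph (Cn n) (Cn n)) :
    TopologicalSpace.Opens (Cn n) :=
  ⟨F.source \ {0}, F.open_source.sdiff isClosed_singleton⟩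

/-- The Hopf manifold: the quotient of `U ∖ {0}` by the equivalence relation generated by
`z ∼ F z`. -/
def HopfManifold {n : ℕ} (F : OpenPartialHomeomorph (Cn n) (Cn n)) : Type :=
  Quot fun z w : puncturedSource F => (w : Cn n) = F z

/-- The quotient topology. -/
instance {n : ℕ} (F : OpenPartialHomeomorph (Cn n) (Cn n)) : TopologicalSpace (HopfManifold F) :=
  inferInstanceAs (TopologicalSpace (Quot _))

/-- The projection of `U ∖ {0}` onto the Hopf manifold. -/
def hopfProj {n : ℕ} (F : OpenPartialHomeomorph (Cn n) (Cn n)) (z : puncturedSource F) :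
    HopfManifold F :=
  Quot.mk _ z

/-! ### Holomorphic functions of several variables -/

section Osgood

open MeasureTheory Metric

variable {E : Type*} [NormedAddCommGroup E] [NormedSpace ℂ E]

/-! The eigenvalues λ of L satisfy 0 < |λ| < 1, so in a basis of generalized eigenvectors the
weights w_k = -ln|λ_k| are positive. Allowing constants, the sub-resonance inequality says that the
i-th coordinate of a map is a polynomial of weight at most w_i. Let V be the space of all such maps.
Positivity leaves finitely many monomials, so V is finite-dimensional. Substituting polynomials of
weight at most w_k for the variables does not raise weights, so V is closed under composition
(`isCompositionMonoid_weightedMaps`). A bijection in V has its inverse in V, because right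
composition is a linear endomorphism of V. Hence G is exactly the set of bijections in V
(`mem_subResonantAffineGroup_iff`). It is open in V, being cut out by invertibility of right
composition, and this makes it a complex Lie group (`IsCompositionMonoid.exists_lieGroup`).
Translations give transitivity.

Next, F is conjugate near 0 to an element g of G (`IsAttractingNhd.exists_normalForm`). Let T be
composition with F on bounded holomorphic functions on a small invariant neighbourhood B, where
iterates decay like q^k. Modulo the space K of functions O(|z|^N), T acts on something
finite-dimensional. If q^N < |μ|, then T - μ is onto on K, and K contains no generalized
eigenfunction for μ that is nonzero on B. So each linear coordinate can be corrected to an exact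
generalized eigenfunction φ_i of T with the same differential. Products of the φ_k are generalized
eigenfunctions for products of eigenvalues. Comparing eigenvalues in the Taylor expansion of φ_i∘F
in the φ_k leaves only monomials with ∏ λ_k = λ_i, and no remainder. Thus φ∘F = P∘φ with P in V.

Every orbit enters B (`IsHopfContraction.exists_iterate_mem`), so ψ(z) = g⁻ᵏ φ(Fᵏ z), for k large,
is a well-defined injective holomorphic map on all of U with ψ∘F = g∘ψ. Convergence of the iterates
to 0 makes the action on U∖{0} wandering, so M is Hausdorff and π is a local homeomorphism. Charts
of M are local inverses of π followed by ψ. Points in one fibre differ by iterates of F, so the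
chart changes are powers of g.

Analyticity in several variables comes from the Cauchy formula on polydiscs: continuity together
with holomorphy on complex lines suffices, which also covers normally convergent series. -/

lemma torusMap_mem_closedBall {n : ℕ} (c : Fin n → ℂ) {R : ℝ} (hR : 0 ≤ R) (θ : Fin n → ℝ) :
    torusMap c (fun _ => R) θ ∈ closedBall c R := by
  rw [mem_closedBall, dist_pi_le_iff hR]
  intro i
  simp [torusMap, dist_eq_norm, Complex.norm_exp_ofReal_mul_I, abs_of_nonneg hR]

lemma torusMap_sub_ne_zero {n : ℕ} {c z : Fin n → ℂ} {R : ℝ} (hR : 0 ≤ R) (hz : z ∈ ball c R)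
    (θ : Fin n → ℝ) (i : Fin n) : torusMap c (fun _ => R) θ i - z i ≠ 0 := by
  intro h
  have h1 : dist (z i) (c i) < R := (dist_le_pi_dist z c i).trans_lt hz
  rw [← sub_eq_zero.1 h] at h1
  simp [torusMap, dist_eq_norm, Complex.norm_exp_ofReal_mul_I, abs_of_nonneg hR] at h1

lemma continuous_torusMap {n : ℕ} (c : Fin n → ℂ) (R : Fin n → ℝ) : Continuous (torusMap c R) := by
  unfold torusMap
  fun_prop

/-- The Cauchy formula on a polydisc. -/
theorem torusIntegral_prod_sub_inv_smul [CompleteSpace E] {n : ℕ} {f : (Fin n → ℂ) → E}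
    {c : Fin n → ℂ} {R : ℝ} (hR : 0 ≤ R) (hc : ContinuousOn f (closedBall c R))
    (hd : ∀ z ∈ closedBall c R, ∀ v, DifferentiableAt ℂ (fun t : ℂ => f (z + t • v)) 0)
    {z : Fin n → ℂ} (hz : z ∈ ball c R) :
    torusIntegral (fun ζ => (∏ i, (ζ i - z i)⁻¹) • f ζ) c (fun _ => R) =
      (2 * Real.pi * Complex.I : ℂ) ^ n • f z := by
  induction n with
  | zero =>
    rw [torusIntegral_dim0]
    simp [Subsingleton.elim c z]
  | succ n ih =>
    have hint : TorusIntegrable (fun ζ => (∏ i, (ζ i - z i)⁻¹) • f ζ) c (fun _ => R) := by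
      refine ContinuousOn.integrableOn_compact isCompact_Icc ?_
      refine Continuous.continuousOn ?_
      refine Continuous.smul ?_ ?_
      · refine continuous_finsetProd _ fun i _ => Continuous.inv₀ ?_ ?_
        · have := continuous_torusMap c (fun _ => R)
          fun_prop
        · exact fun θ => torusMap_sub_ne_zero hR hz θ i
      · exact hc.comp_continuous (continuous_torusMap _ _) (torusMap_mem_closedBall c hR)
    have hcons : ∀ x ∈ closedBall (c 0) R, ∀ y ∈ closedBall (c ∘ Fin.succ) R,
        (Fin.cons x y : Fin (n + 1) → ℂ) ∈ closedBall c R := by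
      intro x hx y hy
      rw [mem_closedBall, dist_pi_le_iff hR]
      intro i
      refine Fin.cases ?_ (fun j => ?_) i
      · simpa using hx
      · simpa using (dist_le_pi_dist y (c ∘ Fin.succ) j).trans hy
    have hz' : z ∘ Fin.succ ∈ ball (c ∘ Fin.succ) R := by
      have hR' : 0 < R := pos_of_mem_ball hz
      rw [mem_ball, dist_pi_lt_iff hR']
      exact fun i => (dist_le_pi_dist z c i.succ).trans_lt hz
    have hz0 : z 0 ∈ ball (c 0) R := (dist_le_pi_dist z c 0).trans_lt hz
    rw [torusIntegral_succ hint]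
    -- With the first coordinate frozen, the inner integral is the formula in one variable fewer.
    -- The outer integral is then the one-variable Cauchy formula. The hypothesis on lines is used
    -- only for directions in these two coordinate subspaces.
    have hinner : ∀ x ∈ sphere (c 0) R,
        torusIntegral (fun y : Fin n → ℂ =>
          (∏ i, ((Fin.cons x y : Fin (n + 1) → ℂ) i - z i)⁻¹) • f (Fin.cons x y))
          (c ∘ Fin.succ) ((fun _ => R) ∘ Fin.succ) =
        (2 * Real.pi * Complex.I : ℂ) ^ n •
          ((x - z 0)⁻¹ • f (Fin.cons x (z ∘ Fin.succ))) := by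
      intro x hx
      have hx' := sphere_subset_closedBall hx
      have h := ih (f := fun y => f (Fin.cons x y)) (c := c ∘ Fin.succ)
        (hc.comp (by fun_prop) fun y hy => hcons x hx' y hy) (by
          intro y hy v
          have h := hd _ (hcons x hx' y hy) (Fin.cons 0 v)
          have e : ∀ t : ℂ, (Fin.cons x y : Fin (n + 1) → ℂ) + t • Fin.cons 0 v =
              Fin.cons x (y + t • v) := by
            intro t
            ext i
            refine Fin.cases ?_ (fun j => ?_) i <;> simp
          simpa only [e] using h) hz'
      simp only [Fin.prod_univ_succ, Fin.cons_zero, Fin.cons_succ, mul_smul]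
      rw [torusIntegral_smul, Function.comp_def (fun _ : Fin (n + 1) => R)]
      simp only [Function.comp_apply] at h
      rw [h, smul_comm]
    rw [circleIntegral.integral_congr hR hinner]
    rw [circleIntegral.integral_smul]
    have hg : DifferentiableOn ℂ (fun x : ℂ => f (Fin.cons x (z ∘ Fin.succ)))
        (closedBall (c 0) R) := by
      intro x hx
      have h := hd _ (hcons x hx _ (ball_subset_closedBall hz')) (Fin.cons 1 0)
      have e : (fun t : ℂ => f ((Fin.cons x (z ∘ Fin.succ) : Fin (n + 1) → ℂ) + t • Fin.cons 1 0)) =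
          fun t => f (Fin.cons (x + t) (z ∘ Fin.succ)) := by
        funext t
        congr 1
        ext i
        refine Fin.cases ?_ (fun j => ?_) i <;> simp
      rw [e] at h
      have h2 := DifferentiableAt.comp x (g := fun t => f (Fin.cons (x + t) (z ∘ Fin.succ)))
        (f := fun y : ℂ => y - x) (by simpa using h) (by fun_prop)
      refine DifferentiableAt.differentiableWithinAt ?_
      refine h2.congr_of_eventuallyEq (Filter.Eventually.of_forall fun y => ?_)
      simp
    rw [(hg.diffContOnCl_ball subset_rfl).circleIntegral_sub_inv_smul hz0, smul_smul, ← pow_succ]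
    congr 2
    exact Fin.cons_self_tail z

/-- The function `θ ↦ ζ_i(θ)` on the parameter box of the torus. -/
noncomputable def torusCoord {n : ℕ} (c : Fin n → ℂ) (R : ℝ) (i : Fin n) :
    C(Set.Icc (0 : Fin n → ℝ) (fun _ => 2 * Real.pi), ℂ) :=
  ⟨fun θ => torusMap c (fun _ => R) θ i,
    by have := continuous_torusMap c (fun _ => R); fun_prop⟩

lemma torusCoord_sub_apply {n : ℕ} (c : Fin n → ℂ) (R : ℝ) (i : Fin n) (a : ℂ)
    (θ : Set.Icc (0 : Fin n → ℝ) (fun _ => 2 * Real.pi)) :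
    (torusCoord c R i - algebraMap ℂ _ a) θ = torusMap c (fun _ => R) θ i - a := by
  simp [torusCoord]

/-- The Cauchy kernel, as a function with values in the continuous functions on the torus. -/
noncomputable def cauchyKernel {n : ℕ} (c : Fin n → ℂ) (R : ℝ) (z : Fin n → ℂ) :
    C(Set.Icc (0 : Fin n → ℝ) (fun _ => 2 * Real.pi), ℂ) :=
  ∏ i, Ring.inverse (torusCoord c R i - algebraMap ℂ _ (z i))

lemma isUnit_torusCoord_sub {n : ℕ} {c z : Fin n → ℂ} {R : ℝ} (hR : 0 ≤ R) (hz : z ∈ ball c R)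
    (i : Fin n) : IsUnit (torusCoord c R i - algebraMap ℂ _ (z i)) := by
  rw [ContinuousMap.isUnit_iff_forall_ne_zero]
  intro θ
  rw [torusCoord_sub_apply]
  exact torusMap_sub_ne_zero hR hz θ i

/-- Inversion is analytic at every unit of a Banach algebra, and the factors are units because z
stays off the torus. -/
lemma analyticAt_cauchyKernel {n : ℕ} {c z : Fin n → ℂ} {R : ℝ} (hR : 0 ≤ R) (hz : z ∈ ball c R) :
    AnalyticAt ℂ (cauchyKernel c R) z := by
  unfold cauchyKernel
  refine Finset.analyticAt_fun_prod _ fun i _ => ?_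
  obtain ⟨u, hu⟩ := isUnit_torusCoord_sub hR hz i
  refine AnalyticAt.fun_comp (g := Ring.inverse) (by rw [← hu]; exact analyticAt_inverse u) ?_
  refine analyticAt_const.sub ?_
  simp only [Algebra.algebraMap_eq_smul_one]
  exact ((ContinuousLinearMap.proj (R := ℂ) (φ := fun _ : Fin n => ℂ) i).analyticAt z).fun_smul
    analyticAt_const

lemma cauchyKernel_apply {n : ℕ} {c z : Fin n → ℂ} {R : ℝ} (hR : 0 ≤ R) (hz : z ∈ ball c R)
    (θ : Set.Icc (0 : Fin n → ℝ) (fun _ => 2 * Real.pi)) :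
    cauchyKernel c R z θ = ∏ i, (torusMap c (fun _ => R) θ i - z i)⁻¹ := by
  rw [cauchyKernel, ContinuousMap.prod_apply]
  refine Finset.prod_congr rfl fun i _ => ?_
  have h := Ring.mul_inverse_cancel _ (isUnit_torusCoord_sub hR hz i)
  have h2 := congrArg (fun g => g θ) h
  simp only [ContinuousMap.mul_apply, ContinuousMap.one_apply, torusCoord_sub_apply] at h2
  exact eq_inv_of_mul_eq_one_right h2

/-- Integration of continuous functions on a compact measured space against a continuous density. -/
noncomputable def integralAgainst {X : Type*} [TopologicalSpace X] [CompactSpace X]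
    [MeasurableSpace X] [BorelSpace X] (μ : Measure X) [IsFiniteMeasure μ] (h : C(X, E)) :
    C(X, ℂ) →L[ℂ] E :=
  LinearMap.mkContinuous
    { toFun := fun g => ∫ x, g x • h x ∂μ
      map_add' := fun g₁ g₂ => by
        simp only [ContinuousMap.add_apply, add_smul]
        exact integral_add
          ((g₁.continuous.smul h.continuous).integrable_of_hasCompactSupport
            (HasCompactSupport.of_compactSpace _))
          ((g₂.continuous.smul h.continuous).integrable_of_hasCompactSupport
            (HasCompactSupport.of_compactSpace _))
      map_smul' := fun a g => by
        simp only [ContinuousMap.smul_apply, smul_assoc, RingHom.id_apply]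
        exact integral_smul a _ }
    (‖h‖ * μ.real Set.univ) fun g => by
      refine (norm_integral_le_of_norm_le_const (C := ‖g‖ * ‖h‖) ?_).trans_eq (by ring)
      refine Filter.Eventually.of_forall fun x => ?_
      rw [norm_smul]
      gcongr
      · exact g.norm_coe_le_norm x
      · exact h.norm_coe_le_norm x

/-- The Cauchy formula presents f near c as a fixed continuous linear map applied to the kernel. The
kernel depends analytically on z as an element of the Banach algebra of continuous functions on the
parameter box, so no differentiation under the integral sign is needed. -/
theorem analyticAt_of_continuousOn_of_line [CompleteSpace E] {n : ℕ} {f : (Fin n → ℂ) → E}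
    {c : Fin n → ℂ} {R : ℝ} (hR : 0 < R) (hc : ContinuousOn f (closedBall c R))
    (hd : ∀ z ∈ closedBall c R, ∀ v, DifferentiableAt ℂ (fun t : ℂ => f (z + t • v)) 0) :
    AnalyticAt ℂ f c := by
  let X := Set.Icc (0 : Fin n → ℝ) (fun _ => 2 * Real.pi)
  -- The product is the Jacobian factor built into `torusIntegral`.
  let h : C(X, E) := ⟨fun θ => (∏ i : Fin n, (R : ℂ) * Complex.exp (θ.1 i * Complex.I) * Complex.I)
      • f (torusMap c (fun _ => R) θ), by
    refine Continuous.smul ?_ ?_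
    · refine continuous_finsetProd _ fun i _ => ?_
      have : Continuous fun θ : X => θ.1 i := (continuous_apply i).comp continuous_subtype_val
      exact (continuous_const.mul (Complex.continuous_exp.comp
        ((Complex.continuous_ofReal.comp this).mul continuous_const))).mul continuous_const
    · exact hc.comp_continuous ((continuous_torusMap _ _).comp continuous_subtype_val)
        fun θ => torusMap_mem_closedBall c hR.le θ⟩
  let μ : Measure X := Measure.comap Subtype.val volume
  have : IsFiniteMeasure μ := ⟨by
    rw [Measure.comap_apply _ Subtype.val_injective (fun s hs => measurableSet_Icc.subtype_image hs)
      _ MeasurableSet.univ]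
    rw [Set.image_univ, Subtype.range_coe]
    exact isCompact_Icc.measure_lt_top⟩
  have key : ∀ z ∈ ball c R, f z = ((2 * Real.pi * Complex.I : ℂ) ^ n)⁻¹ •
      integralAgainst μ h (cauchyKernel c R z) := by
    intro z hz
    rw [eq_inv_smul_iff₀ (pow_ne_zero _ Complex.two_pi_I_ne_zero),
      ← torusIntegral_prod_sub_inv_smul hR.le hc hd hz, torusIntegral,
      ← integral_subtype_comap measurableSet_Icc]
    refine integral_congr_ae (Filter.Eventually.of_forall fun θ => ?_)
    simp only
    rw [cauchyKernel_apply hR.le hz, smul_comm]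
    rfl
  have han : AnalyticAt ℂ (fun z => ((2 * Real.pi * Complex.I : ℂ) ^ n)⁻¹ •
      integralAgainst μ h (cauchyKernel c R z)) c :=
    analyticAt_const.smul (((integralAgainst μ h).analyticAt _).comp
      (analyticAt_cauchyKernel hR.le (mem_ball_self hR)))
  refine han.congr ?_
  filter_upwards [ball_mem_nhds c hR] with z hz
  exact (key z hz).symm

/-- A continuous function on an open subset of `ℂⁿ` that is holomorphic on complex lines is
analytic. -/
theorem analyticOnNhd_of_continuousOn_of_line [CompleteSpace E] {n : ℕ} {f : Cn n → E}
    {U : Set (Cn n)} (hU : IsOpen U) (hc : ContinuousOn f U)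
    (hd : ∀ z ∈ U, ∀ v, DifferentiableAt ℂ (fun t : ℂ => f (z + t • v)) 0) :
    AnalyticOnNhd ℂ f U := by
  intro c hcU
  let e := EuclideanSpace.equiv (Fin n) ℂ
  have hopen : IsOpen (e.symm ⁻¹' U) := hU.preimage e.symm.continuous
  obtain ⟨R, hR, hRU⟩ := nhds_basis_closedBall.mem_iff.1
    (hopen.mem_nhds (show e c ∈ e.symm ⁻¹' U by simpa using hcU))
  have h1 : AnalyticAt ℂ (f ∘ e.symm) (e c) := by
    refine analyticAt_of_continuousOn_of_line hR
      (hc.comp e.symm.continuous.continuousOn fun x hx => hRU hx) fun z hz v => ?_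
    have := hd (e.symm z) (hRU hz) (e.symm v)
    simpa using this
  have h2 := h1.comp (e.toContinuousLinearMap.analyticAt c)
  refine h2.congr (Filter.Eventually.of_forall fun x => ?_)
  simp

/-- Holomorphic functions on open subsets of `ℂⁿ` are analytic. -/
theorem DifferentiableOn.analyticOnNhd_cn [CompleteSpace E] {n : ℕ} {f : Cn n → E}
    {U : Set (Cn n)} (hU : IsOpen U) (hf : DifferentiableOn ℂ f U) : AnalyticOnNhd ℂ f U := by
  refine analyticOnNhd_of_continuousOn_of_line hU hf.continuousOn fun z hz v => ?_
  have h : DifferentiableAt ℂ f (z + (0 : ℂ) • v) := by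
    simpa using hf.differentiableAt (hU.mem_nhds hz)
  exact h.comp (0 : ℂ) (by fun_prop)

/-- A normally convergent series of holomorphic functions of several variables is holomorphic. -/
theorem differentiableOn_tsum_cn [CompleteSpace E] {n : ℕ} {f : ℕ → Cn n → E} {U : Set (Cn n)}
    (hU : IsOpen U) {u : ℕ → ℝ} (hu : Summable u) (hf : ∀ k, DifferentiableOn ℂ (f k) U)
    (hb : ∀ k, ∀ z ∈ U, ‖f k z‖ ≤ u k) : DifferentiableOn ℂ (fun z => ∑' k, f k z) U := by
  refine (analyticOnNhd_of_continuousOn_of_line hU ?_ fun z hz v => ?_).differentiableOn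
  · exact continuousOn_tsum (fun k => (hf k).continuousOn) hu hb
  -- On a complex line the sum is a normally convergent series in one variable.
  · have hV : IsOpen ((fun t : ℂ => z + t • v) ⁻¹' U) := hU.preimage (by fun_prop)
    refine (Complex.differentiableOn_tsum_of_summable_norm
      (F := fun k (t : ℂ) => f k (z + t • v)) hu (fun k => ?_) hV
      (fun k t ht => hb k _ ht)).differentiableAt (hV.mem_nhds (by simpa using hz))
    exact (hf k).comp (by fun_prop) fun t ht => ht

end Osgood

/-! ### Lie groups of transformations in a finite-dimensional space of maps -/

section CompositionMonoid

variable {n : ℕ}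

/-- A finite-dimensional vector space of analytic maps `ℂⁿ → ℂⁿ` that contains the identity and is
closed under composition. -/
structure IsCompositionMonoid (V : Submodule ℂ (Cn n → Cn n)) : Prop where
  finiteDimensional : FiniteDimensional ℂ V
  id_mem : id ∈ V
  comp_mem : ∀ P ∈ V, ∀ Q ∈ V, P ∘ Q ∈ V
  contDiff : ∀ P ∈ V, ContDiff ℂ ω P

variable {V : Submodule ℂ (Cn n → Cn n)}

/-- Composition on the right with an element of `V`, as a linear endomorphism of `V`. -/
def IsCompositionMonoid.compRight (hV : IsCompositionMonoid V) (Q : V) : V →ₗ[ℂ] V where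
  toFun P := ⟨(P : Cn n → Cn n) ∘ Q, hV.comp_mem _ P.2 _ Q.2⟩
  map_add' _ _ := rfl
  map_smul' _ _ := rfl

/-- The hypothesis `hinj` is injectivity of right composition with Q on the finite-dimensional space
V. Surjectivity follows and yields P with P∘Q = id. Then Q∘P - id is killed by right composition
with Q, so P is a two-sided inverse. -/
lemma IsCompositionMonoid.exists_perm (hV : IsCompositionMonoid V) {Q : Cn n → Cn n} (hQ : Q ∈ V)
    (hinj : ∀ A ∈ V, (∀ z, A (Q z) = 0) → A = 0) :
    ∃ g : Equiv.Perm (Cn n), (g : Cn n → Cn n) = Q ∧ ((g⁻¹ : Equiv.Perm _) : Cn n → Cn n) ∈ V := by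
  have := hV.finiteDimensional
  have hi : Function.Injective (hV.compRight ⟨Q, hQ⟩) := by
    rw [← LinearMap.ker_eq_bot, LinearMap.ker_eq_bot']
    intro A hA
    exact Subtype.ext (hinj A A.2 fun z => congrFun (congrArg Subtype.val hA) z)
  obtain ⟨P, hP⟩ := LinearMap.injective_iff_surjective.1 hi ⟨id, hV.id_mem⟩
  have h1 : ∀ z, (P : Cn n → Cn n) (Q z) = z := fun z => congrFun (congrArg Subtype.val hP) z
  have h2 : Q ∘ (P : Cn n → Cn n) - id = 0 := by
    refine hinj _ (V.sub_mem (hV.comp_mem _ hQ _ P.2) hV.id_mem) fun z => ?_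
    simp [h1]
  refine ⟨⟨Q, P, h1, fun z => sub_eq_zero.1 (congrFun h2 z)⟩, rfl, P.2⟩

lemma IsCompositionMonoid.inv_mem (hV : IsCompositionMonoid V) {g : Equiv.Perm (Cn n)}
    (hg : (g : Cn n → Cn n) ∈ V) :
    ((g⁻¹ : Equiv.Perm _) : Cn n → Cn n) ∈ V := by
  obtain ⟨g', h, h'⟩ := hV.exists_perm hg fun A _ h => by
    funext z
    simpa using h (g.symm z)
  rwa [← DFunLike.coe_injective h]

/-- The group of bijections in `V` is a complex Lie group that acts holomorphically on `ℂⁿ`. -/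
theorem IsCompositionMonoid.exists_lieGroup (hV : IsCompositionMonoid V)
    {G : Subgroup (Equiv.Perm (Cn n))}
    (hG : ∀ g, g ∈ G ↔ (g : Cn n → Cn n) ∈ V) :
    ∃ (m : ℕ) (_ : TopologicalSpace G) (_ : ChartedSpace (Cn m) G),
      T2Space G ∧ SecondCountableTopology G ∧ LieGroup 𝓘(ℂ, Cn m) ω G ∧
      ContMDiff (𝓘(ℂ, Cn m).prod 𝓘(ℂ, Cn n)) 𝓘(ℂ, Cn n) ω
        (fun p : G × Cn n => (p.1 : Equiv.Perm (Cn n)) p.2) := by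
  have := hV.finiteDimensional
  let m := Module.finrank ℂ V
  let κ : V ≃ₗ[ℂ] Cn m := LinearEquiv.ofFinrankEq _ _ (by simp [m])
  let bas : Module.Basis (Fin m) ℂ V := (EuclideanSpace.basisFun (Fin m) ℂ).toBasis.map κ.symm
  have hκ : ∀ x : Cn m, κ.symm x = ∑ j, x j • bas j := by
    intro x
    apply κ.injective
    rw [LinearEquiv.apply_symm_apply, map_sum]
    simp only [map_smul, bas, Module.Basis.map_apply, LinearEquiv.apply_symm_apply]
    simpa using ((EuclideanSpace.basisFun (Fin m) ℂ).sum_repr x).symm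
  -- evaluation
  have hev : ContDiff ℂ ω (fun p : Cn m × Cn n => (κ.symm p.1 : Cn n → Cn n) p.2) := by
    have : (fun p : Cn m × Cn n => (κ.symm p.1 : Cn n → Cn n) p.2) =
        fun p => ∑ j, p.1 j • (bas j : Cn n → Cn n) p.2 := by
      funext p
      rw [hκ]
      simp
    rw [this]
    refine ContDiff.sum fun j _ => ContDiff.fun_smul ?_ ?_
    · exact (EuclideanSpace.proj (𝕜 := ℂ) j).contDiff.comp contDiff_fst
    · exact (hV.contDiff _ (bas j).2).comp contDiff_snd
  -- composition
  let mult : Cn m × Cn m → Cn m := fun p => κ (hV.compRight (κ.symm p.2) (κ.symm p.1))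
  -- Evaluations of coordinates at points separate the elements of V, hence span its dual.
  -- Analyticity of composition therefore only has to be tested after evaluation at a point.
  have hspan : Submodule.span ℂ (Set.range fun p : Cn n × Fin n =>
      ((EuclideanSpace.proj (𝕜 := ℂ) p.2 : Cn n →ₗ[ℂ] ℂ) ∘ₗ LinearMap.proj p.1 ∘ₗ V.subtype :
        Module.Dual ℂ V)) = ⊤ := by
    refine Submodule.span_eq_top_of_ne_zero fun P hP => ?_
    by_contra! hcon
    refine hP (Subtype.ext ?_)
    funext z
    ext i
    simpa using hcon _ ⟨(z, i), rfl⟩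
  have hmultℓ : ∀ ℓ : Module.Dual ℂ V, ContDiff ℂ ω
      (fun p : Cn m × Cn m => ℓ (hV.compRight (κ.symm p.2) (κ.symm p.1))) := by
    intro ℓ
    have hℓ : ℓ ∈ (⊤ : Submodule ℂ (Module.Dual ℂ V)) := trivial
    rw [← hspan] at hℓ
    induction hℓ using Submodule.span_induction with
    | mem ℓ h =>
      obtain ⟨⟨z, i⟩, rfl⟩ := h
      have h1 : ContDiff ℂ ω (fun p : Cn m × Cn m =>
          (κ.symm p.1 : Cn n → Cn n) ((κ.symm p.2 : Cn n → Cn n) z)) :=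
        hev.comp (contDiff_fst.prodMk (hev.comp (contDiff_snd.prodMk contDiff_const)))
      exact (EuclideanSpace.proj (𝕜 := ℂ) i).contDiff.comp h1
    | zero => exact contDiff_const
    | add ℓ₁ ℓ₂ _ _ h1 h2 => exact h1.add h2
    | smul a ℓ _ h => exact contDiff_const.smul h
  have hmult : ContDiff ℂ ω mult := by
    rw [contDiff_euclidean]
    intro i
    exact hmultℓ ((EuclideanSpace.proj (𝕜 := ℂ) i : Cn m →ₗ[ℂ] ℂ) ∘ₗ κ.toLinearMap)
  -- right composition operators
  let ρ : Cn m → (Cn m →L[ℂ] Cn m) := fun x =>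
    LinearMap.toContinuousLinearMap (κ.toLinearMap ∘ₗ hV.compRight (κ.symm x) ∘ₗ κ.symm.toLinearMap)
  have hρmult : ∀ x y, ρ x y = mult (y, x) := fun x y => rfl
  have hρ : ContDiff ℂ ω ρ := by
    rw [contDiff_clm_apply_iff]
    intro y
    exact hmult.comp (contDiff_const.prodMk contDiff_id)
  -- the chart
  let emb : G → Cn m := fun g => κ ⟨g.1, (hG _).1 g.2⟩
  have hemb_mul : ∀ g h : G, emb (g * h) = mult (emb g, emb h) := by
    intro g h
    simp only [emb, mult, LinearEquiv.symm_apply_apply]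
    rfl
  have hκemb : ∀ g : G, (κ.symm (emb g) : Cn n → Cn n) = g.1 := by
    intro g
    simp [emb]
  have hemb_inj : Function.Injective emb := by
    intro g h hgh
    apply Subtype.ext
    apply DFunLike.coe_injective
    exact congrArg Subtype.val (κ.injective hgh)
  have hρone : ∀ y, ρ (emb 1) y = y := by
    intro y
    apply κ.symm.injective
    simp only [hρmult, mult, LinearEquiv.symm_apply_apply]
    apply Subtype.ext
    change (κ.symm y : Cn n → Cn n) ∘ (κ.symm (emb 1) : Cn n → Cn n) = _
    rw [hκemb]
    rfl
  have hρmul : ∀ g h : G, ρ (emb (g * h)) = ρ (emb h) * ρ (emb g) := by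
    intro g h
    ext1 y
    rw [mul_apply_eq_comp]
    apply κ.symm.injective
    simp only [hρmult, mult, LinearEquiv.symm_apply_apply]
    apply Subtype.ext
    change (κ.symm y : Cn n → Cn n) ∘ (κ.symm (emb (g * h)) : Cn n → Cn n) =
      ((κ.symm y : Cn n → Cn n) ∘ (κ.symm (emb g) : Cn n → Cn n)) ∘
        (κ.symm (emb h) : Cn n → Cn n)
    simp only [hκemb]
    rfl
  have hρ1 : ρ (emb 1) = 1 := by
    ext1 y
    exact hρone y
  let U : G → (Cn m →L[ℂ] Cn m)ˣ := fun g =>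
    ⟨ρ (emb g), ρ (emb g⁻¹), by rw [← hρmul, inv_mul_cancel, hρ1],
      by rw [← hρmul, mul_inv_cancel, hρ1]⟩
  -- Membership in G is invertibility of the right composition operator. The units are open and `ρ`
  -- is continuous, so the image of `emb` is open.
  have hrange : Set.range emb = ρ ⁻¹' {u | IsUnit u} := by
    ext x
    constructor
    · rintro ⟨g, rfl⟩
      exact ⟨U g, rfl⟩
    · rintro ⟨u, hu⟩
      have hinj : Function.Injective (ρ x) := by
        intro y y' h
        have h' := congrArg (fun y => (↑u⁻¹ : Cn m →L[ℂ] Cn m) y) h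
        simp only [← hu, ← mul_apply_eq_comp, Units.inv_mul] at h'
        simpa using h'
      obtain ⟨g, hg, hg'⟩ := hV.exists_perm (κ.symm x).2 (by
        intro A hA hAz
        have h0 : ρ x (κ ⟨A, hA⟩) = ρ x 0 := by
          rw [map_zero]
          change κ (hV.compRight (κ.symm x) (κ.symm (κ ⟨A, hA⟩))) = 0
          rw [LinearEquiv.symm_apply_apply, LinearEquiv.map_eq_zero_iff]
          exact Subtype.ext (funext hAz)
        have h1 := hinj h0
        rw [LinearEquiv.map_eq_zero_iff] at h1
        exact congrArg Subtype.val h1)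
      refine ⟨⟨g, (hG g).2 (hg ▸ (κ.symm x).2)⟩, ?_⟩
      apply κ.symm.injective
      apply Subtype.ext
      rw [hκemb]
      exact hg
  let top : TopologicalSpace G := TopologicalSpace.induced emb inferInstance
  have hind : Topology.IsEmbedding emb := ⟨⟨rfl⟩, hemb_inj⟩
  have hopen : Topology.IsOpenEmbedding emb :=
    ⟨hind, by rw [hrange]; exact Units.isOpen.preimage hρ.continuous⟩
  let cs : ChartedSpace (Cn m) G := hopen.singletonChartedSpace
  have hsm : ContMDiff 𝓘(ℂ, Cn m) 𝓘(ℂ, Cn m) ω emb := contMDiff_isOpenEmbedding hopen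
  refine ⟨m, top, cs, hind.t2Space, hind.secondCountableTopology, ?_, ?_⟩
  · have hman : IsManifold 𝓘(ℂ, Cn m) ω G := hopen.isManifold_singleton
    refine { hman with contMDiff_mul := ?_, contMDiff_inv := ?_ }
    · apply ContMDiff.of_comp_isOpenEmbedding hopen
      have : emb ∘ (fun p : G × G => p.1 * p.2) = mult ∘ fun p : G × G => (emb p.1, emb p.2) := by
        funext p
        exact hemb_mul _ _
      rw [this]
      exact hmult.contMDiff.comp
        ((hsm.comp contMDiff_fst).prodMk_space (hsm.comp contMDiff_snd))
    · apply ContMDiff.of_comp_isOpenEmbedding hopen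
      -- The inverse of g is the element whose right composition with g is the identity, so
      -- inversion in G reduces to inversion of operators, which is analytic.
      have : emb ∘ (fun g : G => g⁻¹) =
          (fun x : Cn m => Ring.inverse (ρ x) (emb 1)) ∘ emb := by
        funext g
        simp only [Function.comp_apply]
        have h1 : Ring.inverse (ρ (emb g)) = ρ (emb g⁻¹) := Ring.inverse_unit (U g)
        rw [h1, hρmult, ← hemb_mul, one_mul]
      rw [this]
      refine fun g => ContMDiffAt.comp g ?_ (hsm g)
      rw [contMDiffAt_iff_contDiffAt]
      refine ContDiffAt.clm_apply ?_ contDiffAt_const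
      exact (contDiffAt_ringInverse ℂ (U g)).comp (emb g) hρ.contDiffAt
  · have : (fun p : G × Cn n => (p.1 : Equiv.Perm (Cn n)) p.2) =
        (fun p : Cn m × Cn n => (κ.symm p.1 : Cn n → Cn n) p.2) ∘
          fun p : G × Cn n => (emb p.1, p.2) := by
      funext p
      simp only [Function.comp_apply, hκemb]
    rw [this]
    exact hev.contMDiff.comp ((hsm.comp contMDiff_fst).prodMk_space contMDiff_snd)

end CompositionMonoid

/-! ### Bases adapted to the decomposition into generalized eigenspaces -/

section AdaptedBasis

variable {n : ℕ}

/-- A basis of `ℂⁿ` that consists of generalized eigenvectors of `L`, compatible with the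
decomposition of `ℂⁿ` into the generalized eigenspaces. -/
structure AdaptedBasis (L : Module.End ℂ (Cn n)) (ι : Type) where
  /-- the basis -/
  basis : Module.Basis ι ℂ (Cn n)
  /-- the eigenvalue of each basis vector -/
  ev : ι → L.Eigenvalues
  mem : ∀ k, basis k ∈ L.maxGenEigenspace (ev k : ℂ)
  repr_eq_zero : ∀ (j : L.Eigenvalues) (t : Cn n), t ∈ L.maxGenEigenspace (j : ℂ) →
    ∀ k, ev k ≠ j → basis.repr t k = 0

theorem exists_adaptedBasis (L : Module.End ℂ (Cn n)) :
    ∃ (ι : Type) (_ : Fintype ι), Nonempty (AdaptedBasis L ι) := by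
  classical
  let A : L.Eigenvalues → Submodule ℂ (Cn n) := fun j => L.maxGenEigenspace (j : ℂ)
  have hind : iSupIndep A := L.independent_maxGenEigenspace.comp Subtype.val_injective
  have htop : ⨆ j, A j = ⊤ := by
    rw [eq_top_iff, ← L.iSup_maxGenEigenspace_eq_top]
    refine iSup_le fun μ => ?_
    by_cases h : L.maxGenEigenspace μ = ⊥
    · rw [h]
      exact bot_le
    · have h1 : L.HasUnifEigenvalue μ ⊤ := h
      exact le_iSup A ⟨μ, h1.lt zero_lt_one⟩
  have hint := DirectSum.isInternal_submodule_of_iSupIndep_of_iSup_eq_top hind htop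
  let v : ∀ j, Module.Basis (Fin (Module.finrank ℂ (A j))) ℂ (A j) := fun j => Module.finBasis ℂ _
  let b := hint.collectedBasis v
  have hfin : Finite (Σ j : L.Eigenvalues, Fin (Module.finrank ℂ (A j))) :=
    Module.Finite.finite_basis b
  let e := Finite.equivFin (Σ j : L.Eigenvalues, Fin (Module.finrank ℂ (A j)))
  refine ⟨_, inferInstance, ⟨⟨b.reindex e, fun k => (e.symm k).1, fun k => ?_,
    fun j t ht k hk => ?_⟩⟩⟩
  · rw [Module.Basis.reindex_apply]
    exact hint.collectedBasis_mem v _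
  · rw [Module.Basis.repr_reindex_apply]
    exact hint.collectedBasis_repr_of_mem_ne v (Ne.symm hk) ht

variable {L : Module.End ℂ (Cn n)} {ι : Type} (b : AdaptedBasis L ι)

namespace AdaptedBasis

lemma repr_sum_smul (a : L.Eigenvalues → ℂ) (t : L.Eigenvalues → Cn n)
    (ht : ∀ j : L.Eigenvalues, t j ∈ L.maxGenEigenspace (j : ℂ)) (k : ι) :
    b.basis.repr (∑ j, a j • t j) k = a (b.ev k) * b.basis.repr (∑ j, t j) k := by
  classical
  have h : ∀ c : L.Eigenvalues → ℂ, b.basis.repr (∑ j, c j • t j) k =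
      c (b.ev k) * b.basis.repr (t (b.ev k)) k := by
    intro c
    rw [map_sum, Finsupp.finsetSum_apply, Finset.sum_eq_single (b.ev k)]
    · simp
    · intro j _ hj
      simp [b.repr_eq_zero j (t j) (ht j) k hj.symm]
    · simp
  have h1 := h fun _ => 1
  simp only [one_smul, one_mul] at h1
  rw [h a, h1]

lemma contDiff_eval_repr (p : MvPolynomial ι ℂ) :
    ContDiff ℂ ω fun z : Cn n => MvPolynomial.eval (b.basis.repr z) p := by
  induction p using MvPolynomial.induction_on with
  | C a => simpa using contDiff_const
  | add p q hp hq => simpa using hp.add hq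
  | mul_X p k hp =>
    simp only [map_mul, MvPolynomial.eval_X]
    exact hp.mul (LinearMap.toContinuousLinearMap (b.basis.coord k)).contDiff

/-- The weight of a coordinate. -/
noncomputable def weight (k : ι) : ℝ := -Real.log ‖(b.ev k : ℂ)‖

end AdaptedBasis

end AdaptedBasis

/-! ### Polynomials of bounded weight -/

section BoundedWeight

variable {ι : Type} [Fintype ι] (w : ι → ℝ)

/-- The polynomials all of whose monomials have weight at most `c`. -/
noncomputable def boundedWeight (c : ℝ) : Submodule ℂ (MvPolynomial ι ℂ) :=
  MvPolynomial.restrictSupport ℂ {α | ∑ k, (α k : ℝ) * w k ≤ c}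

variable {w}

lemma boundedWeight_mono {c d : ℝ} (h : c ≤ d) : boundedWeight w c ≤ boundedWeight w d :=
  fun _ hp _ hα => (hp hα).trans h

lemma X_mem_boundedWeight (k : ι) : MvPolynomial.X k ∈ boundedWeight w (w k) := by
  classical
  refine (MvPolynomial.monomial_mem_restrictSupport ℂ).2 (Or.inl ?_)
  simp [Finsupp.single_apply]

lemma C_mem_boundedWeight {c : ℝ} (hc : 0 ≤ c) (a : ℂ) :
    MvPolynomial.C a ∈ boundedWeight w c :=
  (MvPolynomial.monomial_mem_restrictSupport ℂ).2 (Or.inl (by simpa using hc))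

lemma mul_mem_boundedWeight {c d : ℝ} {p q : MvPolynomial ι ℂ} (hp : p ∈ boundedWeight w c)
    (hq : q ∈ boundedWeight w d) : p * q ∈ boundedWeight w (c + d) := by
  classical
  intro α hα
  obtain ⟨β, hβ, γ, hγ, rfl⟩ := Finset.mem_add.1 (MvPolynomial.support_mul p q hα)
  have h1 := hp hβ
  have h2 := hq hγ
  simp only [Set.mem_ofPred_eq] at h1 h2 ⊢
  simp only [Finsupp.add_apply, Nat.cast_add, add_mul, Finset.sum_add_distrib]
  exact add_le_add h1 h2

lemma prod_mem_boundedWeight {κ : Type*} (s : Finset κ) (c : κ → ℝ) (p : κ → MvPolynomial ι ℂ)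
    (hp : ∀ k ∈ s, p k ∈ boundedWeight w (c k)) :
    ∏ k ∈ s, p k ∈ boundedWeight w (∑ k ∈ s, c k) := by
  classical
  induction s using Finset.induction_on with
  | empty => simpa using C_mem_boundedWeight (w := w) le_rfl 1
  | insert k s hk ih =>
    rw [Finset.prod_insert hk, Finset.sum_insert hk]
    exact mul_mem_boundedWeight (hp k (by simp)) (ih fun j hj => hp j (by simp [hj]))

lemma pow_mem_boundedWeight {c : ℝ} {p : MvPolynomial ι ℂ} (hp : p ∈ boundedWeight w c) (m : ℕ) :
    p ^ m ∈ boundedWeight w (m * c) := by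
  simpa using prod_mem_boundedWeight (Finset.range m) (fun _ => c) (fun _ => p) fun _ _ => hp

/-- A monomial of exponent α becomes a product of weight at most ∑ α_k w_k, the weight it had
before. This is why sub-resonance survives composition. -/
lemma bind₁_mem_boundedWeight {c : ℝ} {p : MvPolynomial ι ℂ} (hp : p ∈ boundedWeight w c)
    {q : ι → MvPolynomial ι ℂ} (hq : ∀ k, q k ∈ boundedWeight w (w k)) :
    MvPolynomial.bind₁ q p ∈ boundedWeight w c := by
  rw [p.as_sum, map_sum]
  refine Submodule.sum_mem _ fun α hα => ?_
  rw [MvPolynomial.bind₁_monomial, ← MvPolynomial.smul_eq_C_mul]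
  refine Submodule.smul_mem _ _ ?_
  refine boundedWeight_mono (le_of_eq_of_le ?_ (hp hα))
    (prod_mem_boundedWeight _ _ _ fun k _ => pow_mem_boundedWeight (hq k) _)
  exact Finset.sum_subset (Finset.subset_univ _) fun k _ hk => by
    simp [Finsupp.notMem_support_iff.1 hk]

/-- Each exponent is at most c / w_k, so only finitely many monomials qualify. -/
lemma finiteDimensional_boundedWeight (hw : ∀ k, 0 < w k) (c : ℝ) :
    FiniteDimensional ℂ (boundedWeight w c) := by
  have hfin : {α : ι →₀ ℕ | ∑ k, (α k : ℝ) * w k ≤ c}.Finite := by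
    classical
    refine ((Set.finite_Iic (fun k => ⌊c / w k⌋₊)).preimage
      (DFunLike.coe_injective (F := ι →₀ ℕ)).injOn).subset fun α hα k => ?_
    apply Nat.le_floor
    rw [le_div_iff₀ (hw k)]
    refine le_trans ?_ hα
    exact Finset.single_le_sum (f := fun k => (α k : ℝ) * w k)
      (fun j _ => mul_nonneg (Nat.cast_nonneg _) (hw j).le) (Finset.mem_univ k)
  have := hfin.to_subtype
  exact Module.Finite.of_basis (MvPolynomial.basisRestrictSupport ℂ _)

end BoundedWeight

/-! ### The sub-resonant transformation group -/

section WeightedMaps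

variable {n : ℕ} {L : Module.End ℂ (Cn n)} {ι : Type} [Fintype ι] (b : AdaptedBasis L ι)

/-- The polynomial maps whose coordinates have weights bounded by those of the basis vectors. -/
noncomputable def weightedMaps : Submodule ℂ (Cn n → Cn n) where
  carrier := {P | ∀ i, ∃ p ∈ boundedWeight b.weight (b.weight i),
    ∀ z, b.basis.repr (P z) i = MvPolynomial.eval (b.basis.repr z) p}
  zero_mem' i := ⟨0, Submodule.zero_mem _, by simp⟩
  add_mem' := by
    intro P Q hP hQ i
    obtain ⟨p, hp, hp'⟩ := hP i
    obtain ⟨q, hq, hq'⟩ := hQ i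
    exact ⟨p + q, Submodule.add_mem _ hp hq, by simp [hp', hq']⟩
  smul_mem' := by
    intro a P hP i
    obtain ⟨p, hp, hp'⟩ := hP i
    exact ⟨a • p, Submodule.smul_mem _ a hp, by simp [hp', MvPolynomial.smul_eval]⟩

variable {b}

lemma eval_bind₁' {σ τ : Type*} (x : τ → ℂ) (q : σ → MvPolynomial τ ℂ) (p : MvPolynomial σ ℂ) :
    MvPolynomial.eval x (MvPolynomial.bind₁ q p) =
      MvPolynomial.eval (fun k => MvPolynomial.eval x (q k)) p :=
  MvPolynomial.eval₂Hom_bind₁ _ _ _ _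

lemma const_mem_weightedMaps (hw : ∀ k, 0 < b.weight k) (τ : Cn n) :
    (fun _ => τ) ∈ weightedMaps b := fun i =>
  ⟨MvPolynomial.C (b.basis.repr τ i), C_mem_boundedWeight (hw i).le _, by simp⟩

lemma isCompositionMonoid_weightedMaps (hw : ∀ k, 0 < b.weight k) :
    IsCompositionMonoid (weightedMaps b) where
  finiteDimensional := by
    have := fun i => finiteDimensional_boundedWeight hw (b.weight i)
    let Ψ : (∀ i, boundedWeight b.weight (b.weight i)) →ₗ[ℂ] (Cn n → Cn n) :=
      { toFun := fun p z => ∑ i, MvPolynomial.eval (b.basis.repr z) (p i).1 • b.basis i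
        map_add' := fun p q => by
          funext z
          simp [add_smul, Finset.sum_add_distrib]
        map_smul' := fun a p => by
          funext z
          simp [MvPolynomial.smul_eval, mul_smul, Finset.smul_sum] }
    refine Submodule.finiteDimensional_of_le (S₂ := LinearMap.range Ψ) fun P hP => ?_
    choose p hp hp' using hP
    refine ⟨fun i => ⟨p i, hp i⟩, ?_⟩
    funext z
    change ∑ i, MvPolynomial.eval (b.basis.repr z) (p i) • b.basis i = P z
    simp only [← hp']
    exact b.basis.sum_repr (P z)
  id_mem i := ⟨MvPolynomial.X i, X_mem_boundedWeight i, by simp⟩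
  comp_mem P hP Q hQ := by
    choose q hq hq' using hQ
    intro i
    obtain ⟨p, hp, hp'⟩ := hP i
    refine ⟨MvPolynomial.bind₁ q p, bind₁_mem_boundedWeight hp hq, fun z => ?_⟩
    rw [eval_bind₁', Function.comp_apply, hp']
    simp only [← hq']
  contDiff P hP := by
    choose p hp hp' using hP
    have : P = fun z => ∑ i, MvPolynomial.eval (b.basis.repr z) (p i) • b.basis i := by
      funext z
      simp only [← hp']
      exact (b.basis.sum_repr (P z)).symm
    rw [this]
    exact ContDiff.sum fun i _ => (b.contDiff_eval_repr _).fun_smul contDiff_const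

lemma AdaptedBasis.log_prod (h0 : ∀ j : L.Eigenvalues, (j : ℂ) ≠ 0) (α : ι →₀ ℕ) :
    Real.log ‖∏ k, (b.ev k : ℂ) ^ α k‖ = -∑ k, (α k : ℝ) * b.weight k := by
  rw [norm_prod, Real.log_prod fun k _ => norm_ne_zero_iff.2 (pow_ne_zero _ (h0 _)),
    ← Finset.sum_neg_distrib]
  refine Finset.sum_congr rfl fun k _ => ?_
  rw [norm_pow, Real.log_pow, AdaptedBasis.weight]
  ring

lemma exists_eval_repr_eq_of_isPolynomialMap {Q : Cn n → Cn n} (hQ : IsPolynomialMap Q)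
    (i : ι) : ∃ p : MvPolynomial ι ℂ, ∀ z,
      b.basis.repr (Q z) i = MvPolynomial.eval (b.basis.repr z) p := by
  choose q hq using hQ
  let e := EuclideanSpace.basisFun (Fin n) ℂ
  let s : Fin n → MvPolynomial ι ℂ := fun l =>
    ∑ m, MvPolynomial.C (b.basis m l) * MvPolynomial.X m
  have hs : ∀ z : Cn n, ∀ l, MvPolynomial.eval (b.basis.repr z) (s l) = z l := by
    intro z l
    have h := congrArg (fun y : Cn n => y l) (b.basis.sum_repr z)
    simp only [WithLp.ofLp_sum, Finset.sum_apply, PiLp.smul_apply, smul_eq_mul] at h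
    simp only [s, map_sum, map_mul, MvPolynomial.eval_C, MvPolynomial.eval_X]
    rw [← h]
    exact Finset.sum_congr rfl fun m _ => mul_comm _ _
  refine ⟨∑ l, MvPolynomial.C (b.basis.repr (e l) i) * MvPolynomial.bind₁ s (q l), fun z => ?_⟩
  have h := e.sum_repr (Q z)
  conv_lhs => rw [← h]
  rw [map_sum, Finsupp.finsetSum_apply, map_sum]
  refine Finset.sum_congr rfl fun l _ => ?_
  rw [map_smul, Finsupp.smul_apply, smul_eq_mul, map_mul, MvPolynomial.eval_C, eval_bind₁']
  simp only [hs, ← hq]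
  rw [mul_comm]
  simp [e]

/-- A diagonal substitution multiplies each monomial by a scalar, so a homogeneity identity can be
read off one coefficient at a time. -/
lemma coeff_bind₁_C_mul_X (a : ι → ℂ) (p : MvPolynomial ι ℂ) (α : ι →₀ ℕ) :
    MvPolynomial.coeff α (MvPolynomial.bind₁
      (fun k => MvPolynomial.C (a k) * MvPolynomial.X k) p) =
      (∏ k, a k ^ α k) * MvPolynomial.coeff α p := by
  classical
  induction p using MvPolynomial.induction_on' with
  | monomial β c =>
    have : MvPolynomial.bind₁ (fun k => MvPolynomial.C (a k) * MvPolynomial.X k)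
        (MvPolynomial.monomial β c) = MvPolynomial.monomial β ((∏ k, a k ^ β k) * c) := by
      rw [MvPolynomial.bind₁_monomial]
      simp only [mul_pow, Finset.prod_mul_distrib, ← map_pow, ← map_prod]
      rw [MvPolynomial.monomial_eq, mul_comm (∏ k, a k ^ β k) c, map_mul, Finsupp.prod, mul_assoc]
      congr 3
      exact Finset.prod_subset (Finset.subset_univ _) fun k _ hk => by
        simp [Finsupp.notMem_support_iff.1 hk]
    rw [this]
    simp only [MvPolynomial.coeff_monomial]
    split_ifs with h
    · rw [h]
    · simp
  | add p q hp hq => rw [map_add, MvPolynomial.coeff_add, MvPolynomial.coeff_add, hp, hq, mul_add]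

/-- Homogeneity is tested on a single choice of scalars, a_j = j, the eigenvalues themselves. Each
monomial α that occurs then satisfies ∏ λ_k^{α_k} = ∏ λ_j^{s_j}, and logarithms of moduli turn the
sub-resonance inequality into the weight bound. -/
lemma subResonantTerm_mem_weightedMaps (h0 : ∀ j : L.Eigenvalues, (j : ℂ) ≠ 0)
    {Q : Cn n → Cn n} (hQ : IsSubResonantTerm L Q) : Q ∈ weightedMaps b := by
  obtain ⟨hpoly, -, i, s, hi, hs, hle⟩ := hQ
  intro k
  by_cases hk : b.ev k = i
  swap
  · exact ⟨0, Submodule.zero_mem _, fun z => by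
      rw [b.repr_eq_zero i _ (hi z) k hk, map_zero]⟩
  obtain ⟨p, hp⟩ := exists_eval_repr_eq_of_isPolynomialMap (b := b) hpoly k
  refine ⟨p, fun α hα => ?_, hp⟩
  have hscale : ∀ a : L.Eigenvalues → ℂ,
      MvPolynomial.bind₁ (fun m => MvPolynomial.C (a (b.ev m)) * MvPolynomial.X m) p =
        MvPolynomial.C (∏ j, a j ^ s j) * p := by
    classical
    intro a
    refine MvPolynomial.funext fun x => ?_
    let t : L.Eigenvalues → Cn n := fun j => ∑ m with b.ev m = j, x m • b.basis m
    have ht : ∀ j : L.Eigenvalues, t j ∈ L.maxGenEigenspace (j : ℂ) := fun j =>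
      Submodule.sum_mem _ fun m hm => Submodule.smul_mem _ _ (by
        rw [← (Finset.mem_filter.1 hm).2]
        exact b.mem m)
    have hsum : ∀ m, b.basis.repr (∑ j, t j) m = x m := by
      intro m
      have : ∑ j, t j = ∑ m, x m • b.basis m :=
        Finset.sum_fiberwise Finset.univ b.ev fun m => x m • b.basis m
      rw [this, b.basis.repr_sum_self]
    have h := congrArg (fun y => b.basis.repr y k) (hs a t ht)
    simp only [map_smul, Finsupp.smul_apply, smul_eq_mul, hp] at h
    rw [eval_bind₁', map_mul, MvPolynomial.eval_C]
    have e1 : (fun m => MvPolynomial.eval x (MvPolynomial.C (a (b.ev m)) * MvPolynomial.X m)) =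
        b.basis.repr (∑ j, a j • t j) := by
      funext m
      rw [b.repr_sum_smul a t ht, hsum]
      simp
    have e2 : x = b.basis.repr (∑ j, t j) := (funext hsum).symm
    rw [e1, h, ← e2]
  have hc := congrArg (MvPolynomial.coeff α) (hscale fun j => (j : ℂ))
  rw [coeff_bind₁_C_mul_X (fun m => (b.ev m : ℂ)), MvPolynomial.coeff_C_mul] at hc
  have hc' := mul_right_cancel₀ (MvPolynomial.mem_support_iff.1 hα) hc
  have hlog := congrArg (fun x : ℂ => Real.log ‖x‖) hc'
  rw [AdaptedBasis.log_prod h0, norm_prod,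
    Real.log_prod fun j _ => norm_ne_zero_iff.2 (pow_ne_zero _ (h0 _))] at hlog
  simp only [norm_pow, Real.log_pow] at hlog
  have hwk : b.weight k = -Real.log ‖(i : ℂ)‖ := by rw [AdaptedBasis.weight, hk]
  simp only [Set.mem_ofPred_eq]
  linarith

lemma SR_le_weightedMaps (h0 : ∀ j : L.Eigenvalues, (j : ℂ) ≠ 0) : SR L ≤ weightedMaps b :=
  Submodule.span_le.2 fun _ hQ => subResonantTerm_mem_weightedMaps h0 hQ

/-- The type s collects, for each eigenvalue j, the exponents of the coordinates belonging to j. The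
condition α ≠ 0 makes the map vanish at the origin. -/
lemma isSubResonantTerm_monomial (h0 : ∀ j : L.Eigenvalues, (j : ℂ) ≠ 0) {α : ι →₀ ℕ} (hα : α ≠ 0)
    {i : ι} (hle : ∑ k, (α k : ℝ) * b.weight k ≤ b.weight i) :
    IsSubResonantTerm L fun z => (∏ k, b.basis.repr z k ^ α k) • b.basis i := by
  classical
  have hprod : ∀ a : L.Eigenvalues → ℂ, ∏ k, a (b.ev k) ^ α k =
      ∏ j, a j ^ (∑ k with b.ev k = j, α k) := by
    intro a
    rw [← Finset.prod_fiberwise Finset.univ b.ev]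
    refine Finset.prod_congr rfl fun j _ => ?_
    rw [← Finset.prod_pow_eq_pow_sum]
    exact Finset.prod_congr rfl fun k hk => by rw [(Finset.mem_filter.1 hk).2]
  refine ⟨fun l => ?_, ?_, b.ev i, fun j => ∑ k with b.ev k = j, α k, fun z => ?_,
    fun a t ht => ?_, ?_⟩
  · let e := EuclideanSpace.basisFun (Fin n) ℂ
    refine ⟨(∏ k, (∑ m, MvPolynomial.C (b.basis.repr (e m) k) * MvPolynomial.X m) ^ α k) *
      MvPolynomial.C (b.basis i l), fun z => ?_⟩
    have h : ∀ k, b.basis.repr z k = ∑ m, b.basis.repr (e m) k * z m := by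
      intro k
      have h := e.sum_repr z
      conv_lhs => rw [← h]
      rw [map_sum, Finsupp.finsetSum_apply]
      refine Finset.sum_congr rfl fun m _ => ?_
      rw [map_smul, Finsupp.smul_apply, smul_eq_mul, mul_comm]
      simp [e]
    simp only [PiLp.smul_apply, smul_eq_mul, map_mul, map_prod, map_pow, map_sum,
      MvPolynomial.eval_C, MvPolynomial.eval_X, h]
  · obtain ⟨k, hk⟩ := Finsupp.ne_iff.1 hα
    beta_reduce
    rw [Finset.prod_eq_zero (Finset.mem_univ k), zero_smul]
    simpa using hk
  · exact Submodule.smul_mem _ _ (b.mem i)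
  · simp only [b.repr_sum_smul a t ht, mul_pow, Finset.prod_mul_distrib, hprod, mul_smul]
  · have h := b.log_prod h0 α
    rw [hprod fun j => (j : ℂ), norm_prod,
      Real.log_prod fun j _ => norm_ne_zero_iff.2 (pow_ne_zero _ (h0 _))] at h
    simp only [norm_pow, Real.log_pow] at h
    rw [h]
    rw [AdaptedBasis.weight] at hle
    linarith

/-- Subtracting the value at 0 from every monomial cancels the constant one and leaves the others
unchanged, so only sub-resonant terms remain. -/
lemma sub_apply_zero_mem_SR (h0 : ∀ j : L.Eigenvalues, (j : ℂ) ≠ 0) {P : Cn n → Cn n}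
    (hP : P ∈ weightedMaps b) : (fun z => P z - P 0) ∈ SR L := by
  classical
  choose p hp hp' using hP
  have hterm : ∀ i, ∀ α ∈ (p i).support, α ≠ 0 →
      (fun z => (∏ k, b.basis.repr z k ^ α k) • b.basis i) ∈ SR L := fun i α hα hα0 =>
    Submodule.subset_span (isSubResonantTerm_monomial h0 hα0 (hp i hα))
  have heval : ∀ i z, MvPolynomial.eval (b.basis.repr z) (p i) =
      ∑ α ∈ (p i).support, MvPolynomial.coeff α (p i) * ∏ k, b.basis.repr z k ^ α k :=
    fun i z => MvPolynomial.eval_eq' _ _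
  have hPz : ∀ z, P z = ∑ i, ∑ α ∈ (p i).support,
      MvPolynomial.coeff α (p i) • ((∏ k, b.basis.repr z k ^ α k) • b.basis i) := by
    intro z
    rw [← b.basis.sum_repr (P z)]
    refine Finset.sum_congr rfl fun i _ => ?_
    rw [hp', heval, Finset.sum_smul]
    simp only [mul_smul]
  have hkey : (fun z => P z - P 0) = ∑ i, ∑ α ∈ (p i).support, MvPolynomial.coeff α (p i) •
      ((fun z => (∏ k, b.basis.repr z k ^ α k) • b.basis i) -
        fun _ => (∏ k, b.basis.repr (0 : Cn n) k ^ α k) • b.basis i : Cn n → Cn n) := by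
    funext z
    rw [hPz z, hPz 0]
    simp only [Finset.sum_apply, Pi.smul_apply, Pi.sub_apply, smul_sub, Finset.sum_sub_distrib]
  rw [hkey]
  refine Submodule.sum_mem _ fun i _ => Submodule.sum_mem _ fun α hα => Submodule.smul_mem _ _ ?_
  by_cases hα0 : α = 0
  · subst hα0
    simp only [Finsupp.coe_zero, Pi.zero_apply, pow_zero, Finset.prod_const_one, sub_self]
    exact Submodule.zero_mem _
  · have hz := (isSubResonantTerm_monomial h0 hα0 (hp i hα)).2.1
    simp only at hz
    rw [hz]
    exact Submodule.sub_mem _ (hterm i α hα hα0) (Submodule.zero_mem _)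

/-- The generators lie in `weightedMaps b`, which is stable under composition and inversion.
Conversely, following g by the translation by -g(0) gives a map in SR*; its derivative at 0 is
invertible by the chain rule, since the inverse of g also lies in `weightedMaps b` and is
holomorphic. -/
theorem mem_subResonantAffineGroup_iff (b : AdaptedBasis L ι)
    (h0 : ∀ j : L.Eigenvalues, (j : ℂ) ≠ 0) (hw : ∀ k, 0 < b.weight k) (g : Equiv.Perm (Cn n)) :
    g ∈ subResonantAffineGroup L ↔ (g : Cn n → Cn n) ∈ weightedMaps b := by
  have hV := isCompositionMonoid_weightedMaps hw
  constructor
  · intro hg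
    induction hg using Subgroup.closure_induction with
    | mem g hg =>
      rcases hg with hg | ⟨τ, rfl⟩
      · exact SR_le_weightedMaps h0 hg.1
      · exact Submodule.add_mem _ hV.id_mem (const_mem_weightedMaps hw τ)
    | one => exact hV.id_mem
    | mul g h _ _ hg hh => exact hV.comp_mem _ hg _ hh
    | inv g _ hg => exact hV.inv_mem hg
  · intro hg
    have hdiff : Differentiable ℂ g := (hV.contDiff _ hg).differentiable (by simp)
    have hdiff' : Differentiable ℂ (g⁻¹ : Equiv.Perm (Cn n)) :=
      (hV.contDiff _ (hV.inv_mem hg)).differentiable (by simp)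
    have hT : ∀ τ : Cn n, Equiv.addRight τ ∈ subResonantAffineGroup L := fun τ =>
      Subgroup.subset_closure (Or.inr ⟨τ, rfl⟩)
    have hmem : Equiv.addRight (-(g 0)) * g ∈ subResonantAffineGroup L := by
      refine Subgroup.subset_closure (Or.inl ?_)
      have hco : ((Equiv.addRight (-(g 0)) * g : Equiv.Perm (Cn n)) : Cn n → Cn n) =
          fun z => g z - g 0 := by
        funext z
        simp [sub_eq_add_neg]
      refine ⟨?_, ?_⟩
      · rw [hco]
        exact sub_apply_zero_mem_SR h0 hg
      · rw [hco, fderiv_sub_const]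
        refine ⟨⟨fderiv ℂ g 0, fderiv ℂ (g⁻¹ : Equiv.Perm (Cn n)) (g 0), ?_, ?_⟩, rfl⟩
        · have h1 := fderiv_comp (𝕜 := ℂ) (g 0) (g := g) (f := (g⁻¹ : Equiv.Perm (Cn n)))
            (hdiff _) (hdiff' _)
          have e : (g : Cn n → Cn n) ∘ (g⁻¹ : Equiv.Perm (Cn n)) = id := by
            funext z
            simp
          have e0 : (g⁻¹ : Equiv.Perm (Cn n)) (g 0) = 0 := by simp
          rw [e, fderiv_id, e0] at h1
          exact h1.symm
        · have h1 := fderiv_comp (𝕜 := ℂ) 0 (g := (g⁻¹ : Equiv.Perm (Cn n))) (f := g)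
            (hdiff' _) (hdiff _)
          have e : ((g⁻¹ : Equiv.Perm (Cn n)) : Cn n → Cn n) ∘ g = id := by
            funext z
            simp
          rw [e, fderiv_id] at h1
          exact h1.symm
    have := Subgroup.mul_mem _ (hT (g 0)) hmem
    convert this using 1
    ext1 z
    simp

theorem isHolomorphicHomogeneousSpace_subResonantAffineGroup (b : AdaptedBasis L ι)
    (h0 : ∀ j : L.Eigenvalues, (j : ℂ) ≠ 0) (hw : ∀ k, 0 < b.weight k) :
    IsHolomorphicHomogeneousSpace (subResonantAffineGroup L) := by
  refine ⟨(isCompositionMonoid_weightedMaps hw).exists_lieGroup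
    (mem_subResonantAffineGroup_iff b h0 hw), fun x y => ?_⟩
  exact ⟨Equiv.addRight (y - x), Subgroup.subset_closure (Or.inr ⟨_, rfl⟩), by simp⟩

end WeightedMaps

/-! ### Local dynamics of a contraction -/

section LocalDynamics

open Filter Set

variable {n : ℕ}

/-- By Gelfand's formula the norms of the powers are eventually bounded by r^m for some r < 1 above
the spectral radius. Dimension 0 is separate because its spectrum is empty. -/
lemma exists_norm_pow_lt (A : Cn n →L[ℂ] Cn n)
    (hA : ∀ μ : ℂ, Module.End.HasEigenvalue (A : Cn n →ₗ[ℂ] Cn n) μ → ‖μ‖ < 1) {ε : ℝ}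
    (hε : 0 < ε) : ∃ m : ℕ, 0 < m ∧ ‖A ^ m‖ < ε := by
  rcases subsingleton_or_nontrivial (Cn n) with h | h
  · refine ⟨1, one_pos, ?_⟩
    have : A ^ 1 = 0 := by
      ext1 z
      exact Subsingleton.elim _ _
    rw [this, norm_zero]
    exact hε
  have hspec : ∀ μ ∈ spectrum ℂ A, ‖μ‖₊ < 1 := by
    intro μ hμ
    have h1 : μ ∈ spectrum ℂ (A : Cn n →ₗ[ℂ] Cn n) := by
      rw [← AlgEquiv.spectrum_eq (Module.End.toContinuousLinearMap (𝕜 := ℂ) (Cn n))]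
      exact hμ
    exact hA μ (Module.End.hasEigenvalue_iff_mem_spectrum.2 h1)
  have hrad : spectralRadius ℂ A < 1 := by
    simpa using spectrum.spectralRadius_lt_of_forall_lt A (r := 1) hspec
  obtain ⟨r, hr1, hr2⟩ := ENNReal.lt_iff_exists_nnreal_btwn.1 hrad
  have hr2' : r < 1 := by exact_mod_cast hr2
  have htend := spectrum.pow_nnnorm_pow_one_div_tendsto_nhds_spectralRadius A
  have hev : ∀ᶠ m : ℕ in atTop, ‖A ^ m‖ ≤ (r : ℝ) ^ m := by
    filter_upwards [htend.eventually_lt_const hr1, eventually_gt_atTop 0] with m hm hm0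
    have hm' : (m : ℝ) ≠ 0 := by exact_mod_cast hm0.ne'
    have h1 : ((‖A ^ m‖₊ : ENNReal) ^ (1 / m : ℝ)) ^ (m : ℝ) ≤ (r : ENNReal) ^ (m : ℝ) :=
      ENNReal.rpow_le_rpow hm.le (by positivity)
    rw [← ENNReal.rpow_mul, one_div, inv_mul_cancel₀ hm', ENNReal.rpow_one,
      ENNReal.rpow_natCast] at h1
    exact_mod_cast h1
  have hpow : Tendsto (fun m : ℕ => (r : ℝ) ^ m) atTop (𝓝 0) :=
    tendsto_pow_atTop_nhds_zero_of_lt_one r.2 (by exact_mod_cast hr2')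
  obtain ⟨m, h1, h2, h3⟩ := (hev.and ((hpow.eventually_lt_const hε).and
    (eventually_gt_atTop 0))).exists
  exact ⟨m, h3, h1.trans_lt h2⟩

/-- An open neighbourhood `B` of the origin that is mapped into itself by `f`, and on which the
iterates of `f` converge geometrically to the origin. -/
structure IsAttractingNhd (f : Cn n → Cn n) (B : Set (Cn n)) (C q : ℝ) : Prop where
  isOpen : IsOpen B
  zero_mem : (0 : Cn n) ∈ B
  norm_le : ∀ z ∈ B, ‖z‖ ≤ 1
  mapsTo : MapsTo f B B
  differentiableOn : DifferentiableOn ℂ f B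
  pos : 0 < q
  lt_one : q < 1
  norm_iterate_le : ∀ k, ∀ z ∈ B, ‖f^[k] z‖ ≤ C * q ^ k * ‖z‖

/-- The derivative need not have norm below 1, but some power A^m has norm below 1/2, so f^m
contracts a small ball by 3/4. Taking for B the points whose first m iterates, counted from 0, stay
in that ball gives an f-invariant set without changing the norm. -/
theorem exists_isAttractingNhd {f : Cn n → Cn n} {U : Set (Cn n)} (hU : IsOpen U)
    (h0 : (0 : Cn n) ∈ U) (hmaps : MapsTo f U U) (hf : DifferentiableOn ℂ f U) (hf0 : f 0 = 0)
    (hA : ∀ μ : ℂ, Module.End.HasEigenvalue (fderiv ℂ f 0 : Cn n →ₗ[ℂ] Cn n) μ → ‖μ‖ < 1) :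
    ∃ (B : Set (Cn n)) (C q : ℝ), B ⊆ U ∧ IsAttractingNhd f B C q := by
  set A := fderiv ℂ f 0
  obtain ⟨m, hm, hAm⟩ := exists_norm_pow_lt A hA (ε := 1 / 2) (by norm_num)
  have hder : HasFDerivAt f A 0 := (hf.differentiableAt (hU.mem_nhds h0)).hasFDerivAt
  have hderk : ∀ k, HasFDerivAt f^[k] (A ^ k) 0 := fun k => hder.iterate hf0 k
  have hfix : ∀ k, f^[k] 0 = 0 := fun k => Function.iterate_fixed hf0 k
  have hbig : ∀ k, ∃ c, ∀ᶠ z in 𝓝 (0 : Cn n), ‖f^[k] z‖ ≤ c * ‖z‖ := by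
    intro k
    obtain ⟨c, hc⟩ := (hderk k).isBigO_sub.bound
    refine ⟨c, ?_⟩
    simpa [hfix k] using hc
  choose c hc using hbig
  have hcontr : ∀ᶠ z in 𝓝 (0 : Cn n), ‖f^[m] z‖ ≤ 3 / 4 * ‖z‖ := by
    have h1 := (hderk m).isLittleO.bound (c := 1 / 4) (by norm_num)
    filter_upwards [h1] with z hz
    simp only [hfix, sub_zero] at hz
    have h2 : ‖(A ^ m) z‖ ≤ 1 / 2 * ‖z‖ :=
      ((A ^ m).le_opNorm z).trans (by gcongr)
    have h3 := norm_add_le (f^[m] z - (A ^ m) z) ((A ^ m) z)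
    rw [sub_add_cancel] at h3
    linarith
  have hall : ∀ᶠ z in 𝓝 (0 : Cn n), z ∈ U ∧ ‖f^[m] z‖ ≤ 3 / 4 * ‖z‖ ∧
      ∀ k ∈ Finset.range m, ‖f^[k] z‖ ≤ c k * ‖z‖ :=
    (hU.eventually_mem h0).and (hcontr.and ((Finset.eventually_all _).2 fun k _ => hc k))
  obtain ⟨r', hr', hball'⟩ := Metric.eventually_nhds_iff_ball.1 hall
  set r := min r' 1
  have hr : 0 < r := lt_min hr' one_pos
  have hball : ∀ z ∈ Metric.ball (0 : Cn n) r, z ∈ U ∧ ‖f^[m] z‖ ≤ 3 / 4 * ‖z‖ ∧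
      ∀ k ∈ Finset.range m, ‖f^[k] z‖ ≤ c k * ‖z‖ := fun z hz =>
    hball' z (Metric.ball_subset_ball (min_le_left _ _) hz)
  have hcont : ∀ k, ContinuousOn f^[k] U := fun k => hf.continuousOn.iterate hmaps k
  set B : Set (Cn n) := ⋂ k ∈ Finset.range m, U ∩ f^[k] ⁻¹' Metric.ball 0 r
  have hBmem : ∀ z, z ∈ B ↔ ∀ k < m, z ∈ U ∧ ‖f^[k] z‖ < r := by
    intro z
    simp [B]
  have hBball : ∀ z ∈ B, z ∈ Metric.ball (0 : Cn n) r := fun z hz => by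
    simpa using ((hBmem z).1 hz 0 hm).2
  have hstep : ∀ z ∈ Metric.ball (0 : Cn n) r, ‖f^[m] z‖ ≤ 3 / 4 * ‖z‖ := fun z hz =>
    (hball z hz).2.1
  have hBmaps : MapsTo f B B := by
    intro z hz
    rw [hBmem] at hz ⊢
    intro k hk
    refine ⟨hmaps (hz 0 hm).1, ?_⟩
    rw [← Function.iterate_succ_apply]
    rcases Nat.lt_or_ge (k + 1) m with h | h
    · exact (hz _ h).2
    · have hk' : k + 1 = m := by omega
      have hz0 : z ∈ Metric.ball (0 : Cn n) r := by simpa using (hz 0 hm).2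
      rw [Nat.succ_eq_add_one, hk']
      have h1 := hstep z hz0
      have h2 : ‖z‖ < r := by simpa using hz0
      have h3 := norm_nonneg z
      linarith
  -- A gain of 3/4 every m steps is a gain of q per step. The incomplete last block of fewer than m
  -- steps costs the constant `C0 / q ^ m`.
  set q : ℝ := (3 / 4 : ℝ) ^ ((m : ℝ)⁻¹)
  have hqm : q ^ m = 3 / 4 := Real.rpow_inv_natCast_pow (by norm_num) hm.ne'
  have hq0 : 0 < q := Real.rpow_pos_of_pos (by norm_num) _
  have hq1 : q < 1 := Real.rpow_lt_one (by norm_num) (by norm_num) (by positivity)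
  set C0 : ℝ := ∑ k ∈ Finset.range m, |c k|
  have hC0 : 0 ≤ C0 := Finset.sum_nonneg fun _ _ => abs_nonneg _
  have hmult : ∀ a : ℕ, ∀ z ∈ B, ‖f^[m * a] z‖ ≤ (3 / 4) ^ a * ‖z‖ := by
    intro a
    induction a with
    | zero => intro z _; simp
    | succ a ih =>
      intro z hz
      have e : f^[m * (a + 1)] z = f^[m] (f^[m * a] z) := by
        rw [← Function.iterate_add_apply]
        congr 1
        ring
      rw [e]
      have hmem : f^[m * a] z ∈ B := hBmaps.iterate _ hz
      refine (hstep _ (hBball _ hmem)).trans ?_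
      have := ih z hz
      rw [pow_succ]
      linarith
  refine ⟨B, C0 / q ^ m, q, fun z hz => ((hBmem z).1 hz 0 hm).1, ?_, ?_, ?_, hBmaps, ?_, hq0, hq1,
    ?_⟩
  · exact isOpen_biInter_finset fun k _ => (hcont k).isOpen_inter_preimage hU Metric.isOpen_ball
  · rw [hBmem]
    intro k _
    rw [hfix, norm_zero]
    exact ⟨h0, hr⟩
  · intro z hz
    have h1 : ‖z‖ < r := by simpa using hBball z hz
    exact h1.le.trans (min_le_right _ _)
  · exact hf.mono fun z hz => ((hBmem z).1 hz 0 hm).1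
  · intro k z hz
    have hmem : f^[m * (k / m)] z ∈ B := hBmaps.iterate _ hz
    have hk : k % m < m := Nat.mod_lt _ hm
    have e : f^[k] z = f^[k % m] (f^[m * (k / m)] z) := by
      rw [← Function.iterate_add_apply, Nat.mod_add_div]
    have h1 := (hball _ (hBball _ hmem)).2.2 (k % m) (Finset.mem_range.2 hk)
    have h2 : c (k % m) ≤ C0 := (le_abs_self _).trans
      (Finset.single_le_sum (f := fun k => |c k|) (fun _ _ => abs_nonneg _)
        (Finset.mem_range.2 hk))
    have h3 := hmult (k / m) z hz
    have h4 : (3 / 4 : ℝ) ^ (k / m) * q ^ m ≤ q ^ k := by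
      rw [← hqm, ← pow_mul, ← pow_add]
      refine pow_le_pow_of_le_one hq0.le hq1.le ?_
      have := Nat.mod_add_div k m
      omega
    rw [e]
    calc ‖f^[k % m] (f^[m * (k / m)] z)‖ ≤ c (k % m) * ‖f^[m * (k / m)] z‖ := h1
      _ ≤ C0 * ((3 / 4) ^ (k / m) * ‖z‖) := by gcongr
      _ ≤ C0 * ((q ^ k / q ^ m) * ‖z‖) := by
        gcongr
        rwa [le_div_iff₀ (by positivity)]
      _ = C0 / q ^ m * q ^ k * ‖z‖ := by ring

end LocalDynamics

/-! ### Generalized eigenvectors of algebra endomorphisms and lifting from quotients -/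

section GenEigenspace

open Polynomial

/-- Since T is multiplicative, (T - μν)(xy) = (T - μ)x · Ty + μx · (T - ν)y. Each summand has
lowered the nilpotency order of one factor and kept that of the other, so induction on the sum of
the orders applies. -/
theorem AlgHom.mul_mem_maxGenEigenspace {A : Type*} [CommRing A] [Algebra ℂ A] (T : A →ₐ[ℂ] A)
    {μ ν : ℂ} {x y : A} (hx : x ∈ Module.End.maxGenEigenspace T.toLinearMap μ)
    (hy : y ∈ Module.End.maxGenEigenspace T.toLinearMap ν) :
    x * y ∈ Module.End.maxGenEigenspace T.toLinearMap (μ * ν) := by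
  rw [Module.End.mem_maxGenEigenspace] at *
  obtain ⟨c, hc⟩ := hx
  obtain ⟨d, hd⟩ := hy
  set S : ℂ → Module.End ℂ A := fun κ => T.toLinearMap - κ • (1 : Module.End ℂ A)
  have hS : ∀ κ z, S κ z = T z - κ • z := fun κ z => rfl
  have hcomm : ∀ κ, Commute (S κ) T.toLinearMap := fun κ =>
    (Commute.refl _).sub_left ((Commute.one_left _).smul_left κ)
  have main : ∀ k c d : ℕ, c + d ≤ k → ∀ x y : A, (S μ ^ c) x = 0 → (S ν ^ d) y = 0 →
      (S (μ * ν) ^ k) (x * y) = 0 := by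
    intro k
    induction k with
    | zero =>
      intro c d hcd x y hx _
      have : c = 0 := by omega
      subst this
      have hx' : x = 0 := hx
      simp [hx']
    | succ k ih =>
      intro c d hcd x y hx hy
      rcases c with _ | c
      · have hx' : x = 0 := hx
        simp [hx']
      rcases d with _ | d
      · have hy' : y = 0 := hy
        simp [hy']
      have e : S (μ * ν) (x * y) = S μ x * T y + (μ • x) * S ν y := by
        simp only [hS, map_mul, Algebra.smul_def]
        ring
      have hTy : (S ν ^ (d + 1)) (T y) = 0 := by
        have h := congrArg (fun g : Module.End ℂ A => g y) ((hcomm ν).pow_left (d + 1)).eq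
        change (S ν ^ (d + 1)) (T y) = T ((S ν ^ (d + 1)) y) at h
        rw [h, hy, map_zero]
      rw [pow_succ] at hx
      have hy' : (S ν ^ d) (S ν y) = 0 := by rw [pow_succ] at hy; exact hy
      have hx' : (S μ ^ (c + 1)) (μ • x) = 0 := by
        rw [map_smul, pow_succ]
        rw [hx, smul_zero]
      rw [pow_succ, Module.End.mul_apply, e, map_add,
        ih c (d + 1) (by omega) _ _ hx hTy, ih (c + 1) d (by omega) _ _ hx' hy', add_zero]
  exact ⟨c + d, main _ c d le_rfl x y hc hd⟩

theorem AlgHom.prod_mem_maxGenEigenspace {A : Type*} [CommRing A] [Algebra ℂ A] (T : A →ₐ[ℂ] A)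
    {κ : Type*} (s : Finset κ) {μ : κ → ℂ} {x : κ → A}
    (hx : ∀ k ∈ s, x k ∈ Module.End.maxGenEigenspace T.toLinearMap (μ k)) :
    ∏ k ∈ s, x k ∈ Module.End.maxGenEigenspace T.toLinearMap (∏ k ∈ s, μ k) := by
  classical
  induction s using Finset.induction_on with
  | empty =>
    rw [Module.End.mem_maxGenEigenspace]
    exact ⟨1, by simp⟩
  | insert k s hk ih =>
    rw [Finset.prod_insert hk, Finset.prod_insert hk]
    exact T.mul_mem_maxGenEigenspace (hx k (by simp)) (ih fun j hj => hx j (by simp [hj]))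

variable {A : Type*} [AddCommGroup A] [Module ℂ A] {T : Module.End ℂ A} {K : Submodule ℂ A}

lemma aeval_apply_mem (hK : ∀ x ∈ K, T x ∈ K) (p : ℂ[X]) {x : A} (hx : x ∈ K) :
    aeval T p x ∈ K := by
  induction p using Polynomial.induction_on' with
  | add p q hp hq =>
    rw [map_add]
    exact K.add_mem hp hq
  | monomial m a =>
    rw [aeval_monomial]
    refine K.smul_mem a ?_
    clear * - hx hK
    induction m with
    | zero => exact hx
    | succ m ih =>
      rw [pow_succ']
      exact hK _ ih

lemma sub_smul_one_apply_mem (hK : ∀ x ∈ K, T x ∈ K) (μ : ℂ) :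
    ∀ x ∈ K, (T - μ • (1 : Module.End ℂ A)) x ∈ K := fun x hx =>
  K.sub_mem (hK x hx) (K.smul_mem μ hx)

/-- Modulo K all p(T)x lie in the finite-dimensional image of S, whereas ℂ[X] is
infinite-dimensional, so some nonzero p is sent to 0. -/
lemma exists_aeval_apply_mem {E S : Submodule ℂ A} [FiniteDimensional ℂ S]
    (hE : ∀ x ∈ E, T x ∈ E) (hES : E ≤ S ⊔ K) {x : A} (hx : x ∈ E) :
    ∃ p : ℂ[X], p ≠ 0 ∧ aeval T p x ∈ K := by
  let Φ : ℂ[X] →ₗ[ℂ] A ⧸ K :=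
    K.mkQ ∘ₗ LinearMap.applyₗ x ∘ₗ (aeval T : ℂ[X] →ₐ[ℂ] Module.End ℂ A).toLinearMap
  have hrange : ∀ p, Φ p ∈ S.map K.mkQ := by
    intro p
    obtain ⟨s, hs, k, hk, hsk⟩ := Submodule.mem_sup.1 (hES (aeval_apply_mem hE p hx))
    refine ⟨s, hs, ?_⟩
    change _ = K.mkQ (aeval T p x)
    have hk0 : K.mkQ k = 0 := (Submodule.Quotient.mk_eq_zero K).2 hk
    rw [← hsk, map_add, hk0, add_zero]
  by_contra! hcon
  have hinj : Function.Injective (Φ.codRestrict _ hrange) := by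
    rw [← LinearMap.ker_eq_bot, LinearMap.ker_eq_bot']
    intro p hp
    by_contra hp0
    refine hcon p hp0 ?_
    have h : Φ p = 0 := congrArg Subtype.val hp
    exact (Submodule.Quotient.mk_eq_zero K).1 h
  exact Polynomial.not_finite (R := ℂ) (Module.Finite.of_injective _ hinj)

/-- If `p(T) x ∈ K`, then the component `s(T) x` of `x` modulo `K` for the eigenvalue `μ` is
annihilated modulo `K` by a power of `T - μ`. -/
lemma exists_component {p : ℂ[X]} (hp : p ≠ 0) (hK : ∀ x ∈ K, T x ∈ K) {x : A}
    (hx : aeval T p x ∈ K) (μ : ℂ) (M₀ : ℕ) :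
    ∃ (M : ℕ) (s u : ℂ[X]), M₀ ≤ M ∧ s = 1 - u * (X - C μ) ^ M ∧
      (((T - μ • (1 : Module.End ℂ A)) ^ M) (aeval T s x)) ∈ K := by
  obtain ⟨r, hpr, hr⟩ := Polynomial.exists_eq_pow_rootMultiplicity_mul_and_not_dvd p hp μ
  set a := p.rootMultiplicity μ
  have hcop : IsCoprime ((X - C μ) ^ max M₀ a) r :=
    ((Polynomial.irreducible_X_sub_C μ).coprime_iff_not_dvd.2 hr).pow_left
  obtain ⟨u, v, huv⟩ := hcop
  -- The Bézout identity u(X - μ)^M + vr = 1 provides the spectral projector s = vr. The form 1 -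
  -- u(X - μ)^M shows that s fixes whatever (X - μ)^M kills.
  refine ⟨max M₀ a, v * r, u, le_max_left _ _, by rw [← huv]; ring, ?_⟩
  have e : (T - μ • (1 : Module.End ℂ A)) = aeval T (X - C μ) := by
    rw [map_sub, aeval_X, aeval_C, Algebra.algebraMap_eq_smul_one]
  rw [e, ← map_pow, ← Module.End.mul_apply, ← map_mul]
  have e2 : (X - C μ) ^ max M₀ a * (v * r) = (v * (X - C μ) ^ (max M₀ a - a)) * p := by
    conv_rhs => rw [hpr]
    have : (X - C μ) ^ max M₀ a = (X - C μ) ^ (max M₀ a - a) * (X - C μ) ^ a := by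
      rw [← pow_add, Nat.sub_add_cancel (le_max_right _ _)]
    rw [this]
    ring
  rw [e2, map_mul, Module.End.mul_apply]
  exact aeval_apply_mem hK _ hx

lemma exists_pow_sub_smul_eq {S : Module.End ℂ A} (hsurj : ∀ x ∈ K, ∃ y ∈ K, S y = x) (m : ℕ) :
    ∀ x ∈ K, ∃ y ∈ K, (S ^ m) y = x := by
  induction m with
  | zero => exact fun x hx => ⟨x, hx, rfl⟩
  | succ m ih =>
    intro x hx
    obtain ⟨y, hy, rfl⟩ := ih x hx
    obtain ⟨z, hz, rfl⟩ := hsurj y hy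
    exact ⟨z, hz, by rw [pow_succ]; rfl⟩

/-- If a generalized eigenvector for `μ` is congruent modulo `K` to a sum of generalized
eigenvectors, then it is congruent to the sum of those for the eigenvalue `μ`. -/
lemma sub_sum_filter_mem (hK : ∀ x ∈ K, T x ∈ K) {μ : ℂ} {x : A} (hx : x ∈ T.maxGenEigenspace μ)
    {κ : Type*} [Fintype κ] {ν : κ → ℂ} {y : κ → A} (hy : ∀ k, y k ∈ T.maxGenEigenspace (ν k))
    [DecidablePred fun k => ν k = μ] (hxy : x - ∑ k, y k ∈ K) :
    x - ∑ k with ν k = μ, y k ∈ K := by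
  let Tq : Module.End ℂ (A ⧸ K) := K.mapQ K T hK
  have hmap : ∀ κ z, z ∈ T.maxGenEigenspace κ → K.mkQ z ∈ Tq.maxGenEigenspace κ := by
    intro κ z hz
    rw [Module.End.mem_maxGenEigenspace] at hz ⊢
    obtain ⟨m, hm⟩ := hz
    refine ⟨m, ?_⟩
    have h : ∀ m z, ((Tq - κ • (1 : Module.End ℂ (A ⧸ K))) ^ m) (K.mkQ z) =
        K.mkQ (((T - κ • (1 : Module.End ℂ A)) ^ m) z) := by
      intro m
      induction m with
      | zero => exact fun z => rfl
      | succ m ih =>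
        intro z
        rw [pow_succ, pow_succ, Module.End.mul_apply, Module.End.mul_apply, ← ih]
        rfl
    rw [h, hm, map_zero]
  -- In the quotient the difference w lies both in the generalized eigenspace for μ and in the sum
  -- of the others, so it is zero there.
  have hdisj := Tq.independent_maxGenEigenspace μ
  set w := x - ∑ k with ν k = μ, y k
  have h1 : K.mkQ w ∈ Tq.maxGenEigenspace μ := by
    refine hmap μ w (Submodule.sub_mem _ hx (Submodule.sum_mem _ fun k hk => ?_))
    rw [← (Finset.mem_filter.1 hk).2]
    exact hy k
  have h2 : K.mkQ w = ∑ k with ¬ ν k = μ, K.mkQ (y k) := by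
    rw [← map_sum, ← sub_eq_zero, ← map_sub]
    refine (Submodule.Quotient.mk_eq_zero K).2 ?_
    have e : w - ∑ k with ¬ ν k = μ, y k = x - ∑ k, y k := by
      rw [← Finset.sum_filter_add_sum_filter_not Finset.univ (fun k => ν k = μ) y]
      simp only [w]
      abel
    rw [e]
    exact hxy
  have h3 : K.mkQ w ∈ ⨆ j, ⨆ (_ : j ≠ μ), Tq.maxGenEigenspace j := by
    rw [h2]
    refine Submodule.sum_mem _ fun k hk => ?_
    have hk' := (Finset.mem_filter.1 hk).2
    exact Submodule.mem_iSup_of_mem (ν k) (Submodule.mem_iSup_of_mem hk' (hmap _ _ (hy k)))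
  exact (Submodule.Quotient.mk_eq_zero K).1 (Submodule.disjoint_def.1 hdisj _ h1 h3)

end GenEigenspace

/-! ### Spaces of holomorphic functions on an attracting neighbourhood -/

section FunctionSpaces

open Filter Set

variable {n : ℕ}

/-- The functions that are holomorphic and bounded on `B`. -/
def boundedHolomorphic (B : Set (Cn n)) : Submodule ℂ (Cn n → ℂ) where
  carrier := {g | DifferentiableOn ℂ g B ∧ ∃ D, ∀ z ∈ B, ‖g z‖ ≤ D}
  zero_mem' := ⟨differentiableOn_const 0, 0, by simp⟩
  add_mem' := by
    rintro g h ⟨hg, D, hD⟩ ⟨hh, D', hD'⟩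
    exact ⟨hg.add hh, D + D', fun z hz => (norm_add_le _ _).trans (add_le_add (hD z hz) (hD' z hz))⟩
  smul_mem' := by
    rintro a g ⟨hg, D, hD⟩
    refine ⟨hg.const_smul a, ‖a‖ * D, fun z hz => ?_⟩
    rw [Pi.smul_apply, norm_smul]
    exact mul_le_mul_of_nonneg_left (hD z hz) (norm_nonneg a)

/-- The functions that are holomorphic on `B` and bounded there by a multiple of `‖z‖ ^ N`. -/
def vanishingHolomorphic (B : Set (Cn n)) (N : ℕ) : Submodule ℂ (Cn n → ℂ) where
  carrier := {g | DifferentiableOn ℂ g B ∧ ∃ D, ∀ z ∈ B, ‖g z‖ ≤ D * ‖z‖ ^ N}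
  zero_mem' := ⟨differentiableOn_const 0, 0, by simp⟩
  add_mem' := by
    rintro g h ⟨hg, D, hD⟩ ⟨hh, D', hD'⟩
    refine ⟨hg.add hh, D + D', fun z hz => ?_⟩
    rw [add_mul]
    exact (norm_add_le _ _).trans (add_le_add (hD z hz) (hD' z hz))
  smul_mem' := by
    rintro a g ⟨hg, D, hD⟩
    refine ⟨hg.const_smul a, ‖a‖ * D, fun z hz => ?_⟩
    rw [Pi.smul_apply, norm_smul, mul_assoc]
    exact mul_le_mul_of_nonneg_left (hD z hz) (norm_nonneg a)

lemma mul_mem_boundedHolomorphic {B : Set (Cn n)} {g h : Cn n → ℂ} (hg : g ∈ boundedHolomorphic B)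
    (hh : h ∈ boundedHolomorphic B) : g * h ∈ boundedHolomorphic B := by
  obtain ⟨hg, D, hD⟩ := hg
  obtain ⟨hh, D', hD'⟩ := hh
  refine ⟨hg.mul hh, D * D', fun z hz => ?_⟩
  rw [Pi.mul_apply, norm_mul]
  exact mul_le_mul (hD z hz) (hD' z hz) (norm_nonneg _) ((norm_nonneg _).trans (hD z hz))

lemma prod_mem_boundedHolomorphic {B : Set (Cn n)} {κ : Type*} (s : Finset κ) {g : κ → Cn n → ℂ}
    (hg : ∀ k ∈ s, g k ∈ boundedHolomorphic B) : ∏ k ∈ s, g k ∈ boundedHolomorphic B := by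
  classical
  induction s using Finset.induction_on with
  | empty => exact ⟨differentiableOn_const 1, 1, by simp⟩
  | insert k s hk ih =>
    rw [Finset.prod_insert hk]
    exact mul_mem_boundedHolomorphic (hg k (by simp)) (ih fun j hj => hg j (by simp [hj]))

variable {f : Cn n → Cn n} {B : Set (Cn n)} {C q : ℝ}

lemma exists_nonneg_bound_of_mem_vanishingHolomorphic {g : Cn n → ℂ} {N : ℕ}
    (hg : g ∈ vanishingHolomorphic B N) : ∃ D, 0 ≤ D ∧ ∀ z ∈ B, ‖g z‖ ≤ D * ‖z‖ ^ N := by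
  obtain ⟨-, D, hD⟩ := hg
  exact ⟨|D|, abs_nonneg D, fun z hz => (hD z hz).trans (by gcongr; exact le_abs_self D)⟩

lemma IsAttractingNhd.vanishing_le (hB : IsAttractingNhd f B C q) (N : ℕ) :
    vanishingHolomorphic B N ≤ boundedHolomorphic B := by
  intro g hg
  obtain ⟨D, hD0, hD⟩ := exists_nonneg_bound_of_mem_vanishingHolomorphic hg
  refine ⟨hg.1, D, fun z hz => (hD z hz).trans ?_⟩
  exact mul_le_of_le_one_right hD0 (pow_le_one₀ (norm_nonneg z) (hB.norm_le z hz))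

lemma mem_vanishingHolomorphic_of_isBigO {g : Cn n → ℂ}
    (hg : g ∈ boundedHolomorphic B) {N : ℕ} (hO : g =O[𝓝 0] fun z => ‖z‖ ^ N) :
    g ∈ vanishingHolomorphic B N := by
  obtain ⟨hd, D, hD⟩ := hg
  obtain ⟨c, hc⟩ := hO.bound
  obtain ⟨δ, hδ, hball⟩ := Metric.eventually_nhds_iff_ball.1 hc
  refine ⟨hd, max c (D / δ ^ N), fun z hz => ?_⟩
  by_cases hzδ : z ∈ Metric.ball (0 : Cn n) δ
  · have h := hball z hzδ
    rw [norm_pow, norm_norm] at h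
    exact h.trans (by gcongr; exact le_max_left _ _)
  · have h1 : δ ≤ ‖z‖ := by simpa using hzδ
    have hD0 : 0 ≤ D := (norm_nonneg _).trans (hD z hz)
    calc ‖g z‖ ≤ D := hD z hz
      _ = D / δ ^ N * δ ^ N := by field_simp
      _ ≤ D / δ ^ N * ‖z‖ ^ N := by gcongr
      _ ≤ max c (D / δ ^ N) * ‖z‖ ^ N := by gcongr; exact le_max_right _ _

open scoped Classical in
/-- The map `f` on `B`, extended by zero. -/
noncomputable def cutoff (f : Cn n → Cn n) (B : Set (Cn n)) (z : Cn n) : Cn n :=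
  if z ∈ B then f z else 0

lemma cutoff_of_mem {z : Cn n} (hz : z ∈ B) : cutoff f B z = f z := if_pos hz

lemma cutoff_of_notMem {z : Cn n} (hz : z ∉ B) : cutoff f B z = 0 := if_neg hz

/-- Composition with the map `f` on `B`, as an algebra endomorphism of the functions. -/
noncomputable def compCutoff (f : Cn n → Cn n) (B : Set (Cn n)) : (Cn n → ℂ) →ₐ[ℂ] (Cn n → ℂ) where
  toFun g := g ∘ cutoff f B
  map_one' := rfl
  map_mul' _ _ := rfl
  map_zero' := rfl
  map_add' _ _ := rfl
  commutes' _ := rfl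

lemma compCutoff_apply (g : Cn n → ℂ) (z : Cn n) :
    (compCutoff f B).toLinearMap g z = g (cutoff f B z) := rfl

namespace IsAttractingNhd

lemma map_zero (hB : IsAttractingNhd f B C q) : f 0 = 0 := by
  simpa using hB.norm_iterate_le 1 0 hB.zero_mem

lemma iterate_cutoff (hB : IsAttractingNhd f B C q) (k : ℕ) {z : Cn n} (hz : z ∈ B) :
    (cutoff f B)^[k] z = f^[k] z := by
  induction k with
  | zero => rfl
  | succ k ih =>
    rw [Function.iterate_succ_apply', Function.iterate_succ_apply', ih,
      cutoff_of_mem (hB.mapsTo.iterate k hz)]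

/-- Off B the series solving the cohomological equation thus reduces to its first term, as g(0) = 0.
The equation then holds on all of ℂⁿ, as an identity of functions. -/
lemma iterate_cutoff_succ_of_notMem (hB : IsAttractingNhd f B C q) (k : ℕ) {z : Cn n}
    (hz : z ∉ B) : (cutoff f B)^[k + 1] z = 0 := by
  rw [Function.iterate_succ_apply, cutoff_of_notMem hz, hB.iterate_cutoff k hB.zero_mem,
    Function.iterate_fixed hB.map_zero]

lemma comp_mem_bounded (hB : IsAttractingNhd f B C q) :
    ∀ g ∈ boundedHolomorphic B, (compCutoff f B).toLinearMap g ∈ boundedHolomorphic B := by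
  rintro g ⟨hg, D, hD⟩
  refine ⟨?_, D, fun z hz => ?_⟩
  · exact (hg.comp hB.differentiableOn hB.mapsTo).congr fun z hz => by
      rw [compCutoff_apply, cutoff_of_mem hz, Function.comp_apply]
  · rw [compCutoff_apply, cutoff_of_mem hz]
    exact hD _ (hB.mapsTo hz)

lemma norm_comp_iterate_le (hB : IsAttractingNhd f B C q) {g : Cn n → ℂ} {N : ℕ} {D : ℝ}
    (hD0 : 0 ≤ D) (hD : ∀ z ∈ B, ‖g z‖ ≤ D * ‖z‖ ^ N) (k : ℕ) {z : Cn n} (hz : z ∈ B) :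
    ‖g (f^[k] z)‖ ≤ D * |C| ^ N * (q ^ N) ^ k * ‖z‖ ^ N := by
  have hq := hB.pos
  calc ‖g (f^[k] z)‖ ≤ D * ‖f^[k] z‖ ^ N := hD _ (hB.mapsTo.iterate k hz)
    _ ≤ D * (|C| * q ^ k * ‖z‖) ^ N := by
      gcongr
      exact (hB.norm_iterate_le k z hz).trans (by gcongr; exact le_abs_self C)
    _ = D * |C| ^ N * (q ^ N) ^ k * ‖z‖ ^ N := by
      rw [mul_pow, mul_pow, ← pow_mul, ← pow_mul, mul_comm k N]
      ring

lemma comp_mem_vanishing (hB : IsAttractingNhd f B C q) (N : ℕ) :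
    ∀ g ∈ vanishingHolomorphic B N,
      (compCutoff f B).toLinearMap g ∈ vanishingHolomorphic B N := by
  intro g hg
  obtain ⟨D, hD0, hD⟩ := exists_nonneg_bound_of_mem_vanishingHolomorphic hg
  refine ⟨(hB.comp_mem_bounded g (hB.vanishing_le N hg)).1, D * |C| ^ N * (q ^ N) ^ 1,
    fun z hz => ?_⟩
  rw [compCutoff_apply, cutoff_of_mem hz]
  exact hB.norm_comp_iterate_le hD0 hD 1 hz

lemma differentiableOn_iterate (hB : IsAttractingNhd f B C q) (k : ℕ) :
    DifferentiableOn ℂ f^[k] B := hB.differentiableOn.iterate hB.mapsTo k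

/-- The cohomological equation can be solved for functions that vanish to high order. -/
lemma exists_sub_smul_eq (hB : IsAttractingNhd f B C q) {N : ℕ} (hN : N ≠ 0) {μ : ℂ}
    (hμ : q ^ N < ‖μ‖) : ∀ g ∈ vanishingHolomorphic B N, ∃ u ∈ vanishingHolomorphic B N,
      ((compCutoff f B).toLinearMap - μ • (1 : Module.End ℂ (Cn n → ℂ))) u = g := by
  intro g hg
  have hq := hB.pos
  have hμ0 : 0 < ‖μ‖ := (pow_pos hq N).trans hμ
  have hμ0' : μ ≠ 0 := norm_pos_iff.1 hμ0
  obtain ⟨D, hD0, hD⟩ := exists_nonneg_bound_of_mem_vanishingHolomorphic hg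
  -- The Neumann series for u∘f - μu = g is u = -∑ μ^{-(k+1)} g∘fᵏ. It converges because g∘fᵏ is
  -- O(q^{Nk}) and q^N < |μ|.
  set t : ℕ → Cn n → ℂ := fun k z => (μ⁻¹) ^ (k + 1) * g ((cutoff f B)^[k] z)
  set M : ℝ := ‖μ‖⁻¹ * (D * |C| ^ N)
  have hM : 0 ≤ M := by positivity
  have hbound : ∀ k, ∀ z ∈ B, ‖t k z‖ ≤ M * (q ^ N / ‖μ‖) ^ k * ‖z‖ ^ N := by
    intro k z hz
    have h := hB.norm_comp_iterate_le hD0 hD k hz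
    simp only [t, norm_mul, norm_pow, norm_inv, hB.iterate_cutoff k hz]
    calc ‖μ‖⁻¹ ^ (k + 1) * ‖g (f^[k] z)‖
        ≤ ‖μ‖⁻¹ ^ (k + 1) * (D * |C| ^ N * (q ^ N) ^ k * ‖z‖ ^ N) := by gcongr
      _ = M * (q ^ N / ‖μ‖) ^ k * ‖z‖ ^ N := by
        simp only [M, pow_succ, div_eq_mul_inv, mul_pow]
        ring
  have hgeo : Summable fun k : ℕ => M * (q ^ N / ‖μ‖) ^ k :=
    (summable_geometric_of_lt_one (by positivity) ((div_lt_one hμ0).2 hμ)).mul_left M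
  have hg0 : g 0 = 0 := by
    have h := hD 0 hB.zero_mem
    rw [norm_zero, zero_pow hN, mul_zero] at h
    exact norm_le_zero_iff.1 h
  have hsum : ∀ z, Summable fun k => t k z := by
    intro z
    by_cases hz : z ∈ B
    · exact Summable.of_norm_bounded (hgeo.mul_right (‖z‖ ^ N)) fun k => hbound k z hz
    · rw [← summable_nat_add_iff 1]
      convert summable_zero with k
      simp only [t, hB.iterate_cutoff_succ_of_notMem k hz, hg0, mul_zero]
  have hle : ∀ k, ∀ z ∈ B, ‖t k z‖ ≤ M * (q ^ N / ‖μ‖) ^ k := fun k z hz =>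
    (hbound k z hz).trans (mul_le_of_le_one_right (by positivity)
      (pow_le_one₀ (norm_nonneg z) (hB.norm_le z hz)))
  have hdiff : ∀ k, DifferentiableOn ℂ (t k) B := by
    intro k
    have h1 : DifferentiableOn ℂ (fun z => g (f^[k] z)) B :=
      hg.1.comp (hB.differentiableOn_iterate k) (hB.mapsTo.iterate k)
    exact (h1.const_mul (μ⁻¹ ^ (k + 1))).congr fun z hz => by simp only [t, hB.iterate_cutoff k hz]
  refine ⟨fun z => -∑' k, t k z, ⟨?_, (∑' k : ℕ, M * (q ^ N / ‖μ‖) ^ k), fun z hz => ?_⟩, ?_⟩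
  · exact (differentiableOn_tsum_cn hB.isOpen hgeo hdiff hle).neg
  · rw [norm_neg, ← tsum_mul_right]
    exact tsum_of_norm_bounded (hgeo.mul_right (‖z‖ ^ N)).hasSum fun k => hbound k z hz
  · funext z
    change -∑' k, t k (cutoff f B z) - μ • (-∑' k, t k z) = g z
    have h1 : ∀ k, t k (cutoff f B z) = μ * t (k + 1) z := by
      intro k
      simp only [t, ← Function.iterate_succ_apply, pow_succ]
      field_simp
    have h2 := (hsum z).tsum_eq_zero_add
    have h3 : t 0 z = μ⁻¹ * g z := by simp [t]
    simp only [h1, tsum_mul_left, smul_eq_mul]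
    rw [h2, h3]
    field_simp
    ring

/-- Iteration gives |μ|ᵏ |g(z)| = |g(fᵏ z)|, which is at most a constant times q^{Nk}. Since q^N <
|μ|, this forces g(z) = 0. -/
lemma eqOn_zero_of_comp_eq (hB : IsAttractingNhd f B C q) {N : ℕ} {μ : ℂ}
    (hμ : q ^ N < ‖μ‖) {g : Cn n → ℂ} (hg : g ∈ vanishingHolomorphic B N)
    (h : ∀ z ∈ B, g (f z) = μ * g z) : ∀ z ∈ B, g z = 0 := by
  intro z hz
  have hq := hB.pos
  have hμ0 : 0 < ‖μ‖ := (pow_pos hq N).trans hμ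
  obtain ⟨D, hD0, hD⟩ := exists_nonneg_bound_of_mem_vanishingHolomorphic hg
  have hit : ∀ k, g (f^[k] z) = μ ^ k * g z := by
    intro k
    induction k with
    | zero => simp
    | succ k ih =>
      rw [Function.iterate_succ_apply', h _ (hB.mapsTo.iterate k hz), ih, pow_succ]
      ring
  have hle : ∀ k : ℕ, ‖g z‖ ≤ D * |C| ^ N * ‖z‖ ^ N * (q ^ N / ‖μ‖) ^ k := by
    intro k
    have h1 := hB.norm_comp_iterate_le hD0 hD k hz
    rw [hit, norm_mul, norm_pow] at h1
    rw [div_pow, mul_div_assoc', le_div_iff₀ (pow_pos hμ0 k)]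
    linarith
  have hlim : Tendsto (fun k : ℕ => D * |C| ^ N * ‖z‖ ^ N * (q ^ N / ‖μ‖) ^ k) atTop (𝓝 0) := by
    simpa using (tendsto_pow_atTop_nhds_zero_of_lt_one (by positivity)
      ((div_lt_one hμ0).2 hμ)).const_mul (D * |C| ^ N * ‖z‖ ^ N)
  exact norm_le_zero_iff.1 (ge_of_tendsto' hlim hle)

lemma eqOn_zero_of_mem_maxGenEigenspace (hB : IsAttractingNhd f B C q) {N : ℕ} {μ : ℂ}
    (hμ : q ^ N < ‖μ‖) {g : Cn n → ℂ} (hg : g ∈ vanishingHolomorphic B N)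
    (h : g ∈ Module.End.maxGenEigenspace (compCutoff f B).toLinearMap μ) :
    ∀ z ∈ B, g z = 0 := by
  rw [Module.End.mem_maxGenEigenspace] at h
  obtain ⟨m, hm⟩ := h
  induction m generalizing g with
  | zero => intro z _; exact congrFun hm z
  | succ m ih =>
    rw [pow_succ] at hm
    have h1 := ih (sub_smul_one_apply_mem (hB.comp_mem_vanishing N) μ g hg) hm
    refine hB.eqOn_zero_of_comp_eq hμ hg fun z hz => ?_
    have h2 := h1 z hz
    change g (cutoff f B z) - μ • g z = 0 at h2
    rw [cutoff_of_mem hz] at h2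
    exact sub_eq_zero.1 h2

end IsAttractingNhd

end FunctionSpaces

/-! ### Resonant normal form -/

section NormalForm

open Filter Set Polynomial

variable {n : ℕ} {ι : Type} {L : Module.End ℂ (Cn n)} {f : Cn n → Cn n} {B : Set (Cn n)} {C q : ℝ}

/-- `φ` is a system of bounded holomorphic coordinates on `B`, tangent to the linear coordinates of
the basis `β`. -/
structure IsCoordSystem (β : Module.Basis ι ℂ (Cn n)) (B : Set (Cn n)) (φ : ι → Cn n → ℂ) :
    Prop where
  mem : ∀ i, φ i ∈ boundedHolomorphic B
  apply_zero : ∀ i, φ i 0 = 0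
  hasFDerivAt : ∀ i, HasFDerivAt (φ i) (LinearMap.toContinuousLinearMap (β.coord i)) 0

lemma IsAttractingNhd.isCoordSystem_coord (hB : IsAttractingNhd f B C q)
    (β : Module.Basis ι ℂ (Cn n)) : IsCoordSystem β B fun i z => β.repr z i where
  mem i := by
    let ℓ := LinearMap.toContinuousLinearMap (β.coord i)
    refine ⟨ℓ.differentiable.differentiableOn, ‖ℓ‖, fun z hz => ?_⟩
    exact (ℓ.le_opNorm z).trans (mul_le_of_le_one_right (norm_nonneg _) (hB.norm_le z hz))
  apply_zero i := by simp
  hasFDerivAt i := (LinearMap.toContinuousLinearMap (β.coord i)).hasFDerivAt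

/-- The power vanishes on the generalized eigenspace of the i-th eigenvalue, and it preserves the
others, where the i-th coordinate is zero. Dually, the coordinate form is a generalized eigenvector
for precomposition with L. -/
lemma AdaptedBasis.coord_pow_eq_zero (b : AdaptedBasis L ι) (i : ι) (z : Cn n) {M : ℕ}
    (hM : Module.finrank ℂ (Cn n) ≤ M) :
    b.basis.coord i (((L - (b.ev i : ℂ) • (1 : Module.End ℂ (Cn n))) ^ M) z) = 0 := by
  have key : b.basis.coord i ∘ₗ ((L - (b.ev i : ℂ) • (1 : Module.End ℂ (Cn n))) ^ M) = 0 := by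
    refine b.basis.ext fun k => ?_
    rw [LinearMap.comp_apply, LinearMap.zero_apply]
    by_cases hk : b.ev i = b.ev k
    · have h := b.mem k
      rw [Module.End.maxGenEigenspace_eq_genEigenspace_finrank, ← hk] at h
      have h' := (L.genEigenspace (b.ev i : ℂ)).monotone (show
        ((Module.finrank ℂ (Cn n) : ℕ) : ℕ∞) ≤ (M : ℕ∞) by exact_mod_cast hM) h
      rw [Module.End.mem_genEigenspace_nat, LinearMap.mem_ker] at h'
      rw [h', _root_.map_zero]
    · refine b.repr_eq_zero (b.ev k) _ ?_ i hk
      refine Module.End.mapsTo_maxGenEigenspace_of_comm ?_ (b.ev k : ℂ) (b.mem k)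
      exact Commute.pow_right ((Commute.refl L).sub_right ((Commute.one_right L).smul_right _)) M
  exact congrArg (fun g : Cn n →ₗ[ℂ] ℂ => g z) key

lemma AdaptedBasis.weight_prod (b : AdaptedBasis L ι) (h0 : ∀ j : L.Eigenvalues, (j : ℂ) ≠ 0)
    {k : ℕ} (x : Fin k → ι) {i : ι} (h : ∏ j, (b.ev (x j) : ℂ) = (b.ev i : ℂ)) :
    ∑ j, b.weight (x j) = b.weight i := by
  simp only [AdaptedBasis.weight]
  rw [← h, norm_prod, Real.log_prod fun j _ => norm_ne_zero_iff.2 (h0 _), Finset.sum_neg_distrib]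

variable [Fintype ι]

/-- Taylor expansion in the coordinates of a basis. -/
lemma AnalyticAt.exists_isBigO_sub_sum (β : Module.Basis ι ℂ (Cn n)) {g : Cn n → ℂ}
    (hg : AnalyticAt ℂ g 0) (N : ℕ) : ∃ c : (Σ k : Fin N, (Fin k → ι)) → ℂ,
      (fun z => g z - ∑ x, c x * ∏ j, β.repr z (x.2 j)) =O[𝓝 0] fun z => ‖z‖ ^ N := by
  obtain ⟨p, hp⟩ := hg
  refine ⟨fun x => p x.1 fun j => β (x.2 j), ?_⟩
  have h := hp.isBigO_sub_partialSum_pow N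
  refine h.congr_left fun z => ?_
  rw [zero_add]
  congr 1
  rw [FormalMultilinearSeries.partialSum, Fintype.sum_sigma,
    ← Fin.sum_univ_eq_sum_range (fun k => p k fun _ => z)]
  refine Finset.sum_congr rfl fun k _ => ?_
  have e : (fun _ : Fin k => z) = fun _ : Fin k => ∑ i, β.repr z i • β i := by
    rw [β.sum_repr]
  rw [e, ContinuousMultilinearMap.map_sum]
  refine Finset.sum_congr rfl fun x _ => ?_
  rw [ContinuousMultilinearMap.map_smul_univ, smul_eq_mul, mul_comm]

/-- The map with given coordinate functions. -/
noncomputable def mapOfCoords (β : Module.Basis ι ℂ (Cn n)) (φ : ι → Cn n → ℂ) (z : Cn n) : Cn n :=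
  ∑ i, φ i z • β i

lemma repr_mapOfCoords (β : Module.Basis ι ℂ (Cn n)) (φ : ι → Cn n → ℂ) (z : Cn n) (i : ι) :
    β.repr (mapOfCoords β φ z) i = φ i z := by
  rw [mapOfCoords, β.repr_sum_self]

namespace IsCoordSystem

variable {β : Module.Basis ι ℂ (Cn n)} {φ : ι → Cn n → ℂ}

lemma mapOfCoords_zero (hφ : IsCoordSystem β B φ) : mapOfCoords β φ 0 = 0 := by
  simp [mapOfCoords, hφ.apply_zero]

lemma differentiableOn (hφ : IsCoordSystem β B φ) : DifferentiableOn ℂ (mapOfCoords β φ) B :=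
  DifferentiableOn.fun_sum fun i _ => (hφ.mem i).1.smul_const (β i)

lemma hasFDerivAt_mapOfCoords (hφ : IsCoordSystem β B φ) :
    HasFDerivAt (mapOfCoords β φ) (ContinuousLinearEquiv.refl ℂ (Cn n) : Cn n →L[ℂ] Cn n) 0 := by
  have h := HasFDerivAt.fun_sum (u := Finset.univ) fun i _ => (hφ.hasFDerivAt i).smul_const (β i)
  refine h.congr_fderiv ?_
  ext1 z
  rw [sum_apply]
  simp [β.sum_repr z]

lemma contDiffAt (hφ : IsCoordSystem β B φ) (hB : IsOpen B) (h0 : (0 : Cn n) ∈ B) :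
    ContDiffAt ℂ ω (mapOfCoords β φ) 0 :=
  (hφ.differentiableOn.analyticOnNhd_cn hB 0 h0).contDiffAt

/-- The map φ has identity derivative at 0, hence a local analytic inverse. The Taylor polynomial of
g∘φ⁻¹, evaluated at φ, approximates g near 0; away from 0 boundedness supplies the estimate on the
rest of B. -/
lemma exists_sub_sum_mem (hφ : IsCoordSystem β B φ) (hB : IsOpen B) (h0 : (0 : Cn n) ∈ B)
    {g : Cn n → ℂ} (hg : g ∈ boundedHolomorphic B) (N : ℕ) :
    ∃ c : (Σ k : Fin N, (Fin k → ι)) → ℂ,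
      g - ∑ x, c x • ∏ j, φ (x.2 j) ∈ vanishingHolomorphic B N := by
  have hcd := hφ.contDiffAt hB h0
  have hω : (ω : WithTop ℕ∞) ≠ 0 := by simp
  have hinv := hcd.to_localInverse hφ.hasFDerivAt_mapOfCoords hω
  set e := hcd.toOpenPartialHomeomorph _ hφ.hasFDerivAt_mapOfCoords hω
  have he0 : (0 : Cn n) ∈ e.source :=
    hcd.mem_toOpenPartialHomeomorph_source hφ.hasFDerivAt_mapOfCoords hω
  have hecoe : ∀ z, e z = mapOfCoords β φ z := fun z => rfl
  rw [hφ.mapOfCoords_zero] at hinv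
  have hloc : ∀ z, hcd.localInverse hφ.hasFDerivAt_mapOfCoords hω z = e.symm z := fun z => rfl
  have hinv' : AnalyticAt ℂ e.symm 0 := hinv.analyticAt
  have hs0 : e.symm 0 = 0 := by
    have h := e.left_inv he0
    rwa [hecoe, hφ.mapOfCoords_zero] at h
  have hgan : AnalyticAt ℂ (g ∘ e.symm) 0 := by
    refine AnalyticAt.comp ?_ hinv'
    rw [hs0]
    exact hg.1.analyticOnNhd_cn hB 0 h0
  obtain ⟨c, hc⟩ := hgan.exists_isBigO_sub_sum β N
  refine ⟨c, mem_vanishingHolomorphic_of_isBigO ?_ ?_⟩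
  · exact Submodule.sub_mem _ hg (Submodule.sum_mem _ fun x _ => Submodule.smul_mem _ _
      (prod_mem_boundedHolomorphic _ fun j _ => hφ.mem _))
  · have htend : Tendsto (mapOfCoords β φ) (𝓝 0) (𝓝 0) := by
      have h := hcd.continuousAt.tendsto
      rwa [hφ.mapOfCoords_zero] at h
    have h1 := hc.comp_tendsto htend
    have h2 : (fun z => ‖mapOfCoords β φ z‖ ^ N) =O[𝓝 0] fun z : Cn n => ‖z‖ ^ N := by
      refine Asymptotics.IsBigO.pow ?_ N
      have h3 := hφ.hasFDerivAt_mapOfCoords.isBigO_sub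
      simp only [hφ.mapOfCoords_zero, sub_zero] at h3
      exact h3.norm_norm
    refine (h1.trans h2).congr' ?_ EventuallyEq.rfl
    filter_upwards [e.open_source.mem_nhds he0] with z hz
    have h4 : e.symm (mapOfCoords β φ z) = z := by rw [← hecoe, e.left_inv hz]
    simp only [Function.comp_apply, h4, repr_mapOfCoords, Pi.sub_apply, Finset.sum_apply,
      Pi.smul_apply, Finset.prod_apply, smul_eq_mul]

end IsCoordSystem

/-- Precomposition of linear forms with a linear map. -/
noncomputable def precompForms (A : Cn n →L[ℂ] Cn n) : Module.End ℂ (Cn n →L[ℂ] ℂ) where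
  toFun ℓ := ℓ.comp A
  map_add' _ _ := rfl
  map_smul' _ _ := rfl

lemma precompForms_pow_apply (A : Cn n →L[ℂ] Cn n) (μ : ℂ) (m : ℕ) (ℓ : Cn n →L[ℂ] ℂ)
    (z : Cn n) :
    ((precompForms A - μ • (1 : Module.End ℂ (Cn n →L[ℂ] ℂ))) ^ m) ℓ z =
      ℓ ((((A : Cn n →ₗ[ℂ] Cn n) - μ • (1 : Module.End ℂ (Cn n))) ^ m) z) := by
  induction m generalizing ℓ z with
  | zero => rfl
  | succ m ih =>
    rw [pow_succ, Module.End.mul_apply, ih, pow_succ', Module.End.mul_apply]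
    set y := (((A : Cn n →ₗ[ℂ] Cn n) - μ • (1 : Module.End ℂ (Cn n))) ^ m) z
    change ℓ (A y) - μ • ℓ y = ℓ (A y - μ • y)
    rw [map_sub, map_smul]

/-- Taking differentials at the fixed point intertwines composition with f and precomposition with
Df(0), hence also polynomials in these operators. -/
lemma IsAttractingNhd.hasFDerivAt_aeval (hB : IsAttractingNhd f B C q) (s : ℂ[X])
    {g : Cn n → ℂ} {ℓ : Cn n →L[ℂ] ℂ} (hℓ : HasFDerivAt g ℓ 0) :
    HasFDerivAt (aeval (compCutoff f B).toLinearMap s g)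
      (aeval (precompForms (fderiv ℂ f 0)) s ℓ) 0 := by
  have hf : HasFDerivAt (cutoff f B) (fderiv ℂ f 0) 0 := by
    refine (hB.differentiableOn.differentiableAt
      (hB.isOpen.mem_nhds hB.zero_mem)).hasFDerivAt.congr_of_eventuallyEq ?_
    filter_upwards [hB.isOpen.mem_nhds hB.zero_mem] with z hz using cutoff_of_mem hz
  have hc0 : cutoff f B 0 = 0 := by rw [cutoff_of_mem hB.zero_mem, hB.map_zero]
  induction s using Polynomial.induction_on' with
  | add p r hp hr =>
    rw [map_add, map_add]
    exact hp.add hr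
  | monomial m a =>
    rw [aeval_monomial, aeval_monomial]
    refine HasFDerivAt.const_smul ?_ a
    induction m with
    | zero => exact hℓ
    | succ m ih =>
      rw [pow_succ', pow_succ']
      refine HasFDerivAt.comp (0 : Cn n) (g := ((compCutoff f B).toLinearMap ^ m) g) ?_ hf
      rw [hc0]
      exact ih

/-- The spectral component s(T)x_i of the linear coordinate is a generalized eigenvector only modulo
K. Since T - μ is onto on K, the error (T - μ)^M s(T)x_i equals (T - μ)^M κ with κ in K, and κ is
subtracted. The differential is unaffected: s fixes the form dx_i because M is at least n, and κ is
O(|z|^N) with N ≥ 2. -/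
lemma IsAttractingNhd.exists_eigenCoord (hB : IsAttractingNhd f B C q)
    (b : AdaptedBasis (linearPart f) ι) {N : ℕ} (hN : 2 ≤ N) (i : ι)
    (hμ : q ^ N < ‖(b.ev i : ℂ)‖) :
    ∃ g ∈ boundedHolomorphic B,
      g ∈ Module.End.maxGenEigenspace (compCutoff f B).toLinearMap (b.ev i : ℂ) ∧
      HasFDerivAt g (LinearMap.toContinuousLinearMap (b.basis.coord i)) 0 := by
  set T : Module.End ℂ (Cn n → ℂ) := (compCutoff f B).toLinearMap
  set μ : ℂ := (b.ev i : ℂ)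
  set K := vanishingHolomorphic B N
  have hK : ∀ g ∈ K, T g ∈ K := hB.comp_mem_vanishing N
  have hcs := hB.isCoordSystem_coord b.basis
  let S : Submodule ℂ (Cn n → ℂ) := Submodule.span ℂ
    (Set.range fun x : (Σ k : Fin N, (Fin k → ι)) => ∏ j, fun z => b.basis.repr z (x.2 j))
  have hS : FiniteDimensional ℂ S := FiniteDimensional.span_of_finite ℂ (Set.finite_range _)
  have hES : boundedHolomorphic B ≤ S ⊔ K := by
    intro g hg
    obtain ⟨c, hc⟩ := hcs.exists_sub_sum_mem hB.isOpen hB.zero_mem hg N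
    refine Submodule.mem_sup.2 ⟨_, ?_, _, hc, add_sub_cancel _ _⟩
    exact Submodule.sum_mem _ fun x _ => Submodule.smul_mem _ _ (Submodule.subset_span ⟨x, rfl⟩)
  obtain ⟨p, hp0, hp⟩ := exists_aeval_apply_mem hB.comp_mem_bounded hES (hcs.mem i)
  obtain ⟨M, s, u, hM, hs, hmem⟩ := exists_component hp0 hK hp μ (Module.finrank ℂ (Cn n))
  obtain ⟨κ, hκ, hκeq⟩ := exists_pow_sub_smul_eq
    (hB.exists_sub_smul_eq (by omega : N ≠ 0) hμ) M _ hmem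
  have hE : aeval T s (fun z => b.basis.repr z i) ∈ boundedHolomorphic B :=
    aeval_apply_mem hB.comp_mem_bounded s (hcs.mem i)
  refine ⟨aeval T s (fun z => b.basis.repr z i) - κ,
    Submodule.sub_mem _ hE (hB.vanishing_le N hκ), ?_, ?_⟩
  · rw [Module.End.mem_maxGenEigenspace]
    exact ⟨M, by rw [map_sub, hκeq, sub_self]⟩
  · have h1 := hB.hasFDerivAt_aeval s (hcs.hasFDerivAt i)
    have h2 : HasFDerivAt κ (0 : Cn n →L[ℂ] ℂ) 0 := by
      obtain ⟨D, hD0, hD⟩ := exists_nonneg_bound_of_mem_vanishingHolomorphic hκ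
      have hO : κ =O[𝓝 0] fun z : Cn n => ‖z‖ ^ N := by
        refine Asymptotics.IsBigO.of_bound D ?_
        filter_upwards [hB.isOpen.mem_nhds hB.zero_mem] with z hz
        rw [norm_pow, norm_norm]
        exact hD z hz
      have hO' : (fun z => κ z) =O[𝓝 0] fun z : Cn n => ‖z - 0‖ ^ N := by simpa using hO
      exact hO'.hasFDerivAt (by omega)
    have h3 : aeval (precompForms (fderiv ℂ f 0)) s
        (LinearMap.toContinuousLinearMap (b.basis.coord i)) =
          LinearMap.toContinuousLinearMap (b.basis.coord i) := by
      rw [hs, map_sub, map_one, map_mul, map_pow, map_sub, aeval_X, aeval_C,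
        Algebra.algebraMap_eq_smul_one, LinearMap.sub_apply, Module.End.mul_apply]
      have h4 : ((precompForms (fderiv ℂ f 0) - μ • (1 : Module.End ℂ (Cn n →L[ℂ] ℂ))) ^ M)
          (LinearMap.toContinuousLinearMap (b.basis.coord i)) = 0 := by
        ext1 z
        rw [precompForms_pow_apply]
        exact b.coord_pow_eq_zero i z hM
      rw [h4, _root_.map_zero, sub_zero]
      rfl
    rw [h3] at h1
    simpa using h1.sub h2

/-- Near an attracting fixed point a holomorphic map is conjugate to a sub-resonant polynomial
map. -/
theorem IsAttractingNhd.exists_normalForm (hB : IsAttractingNhd f B C q)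
    (b : AdaptedBasis (linearPart f) ι) (h0 : ∀ j : (linearPart f).Eigenvalues, (j : ℂ) ≠ 0)
    (h1 : ∀ j : (linearPart f).Eigenvalues, (j : ℂ) ≠ 1) :
    ∃ φ P : Cn n → Cn n, P ∈ weightedMaps b ∧ DifferentiableOn ℂ φ B ∧ φ 0 = 0 ∧
      HasFDerivAt φ (ContinuousLinearEquiv.refl ℂ (Cn n) : Cn n →L[ℂ] Cn n) 0 ∧
      ∀ z ∈ B, φ (f z) = P (φ z) := by
  classical
  set T : Module.End ℂ (Cn n → ℂ) := (compCutoff f B).toLinearMap with hT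
  obtain ⟨N, hN2, hN⟩ : ∃ N, 2 ≤ N ∧ ∀ i, q ^ N < ‖(b.ev i : ℂ)‖ := by
    have h := fun i => (tendsto_pow_atTop_nhds_zero_of_lt_one hB.pos.le hB.lt_one).eventually_lt_const
      (norm_pos_iff.2 (h0 (b.ev i)))
    obtain ⟨N, hN⟩ := ((eventually_ge_atTop 2).and (eventually_all.2 h)).exists
    exact ⟨N, hN⟩
  choose φ hφE hφeig hφd using fun i => hB.exists_eigenCoord b hN2 i (hN i)
  -- At the fixed point T preserves values, so (1 - λ_i)^m φ_i(0) = 0, while λ_i ≠ 1.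
  have hφ0 : ∀ i, φ i 0 = 0 := by
    intro i
    obtain ⟨m, hm⟩ := (Module.End.mem_maxGenEigenspace _ _ _).1 (hφeig i)
    have h : ∀ m, ∀ g : Cn n → ℂ, ((T - (b.ev i : ℂ) • (1 : Module.End ℂ (Cn n → ℂ))) ^ m) g 0 =
        (1 - (b.ev i : ℂ)) ^ m * g 0 := by
      intro m
      induction m with
      | zero => intro g; simp
      | succ m ih =>
        intro g
        have e : (T - (b.ev i : ℂ) • (1 : Module.End ℂ (Cn n → ℂ))) g 0 =
            (1 - (b.ev i : ℂ)) * g 0 := by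
          change g (cutoff f B 0) - (b.ev i : ℂ) • g 0 = _
          rw [cutoff_of_mem hB.zero_mem, hB.map_zero, smul_eq_mul]
          ring
        rw [pow_succ, Module.End.mul_apply, ih, e, pow_succ]
        ring
    have h2 := h m (φ i)
    rw [hm] at h2
    have h3 : (1 - (b.ev i : ℂ)) ^ m ≠ 0 := pow_ne_zero _ (sub_ne_zero.2 (h1 _).symm)
    exact (mul_eq_zero.1 h2.symm).resolve_left h3
  have hφ : IsCoordSystem b.basis B φ := ⟨hφE, hφ0, hφd⟩
  choose c hc using fun i => hφ.exists_sub_sum_mem hB.isOpen hB.zero_mem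
    (hB.comp_mem_bounded _ (hφE i)) N
  have hmono : ∀ (i : ι) (x : (Σ k : Fin N, (Fin k → ι))), c i x • ∏ j, φ (x.2 j) ∈
      T.maxGenEigenspace (∏ j, (b.ev (x.2 j) : ℂ)) := fun i x =>
    Submodule.smul_mem _ _ ((compCutoff f B).prod_mem_maxGenEigenspace _ fun j _ => hφeig (x.2 j))
  have hTeig : ∀ i, T (φ i) ∈ T.maxGenEigenspace (b.ev i : ℂ) := fun i =>
    Module.End.mapsTo_maxGenEigenspace_of_comm (Commute.refl T) _ (hφeig i)
  -- Modulo K only the resonant monomials survive. The difference is then a generalized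
  -- eigenfunction for λ_i lying in K, hence zero on B: the truncated expansion is exact.
  have hres : ∀ i, ∀ z ∈ B, φ i (f z) = ∑ x : (Σ k : Fin N, (Fin k → ι))
      with ∏ j, (b.ev (x.2 j) : ℂ) = (b.ev i : ℂ), c i x * ∏ j, φ (x.2 j) z := by
    intro i z hz
    have hmem := sub_sum_filter_mem (hB.comp_mem_vanishing N) (hTeig i) (hmono i) (hc i)
    have heig : T (φ i) - ∑ x : (Σ k : Fin N, (Fin k → ι))
        with ∏ j, (b.ev (x.2 j) : ℂ) = (b.ev i : ℂ), c i x • ∏ j, φ (x.2 j) ∈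
          T.maxGenEigenspace (b.ev i : ℂ) := by
      refine Submodule.sub_mem _ (hTeig i) (Submodule.sum_mem _ fun x hx => ?_)
      rw [← (Finset.mem_filter.1 hx).2]
      exact hmono i x
    have h := hB.eqOn_zero_of_mem_maxGenEigenspace (hN i) hmem heig z hz
    rw [Pi.sub_apply, sub_eq_zero, hT, compCutoff_apply, cutoff_of_mem hz] at h
    rw [h, Finset.sum_apply]
    simp only [Pi.smul_apply, Finset.prod_apply, smul_eq_mul]
  let p : ι → MvPolynomial ι ℂ := fun i => ∑ x : (Σ k : Fin N, (Fin k → ι))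
      with ∏ j, (b.ev (x.2 j) : ℂ) = (b.ev i : ℂ),
        c i x • ∏ j, MvPolynomial.X (x.2 j)
  have hp : ∀ i, p i ∈ boundedWeight b.weight (b.weight i) := fun i =>
    Submodule.sum_mem _ fun x hx => Submodule.smul_mem _ _ (by
      rw [← b.weight_prod h0 x.2 (Finset.mem_filter.1 hx).2]
      exact prod_mem_boundedWeight _ _ _ fun j _ => X_mem_boundedWeight _)
  refine ⟨mapOfCoords b.basis φ,
    mapOfCoords b.basis fun i z => MvPolynomial.eval (b.basis.repr z) (p i), fun i => ⟨p i, hp i,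
      fun z => repr_mapOfCoords _ _ _ _⟩, hφ.differentiableOn, hφ.mapOfCoords_zero,
      hφ.hasFDerivAt_mapOfCoords, fun z hz => ?_⟩
  apply b.basis.repr.injective
  ext i
  rw [repr_mapOfCoords, repr_mapOfCoords, hres i z hz, map_sum]
  refine Finset.sum_congr rfl fun x _ => ?_
  rw [MvPolynomial.smul_eval, map_prod]
  simp only [MvPolynomial.eval_X, repr_mapOfCoords]

end NormalForm

/-! ### Quotients by an injective open map whose orbits escape -/

section OrbitQuotient

open Filter Set

variable {X : Type*} {f : X → X}

lemma quot_mk_iterate (f : X → X) (k : ℕ) (z : X) :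
    Quot.mk (fun x y => y = f x) (f^[k] z) = Quot.mk (fun x y => y = f x) z := by
  induction k with
  | zero => rfl
  | succ k ih =>
    rw [Function.iterate_succ_apply', ← ih]
    exact (Quot.sound (r := fun x y => y = f x) rfl).symm

/-- Equivalent points have a common forward iterate f^a z = f^b w, and injectivity cancels the
smaller of a and b. -/
lemma quot_mk_eq_iff (hinj : Function.Injective f) {z w : X} :
    Quot.mk (fun x y => y = f x) z = Quot.mk (fun x y => y = f x) w ↔
      ∃ k, f^[k] z = w ∨ f^[k] w = z := by
  constructor
  · intro h
    have hrel : ∃ a b, f^[a] z = f^[b] w := by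
      have h' := Quot.eqvGen_exact h
      clear h
      induction h' with
      | rel x y h => exact ⟨1, 0, h.symm⟩
      | refl x => exact ⟨0, 0, rfl⟩
      | symm x y _ ih =>
        obtain ⟨a, b, h⟩ := ih
        exact ⟨b, a, h.symm⟩
      | trans x y z _ _ ih₁ ih₂ =>
        obtain ⟨a, b, h₁⟩ := ih₁
        obtain ⟨c, d, h₂⟩ := ih₂
        refine ⟨c + a, b + d, ?_⟩
        rw [Function.iterate_add_apply, h₁, ← Function.iterate_add_apply, add_comm c b,
          Function.iterate_add_apply, h₂, ← Function.iterate_add_apply]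
    obtain ⟨a, b, h⟩ := hrel
    rcases le_total a b with hab | hab
    · obtain ⟨c, rfl⟩ := Nat.exists_eq_add_of_le hab
      rw [Function.iterate_add_apply] at h
      exact ⟨c, Or.inr (hinj.iterate a h).symm⟩
    · obtain ⟨c, rfl⟩ := Nat.exists_eq_add_of_le hab
      rw [Function.iterate_add_apply] at h
      exact ⟨c, Or.inl (hinj.iterate b h)⟩
  · rintro ⟨k, rfl | rfl⟩
    · exact (quot_mk_iterate f k z).symm
    · exact quot_mk_iterate f k w

variable [TopologicalSpace X]

/-- The iterates of `f` move some neighbourhood of each point away from some neighbourhood of each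
point. -/
def IsWandering (f : X → X) : Prop :=
  ∀ z w : X, ∃ k₀ : ℕ, ∀ᶠ p in 𝓝 (z, w), ∀ k ≥ k₀, f^[k] p.1 ≠ p.2

lemma IsOpenMap.iterate' (hopen : IsOpenMap f) (k : ℕ) : IsOpenMap f^[k] := by
  induction k with
  | zero => exact IsOpenMap.id
  | succ k ih =>
    rw [Function.iterate_succ]
    exact ih.comp hopen

/-- The saturation of an open set is the union of its images and preimages under the iterates, all
of which are open. -/
lemma isOpenQuotientMap_quot_mk (hinj : Function.Injective f) (hcont : Continuous f)
    (hopen : IsOpenMap f) : IsOpenQuotientMap (Quot.mk fun x y : X => y = f x) := by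
  refine ⟨Quot.mk_surjective, continuous_quot_mk, fun O hO => ?_⟩
  rw [isOpen_coinduced]
  have : Quot.mk (fun x y : X => y = f x) ⁻¹' (Quot.mk (fun x y : X => y = f x) '' O) =
      ⋃ k, (f^[k] '' O ∪ f^[k] ⁻¹' O) := by
    ext w
    simp only [mem_preimage, mem_image, quot_mk_eq_iff hinj, mem_iUnion, mem_union]
    constructor
    · rintro ⟨z, hz, k, h | h⟩
      · exact ⟨k, Or.inl ⟨z, hz, h⟩⟩
      · exact ⟨k, Or.inr (h ▸ hz)⟩
    · rintro ⟨k, ⟨z, hz, h⟩ | h⟩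
      · exact ⟨z, hz, k, Or.inl h⟩
      · exact ⟨_, h, k, Or.inr rfl⟩
  rw [this]
  exact isOpen_iUnion fun k => (hopen.iterate' k O hO).union (hO.preimage (hcont.iterate k))

/-- Wandering handles all large k at once; the finitely many others follow from continuity and the
Hausdorff property. -/
lemma IsWandering.eventually_ne [T2Space X] (hf : IsWandering f) (hcont : Continuous f)
    {z w : X} {S : Set ℕ} (hS : ∀ k ∈ S, f^[k] z ≠ w) :
    ∀ᶠ p in 𝓝 (z, w), ∀ k ∈ S, f^[k] p.1 ≠ p.2 := by
  obtain ⟨k₀, hk₀⟩ := hf z w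
  have hfin : ∀ᶠ p in 𝓝 (z, w), ∀ k ∈ Finset.range k₀, k ∈ S → f^[k] p.1 ≠ p.2 := by
    rw [Finset.eventually_all]
    intro k _
    by_cases hk : k ∈ S
    · have hc : Continuous fun p : X × X => (f^[k] p.1, p.2) :=
        ((hcont.iterate k).comp continuous_fst).prodMk continuous_snd
      have ho : IsOpen {p : X × X | f^[k] p.1 ≠ p.2} :=
        isClosed_diagonal.isOpen_compl.preimage hc
      exact (ho.eventually_mem (hS k hk)).mono fun p hp _ => hp
    · exact Eventually.of_forall fun p h => absurd h hk
  filter_upwards [hk₀, hfin] with p h1 h2 k hk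
  rcases Nat.lt_or_ge k k₀ with h | h
  · exact h2 k (Finset.mem_range.2 h) hk
  · exact h1 k h

lemma IsWandering.t2Space_quot [T2Space X] (hf : IsWandering f) (hinj : Function.Injective f)
    (hcont : Continuous f) (hopen : IsOpenMap f) : T2Space (Quot fun x y : X => y = f x) := by
  rw [t2Space_iff_of_isOpenQuotientMap (isOpenQuotientMap_quot_mk hinj hcont hopen),
    ← isOpen_compl_iff, isOpen_iff_mem_nhds]
  rintro ⟨z, w⟩ hzw
  simp only [mem_compl_iff, mem_ofPred_eq, quot_mk_eq_iff hinj, not_exists, not_or] at hzw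
  have h1 := hf.eventually_ne hcont (S := univ) (z := z) (w := w) fun k _ => (hzw k).1
  have h2 := hf.eventually_ne hcont (S := univ) (z := w) (w := z) fun k _ => (hzw k).2
  have h2' := (continuous_swap.tendsto (z, w)).eventually h2
  filter_upwards [h1, h2'] with p hp hp'
  simp only [mem_compl_iff, mem_ofPred_eq, quot_mk_eq_iff hinj, not_exists, not_or]
  exact fun k => ⟨hp k trivial, hp' k trivial⟩

/-- A periodic point would return to itself at arbitrarily large times. -/
lemma IsWandering.iterate_ne (hf : IsWandering f) {k : ℕ} (hk : 0 < k) (z : X) : f^[k] z ≠ z := by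
  intro h
  obtain ⟨k₀, hk₀⟩ := hf z z
  refine hk₀.self_of_nhds (k * k₀) (Nat.le_mul_of_pos_left k₀ hk) ?_
  rw [Function.iterate_mul]
  exact Function.iterate_fixed h k₀

/-- Each point has a neighbourhood disjoint from all its images under positive iterates, and the
projection is injective there. -/
lemma IsWandering.isLocalHomeomorph_quot_mk [T2Space X] (hf : IsWandering f)
    (hinj : Function.Injective f) (hcont : Continuous f) (hopen : IsOpenMap f) :
    IsLocalHomeomorph (Quot.mk fun x y : X => y = f x) := by
  have hq := isOpenQuotientMap_quot_mk hinj hcont hopen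
  rw [isLocalHomeomorph_iff_isOpenEmbedding_restrict]
  intro z
  have h := hf.eventually_ne hcont (S := {k | 0 < k}) (z := z) (w := z)
    fun k hk => hf.iterate_ne hk z
  rw [nhds_prod_eq] at h
  obtain ⟨t, ht, h⟩ := (eventually_prod_self_iff
    (r := fun x y => ∀ k ∈ {k : ℕ | 0 < k}, f^[k] x ≠ y)).1 h
  obtain ⟨O, hOt, hO, hzO⟩ := mem_nhds_iff.1 ht
  refine ⟨O, hO.mem_nhds hzO, .of_continuous_injective_isOpenMap
    (hq.continuous.comp continuous_subtype_val) ?_ (hq.isOpenMap.comp hO.isOpenMap_subtype_val)⟩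
  rintro ⟨x, hx⟩ ⟨y, hy⟩ hxy
  obtain ⟨k, hk⟩ := (quot_mk_eq_iff hinj).1 hxy
  apply Subtype.ext
  rcases Nat.eq_zero_or_pos k with rfl | hk0
  · rcases hk with hk | hk
    · exact hk
    · exact hk.symm
  · rcases hk with hk | hk
    · exact absurd hk (h x (hOt hx) y (hOt hy) k hk0)
    · exact absurd hk (h y (hOt hy) x (hOt hx) k hk0)

end OrbitQuotient

/-! ### Global dynamics of a Hopf contraction -/

section GlobalDynamics

open Filter Set Metric

variable {n : ℕ}

/-- A bounded sequence of holomorphic functions on a disc that converges to zero on a smaller disc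
converges to zero. -/
lemma tendsto_zero_of_tendsto_zero_on_disc {E : Type*} [NormedAddCommGroup E] [NormedSpace ℂ E]
    [CompleteSpace E] {g : ℕ → ℂ → E} {R ρ : ℝ} {D : ℕ → ℝ}
    (hg : ∀ k, DifferentiableOn ℂ (g k) (ball 0 3)) (hR : ∀ k, ∀ t ∈ ball (0 : ℂ) 3, ‖g k t‖ ≤ R)
    (hρ : 0 < ρ) (hρ3 : ρ < 3) (hD : ∀ k, ∀ t : ℂ, ‖t‖ ≤ ρ → ‖g k t‖ ≤ D k)
    (hlim : Tendsto D atTop (𝓝 0)) : Tendsto (fun k => g k 1) atTop (𝓝 0) := by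
  -- These are the Taylor terms of `g k` at the point 1. Cauchy estimates on the circle of radius 2
  -- dominate them by R / 2^j uniformly in k, and those on radius ρ make each one tend to 0;
  -- dominated convergence does the rest.
  set a : ℕ → ℕ → E := fun k j =>
    ((j.factorial : ℂ))⁻¹ • ((1 : ℂ) - 0) ^ j • iteratedDeriv j (g k) 0
  have hsum : ∀ k, HasSum (a k) (g k 1) := fun k =>
    Complex.hasSum_taylorSeries_on_ball (hg k) (by simp)
  have hcauchy : ∀ (r M : ℝ) (k j : ℕ), 0 < r → r < 3 → (∀ t ∈ sphere (0 : ℂ) r, ‖g k t‖ ≤ M) →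
      ‖a k j‖ ≤ M / r ^ j := by
    intro r M k j hr hr3 hM
    have hcl : DiffContOnCl ℂ (g k) (ball 0 r) :=
      (hg k).diffContOnCl_ball (closedBall_subset_ball hr3)
    have h := Complex.norm_iteratedDeriv_le_of_forall_mem_sphere_norm_le j hr hcl hM
    have hj : (0 : ℝ) < j.factorial := by exact_mod_cast j.factorial_pos
    simp only [a, sub_zero, one_pow, one_smul, norm_smul, norm_inv, Complex.norm_natCast]
    rw [inv_mul_le_iff₀ hj, ← mul_div_assoc]
    exact h
  have hb2 : ∀ k j, ‖a k j‖ ≤ R / 2 ^ j := fun k j =>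
    hcauchy 2 R k j (by norm_num) (by norm_num) fun t ht => hR k t (by
      rw [mem_sphere_zero_iff_norm] at ht
      rw [mem_ball_zero_iff, ht]
      norm_num)
  have hbρ : ∀ k j, ‖a k j‖ ≤ D k / ρ ^ j := fun k j =>
    hcauchy ρ (D k) k j hρ hρ3 fun t ht => hD k t (mem_sphere_zero_iff_norm.1 ht).le
  have hsummable : Summable fun j : ℕ => R / 2 ^ j := by
    simpa [div_eq_mul_inv] using (summable_geometric_of_lt_one (r := (2 : ℝ)⁻¹) (by norm_num)
      (by norm_num)).mul_left R
  have ha0 : ∀ j, Tendsto (fun k => a k j) atTop (𝓝 0) := fun j =>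
    squeeze_zero_norm (fun k => hbρ k j) (by simpa using hlim.div_const (ρ ^ j))
  have h := tendsto_tsum_of_dominated_convergence hsummable ha0
    (Eventually.of_forall fun k j => hb2 k j)
  simpa only [(hsum _).tsum_eq, tsum_zero] using h

variable {F : OpenPartialHomeomorph (Cn n) (Cn n)}

namespace IsHopfContraction

lemma mapsTo_target (hF : IsHopfContraction F) : F.target ⊆ F.source :=
  subset_closure.trans hF.closure_subset

lemma mapsTo (hF : IsHopfContraction F) : MapsTo F F.source F.source := fun _ hz =>
  hF.mapsTo_target (F.map_source hz)

lemma differentiableOn_iterate (hF : IsHopfContraction F) (k : ℕ) :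
    DifferentiableOn ℂ F^[k] F.source := hF.holomorphic.iterate hF.mapsTo k

lemma exists_attractingNhd (hF : IsHopfContraction F) :
    ∃ (B : Set (Cn n)) (C q : ℝ), B ⊆ F.source ∧ IsAttractingNhd F B C q :=
  exists_isAttractingNhd F.open_source hF.zero_mem hF.mapsTo hF.holomorphic hF.map_zero
    hF.contracting

lemma eigenvalue_ne_zero (hF : IsHopfContraction F) (j : (linearPart F).Eigenvalues) :
    (j : ℂ) ≠ 0 := by
  intro h
  obtain ⟨v, hv⟩ := Module.End.HasEigenvalue.exists_hasEigenvector
    (f := linearPart F) (μ := (j : ℂ)) j.2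
  have hLv : fderiv ℂ F 0 v = 0 := by
    have h1 := hv.apply_eq_smul
    rw [h, zero_smul] at h1
    exact h1
  have hd : DifferentiableAt ℂ F 0 :=
    hF.holomorphic.differentiableAt (F.open_source.mem_nhds hF.zero_mem)
  have hd' : DifferentiableAt ℂ F.symm (F 0) :=
    hF.holomorphic_symm.differentiableAt
      (F.open_target.mem_nhds (F.map_source hF.zero_mem))
  have h2 := (hd'.hasFDerivAt.comp (0 : Cn n) hd.hasFDerivAt).congr_of_eventuallyEq
    (f₁ := id) (by
      filter_upwards [F.open_source.mem_nhds hF.zero_mem] with z hz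
      exact (F.left_inv hz).symm)
  have h3 := h2.unique (hasFDerivAt_id 0)
  have h4 := congrArg (fun A : Cn n →L[ℂ] Cn n => A v) h3
  simp only [ContinuousLinearMap.comp_apply, hLv, _root_.map_zero,
    ContinuousLinearMap.id_apply] at h4
  exact hv.2 h4.symm

/-- Every orbit of a Hopf contraction enters a given attracting neighbourhood. -/
theorem exists_iterate_mem (hF : IsHopfContraction F) {B : Set (Cn n)} {C q : ℝ}
    (hB : IsAttractingNhd F B C q) {z : Cn n} (hz : z ∈ F.source) : ∃ k, F^[k] z ∈ B := by
  set A : Set (Cn n) := ⋃ k, F.source ∩ F^[k] ⁻¹' B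
  have hA : ∀ z, z ∈ A ↔ z ∈ F.source ∧ ∃ k, F^[k] z ∈ B := by
    intro z
    simp [A]
  have hAopen : IsOpen A := isOpen_iUnion fun k =>
    (hF.differentiableOn_iterate k).continuousOn.isOpen_inter_preimage F.open_source hB.isOpen
  obtain ⟨R, hR⟩ := hF.isCompact_closure.isBounded.exists_norm_le
  have hbound : ∀ k, ∀ z ∈ F.source, ‖F^[k + 1] z‖ ≤ R := by
    intro k z hz
    rw [Function.iterate_succ_apply']
    exact hR _ (subset_closure (F.map_source (hF.mapsTo.iterate k hz)))
  -- The basin is relatively closed in U. A limit point z₀ is joined to a nearby z₁ of the basin by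
  -- a complex disc inside U; the iterates are bounded on the disc and tend to 0 near its centre,
  -- hence also at z₀.
  have hclosed : closure A ∩ F.source ⊆ A := by
    rintro z₀ ⟨hcl, hz₀⟩
    obtain ⟨r₄, hr₄, hball⟩ := Metric.mem_nhds_iff.1 (F.open_source.mem_nhds hz₀)
    -- For |t| < 3 the point z₁ + t(z₀ - z₁) is at distance |t - 1| |z₀ - z₁| < 4r from z₀.
    set r := r₄ / 4
    have hr : 0 < r := by positivity
    obtain ⟨z₁, hz₁A, hz₁⟩ := Metric.mem_closure_iff.1 hcl r hr
    obtain ⟨hz₁U, k₁, hk₁⟩ := (hA z₁).1 hz₁A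
    have hnhd : ∀ᶠ w in 𝓝 z₁, w ∈ F.source ∧ F^[k₁] w ∈ B :=
      (((hF.differentiableOn_iterate k₁).continuousOn.isOpen_inter_preimage F.open_source
        hB.isOpen).eventually_mem ⟨hz₁U, hk₁⟩)
    obtain ⟨δ, hδ, hδball⟩ := Metric.eventually_nhds_iff_ball.1 hnhd
    set v := z₀ - z₁
    have hv : ‖v‖ < r := by rwa [← dist_eq_norm]
    have hline : ∀ t ∈ ball (0 : ℂ) 3, z₁ + t • v ∈ F.source := by
      intro t ht
      apply hball
      have ht' : ‖t‖ < 3 := by simpa using ht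
      have e : z₁ + t • v - z₀ = (t - 1) • v := by
        simp only [v, sub_smul, one_smul]
        abel
      rw [mem_ball, dist_eq_norm, e, norm_smul]
      have h1 : ‖t - 1‖ ≤ ‖t‖ + 1 := (norm_sub_le _ _).trans (by simp)
      calc ‖t - 1‖ * ‖v‖ ≤ 4 * ‖v‖ := by gcongr; linarith
        _ < 4 * r := by gcongr
        _ = r₄ := by simp only [r]; ring
    set ρ := min 1 (δ / (2 * r))
    have hρ : 0 < ρ := by positivity
    have hsmall : ∀ t : ℂ, ‖t‖ ≤ ρ → z₁ + t • v ∈ ball z₁ δ := by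
      intro t ht
      rw [mem_ball, dist_eq_norm, add_sub_cancel_left, norm_smul]
      calc ‖t‖ * ‖v‖ ≤ (δ / (2 * r)) * r := by
            gcongr
            exact ht.trans (min_le_right _ _)
        _ = δ / 2 := by field_simp
        _ < δ := by linarith
    -- The additional iterate lands in F(U), which is bounded; U itself need not be.
    have hlim := tendsto_zero_of_tendsto_zero_on_disc
      (g := fun k t => F^[k + 1 + k₁] (z₁ + t • v)) (R := R) (ρ := ρ)
      (D := fun k => |C| * q ^ (k + 1)) (fun k => ?_) (fun k t ht => ?_) hρ
      ((min_le_left _ _).trans_lt (by norm_num)) (fun k t ht => ?_) ?_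
    · simp only [one_smul, v, add_sub_cancel] at hlim
      obtain ⟨k, hk⟩ := (hlim.eventually (hB.isOpen.mem_nhds hB.zero_mem)).exists
      exact (hA z₀).2 ⟨hz₀, _, hk⟩
    · exact (hF.differentiableOn_iterate _).comp (by fun_prop) hline
    · rw [Function.iterate_add_apply]
      exact hbound k _ (hF.mapsTo.iterate k₁ (hline t ht))
    · rw [Function.iterate_add_apply]
      have hq := hB.pos
      have hmem := (hδball _ (hsmall t ht)).2
      refine (hB.norm_iterate_le (k + 1) _ hmem).trans ?_
      calc C * q ^ (k + 1) * ‖F^[k₁] (z₁ + t • v)‖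
          ≤ |C| * q ^ (k + 1) * ‖F^[k₁] (z₁ + t • v)‖ := by gcongr; exact le_abs_self C
        _ ≤ |C| * q ^ (k + 1) :=
          mul_le_of_le_one_right (by positivity) (hB.norm_le _ hmem)
    · have h := (tendsto_pow_atTop_nhds_zero_of_lt_one hB.pos.le hB.lt_one).comp
        (tendsto_add_atTop_nat 1)
      simpa using h.const_mul |C|
  have hsub : connectedComponentIn F.source 0 ⊆ A := by
    refine isPreconnected_connectedComponentIn.subset_of_closure_inter_subset hAopen
      ⟨0, mem_connectedComponentIn hF.zero_mem, (hA 0).2 ⟨hF.zero_mem, 0, hB.zero_mem⟩⟩ ?_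
    exact fun z hz => hclosed ⟨hz.1, connectedComponentIn_subset _ _ hz.2⟩
  obtain ⟨k, hk⟩ := hF.orbit_mem_component z hz
  obtain ⟨-, l, hl⟩ := (hA _).1 (hsub hk)
  exact ⟨l + k, by rwa [Function.iterate_add_apply]⟩

/-- The iterates of a Hopf contraction converge to the origin, locally uniformly. -/
theorem eventually_norm_iterate_lt (hF : IsHopfContraction F) {z : Cn n} (hz : z ∈ F.source)
    {ε : ℝ} (hε : 0 < ε) : ∃ k₀, ∀ᶠ w in 𝓝 z, ∀ k ≥ k₀, ‖F^[k] w‖ < ε := by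
  obtain ⟨B, C, q, -, hB⟩ := hF.exists_attractingNhd
  obtain ⟨k₁, hk₁⟩ := hF.exists_iterate_mem hB hz
  have hq := hB.pos
  have hlim : Tendsto (fun k : ℕ => |C| * q ^ k) atTop (𝓝 0) := by
    simpa using (tendsto_pow_atTop_nhds_zero_of_lt_one hB.pos.le hB.lt_one).const_mul |C|
  obtain ⟨k₂, hk₂⟩ := eventually_atTop.1 (hlim.eventually_lt_const hε)
  refine ⟨k₂ + k₁, ?_⟩
  filter_upwards [((hF.differentiableOn_iterate k₁).continuousOn.isOpen_inter_preimage
    F.open_source hB.isOpen).mem_nhds ⟨hz, hk₁⟩] with w hw k hk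
  obtain ⟨l, rfl⟩ := Nat.exists_eq_add_of_le hk
  have e : F^[k₂ + k₁ + l] w = F^[k₂ + l] (F^[k₁] w) := by
    rw [← Function.iterate_add_apply, show k₂ + k₁ + l = k₂ + l + k₁ by omega]
  rw [e]
  refine (hB.norm_iterate_le _ _ hw.2).trans_lt (lt_of_le_of_lt ?_ (hk₂ (k₂ + l) (by omega)))
  calc C * q ^ (k₂ + l) * ‖F^[k₁] w‖ ≤ |C| * q ^ (k₂ + l) * ‖F^[k₁] w‖ := by
        gcongr; exact le_abs_self C
    _ ≤ |C| * q ^ (k₂ + l) := mul_le_of_le_one_right (by positivity) (hB.norm_le _ hw.2)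

end IsHopfContraction

end GlobalDynamics

/-! ### The developing map of a Hopf contraction -/

section DevelopingMap

open Filter Set

/-- An injective map that locally belongs to a structure groupoid belongs to it. -/
lemma StructureGroupoid.exists_mem_of_injOn {H : Type*} [TopologicalSpace H] [Nonempty H]
    (𝒢 : StructureGroupoid H) [ClosedUnderRestriction 𝒢] {ψ : H → H} {U : Set H} (hU : IsOpen U)
    (hψ : InjOn ψ U) (hloc : ∀ z ∈ U, ∃ e ∈ 𝒢, z ∈ e.source ∧ EqOn ψ e e.source) :
    ∃ Ψ ∈ 𝒢, Ψ.source = U ∧ ⇑Ψ = ψ := by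
  have hcont : ContinuousOn ψ U := by
    intro z hz
    obtain ⟨e, -, hze, he⟩ := hloc z hz
    exact ((e.continuousAt hze).congr
      (he.eventuallyEq_of_mem (e.open_source.mem_nhds hze)).symm).continuousWithinAt
  have hopen : IsOpenMap (U.domRestrict ψ) := by
    rw [isOpenMap_iff_nhds_le]
    rintro ⟨z, hz⟩
    obtain ⟨e, -, hze, he⟩ := hloc z hz
    have h1 : map (U.domRestrict ψ) (𝓝 ⟨z, hz⟩) = 𝓝 (ψ z) := by
      change map (ψ ∘ Subtype.val) _ = _
      rw [← map_map, map_nhds_subtype_coe_eq_nhds hz (hU.mem_nhds hz),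
        map_congr (he.eventuallyEq_of_mem (e.open_source.mem_nhds hze)), e.map_nhds_eq hze, he hze]
    exact h1.ge
  refine ⟨OpenPartialHomeomorph.ofContinuousOpenRestrict (hψ.toPartialEquiv ψ U) hcont hopen hU,
    𝒢.locality fun z hz => ?_, rfl, rfl⟩
  obtain ⟨e, heG, hze, he⟩ := hloc z hz
  refine ⟨e.source, e.open_source, hze, 𝒢.mem_of_eqOnSource
    (closedUnderRestriction' heG hU) ⟨?_, ?_⟩⟩
  · rw [OpenPartialHomeomorph.restr_source, OpenPartialHomeomorph.restr_source,
      e.open_source.interior_eq, hU.interior_eq, inter_comm]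
    rfl
  · intro y hy
    rw [OpenPartialHomeomorph.restr_source, e.open_source.interior_eq] at hy
    exact he hy.2

variable {n : ℕ}

lemma mem_contDiffGroupoid_self_iff {E : Type*} [NormedAddCommGroup E] [NormedSpace ℂ E]
    {e : OpenPartialHomeomorph E E} : e ∈ contDiffGroupoid ω 𝓘(ℂ, E) ↔
      ContDiffOn ℂ ω e e.source ∧ ContDiffOn ℂ ω e.symm e.target := by
  rw [contDiffGroupoid, mem_groupoid_of_pregroupoid]
  simp [contDiffPregroupoid]

lemma DifferentiableOn.contDiffOn_cn {f : Cn n → Cn n} {U : Set (Cn n)} (hU : IsOpen U)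
    (hf : DifferentiableOn ℂ f U) : ContDiffOn ℂ ω f U :=
  (hf.analyticOnNhd_cn hU).contDiffOn hU.uniqueDiffOn

/-- The holomorphic inverse function theorem, in terms of the holomorphic groupoid. -/
lemma exists_mem_contDiffGroupoid_eqOn {φ : Cn n → Cn n} {B : Set (Cn n)} (hB : IsOpen B)
    (hφ : DifferentiableOn ℂ φ B) {a : Cn n} (ha : a ∈ B) {φ' : Cn n ≃L[ℂ] Cn n}
    (hφ' : HasFDerivAt φ (φ' : Cn n →L[ℂ] Cn n) a) :
    ∃ e ∈ contDiffGroupoid ω 𝓘(ℂ, Cn n), a ∈ e.source ∧ e.source ⊆ B ∧ ⇑e = φ := by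
  have hcd : ContDiffAt ℂ ω φ a := (hφ.contDiffOn_cn hB).contDiffAt (hB.mem_nhds ha)
  let e₀ := hcd.toOpenPartialHomeomorph φ hφ' (by simp)
  have he₀ : ⇑e₀ = φ := rfl
  have ha₀ : a ∈ e₀.source := hcd.mem_toOpenPartialHomeomorph_source hφ' (by simp)
  let e := e₀.restrContDiff ℂ ω (by simp)
  have hmem : e ∈ contDiffGroupoid ω 𝓘(ℂ, Cn n) := mem_contDiffGroupoid_self_iff.2
    ⟨e₀.contDiffOn_restrContDiff_source ℂ _, e₀.contDiffOn_restrContDiff_target ℂ _⟩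
  refine ⟨e.restr B, closedUnderRestriction' hmem hB, ?_, ?_, rfl⟩
  · rw [OpenPartialHomeomorph.restr_source, hB.interior_eq]
    refine ⟨⟨ha₀, hcd, ?_⟩, ha⟩
    exact e₀.contDiffAt_symm (e₀.map_source ha₀) (f₀' := φ') (by rwa [e₀.left_inv ha₀])
      (by rwa [e₀.left_inv ha₀])
  · rw [OpenPartialHomeomorph.restr_source, hB.interior_eq]
    exact inter_subset_right

variable {F : OpenPartialHomeomorph (Cn n) (Cn n)}

lemma IsHopfContraction.mem_contDiffGroupoid (hF : IsHopfContraction F) :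
    F ∈ contDiffGroupoid ω 𝓘(ℂ, Cn n) :=
  mem_contDiffGroupoid_self_iff.2 ⟨hF.holomorphic.contDiffOn_cn F.open_source,
    hF.holomorphic_symm.contDiffOn_cn F.open_target⟩

lemma IsHopfContraction.exists_iterate (hF : IsHopfContraction F) (k : ℕ) :
    ∃ e ∈ contDiffGroupoid ω 𝓘(ℂ, Cn n), F.source ⊆ e.source ∧ ⇑e = F^[k] := by
  induction k with
  | zero => exact ⟨.refl _, StructureGroupoid.id_mem _, subset_univ _, rfl⟩
  | succ k ih =>
    obtain ⟨e, he, hs, hk⟩ := ih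
    refine ⟨F.trans e, StructureGroupoid.trans _ hF.mem_contDiffGroupoid he, ?_, ?_⟩
    · rw [OpenPartialHomeomorph.trans_source]
      exact fun z hz => ⟨hz, hs (hF.mapsTo hz)⟩
    · rw [OpenPartialHomeomorph.coe_trans, hk, Function.iterate_succ]

lemma IsHopfContraction.iterate_injOn (hF : IsHopfContraction F) (k : ℕ) :
    InjOn F^[k] F.source := F.injOn.iterate hF.mapsTo k

/-- The homeomorphism given by a transformation that is analytic together with its inverse. -/
lemma exists_mem_contDiffGroupoid_coe_eq {g : Equiv.Perm (Cn n)} (hg : ContDiff ℂ ω g)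
    (hg' : ContDiff ℂ ω (g⁻¹ : Equiv.Perm (Cn n))) :
    ∃ e ∈ contDiffGroupoid ω 𝓘(ℂ, Cn n), e.source = univ ∧ ⇑e = g :=
  ⟨(Homeomorph.mk g hg.continuous hg'.continuous).toOpenPartialHomeomorph,
    mem_contDiffGroupoid_self_iff.2 ⟨hg.contDiffOn, hg'.contDiffOn⟩, rfl, rfl⟩

variable {ι : Type} [Fintype ι]

/-- A Hopf contraction is conjugate on its whole domain to a sub-resonant transformation. -/
theorem IsHopfContraction.exists_developingMap (hF : IsHopfContraction F)
    (b : AdaptedBasis (linearPart F) ι) (hw : ∀ k, 0 < b.weight k) :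
    ∃ g ∈ subResonantAffineGroup (linearPart F), ∃ Ψ ∈ contDiffGroupoid ω 𝓘(ℂ, Cn n),
      Ψ.source = F.source ∧ ∀ z ∈ F.source, Ψ (F z) = g (Ψ z) := by
  have h0 := hF.eigenvalue_ne_zero
  have h1 : ∀ j : (linearPart F).Eigenvalues, (j : ℂ) ≠ 1 := by
    intro j hj
    have := hF.contracting j j.2
    rw [hj, norm_one] at this
    exact lt_irrefl _ this
  obtain ⟨B, C, q, hBU, hB⟩ := hF.exists_attractingNhd
  obtain ⟨φ, P, hP, hφ, hφ0, hφ', hconj⟩ := hB.exists_normalForm b h0 h1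
  obtain ⟨e, he, h0e, heB, rfl⟩ := exists_mem_contDiffGroupoid_eqOn hB.isOpen hφ hB.zero_mem hφ'
  have hV := isCompositionMonoid_weightedMaps (b := b) hw
  -- By conjugacy P is onto near 0, so A∘P = 0 makes A vanish near 0, and the identity theorem gives
  -- A = 0. Hence P is a bijection of ℂⁿ, although the conjugacy is only local.
  obtain ⟨g, rfl, -⟩ := hV.exists_perm hP fun A hA hAP => by
    have hAan : AnalyticOnNhd ℂ A univ :=
      ((hV.contDiff A hA).differentiable (by simp)).differentiableOn.analyticOnNhd_cn isOpen_univ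
    refine hAan.eq_of_eventuallyEq (z₀ := 0) analyticOnNhd_const ?_
    have hc : ContinuousAt e.symm 0 := e.symm.continuousAt (by
      simpa [hφ0] using e.map_source h0e)
    have hs0 : e.symm 0 = 0 := by
      conv_lhs => rw [← hφ0]
      exact e.left_inv h0e
    have hcF : ContinuousAt F.symm 0 := F.symm.continuousAt (by
      simpa [hF.map_zero] using F.map_source hF.zero_mem)
    have hF0 : F.symm 0 = 0 := by
      conv_lhs => rw [← hF.map_zero]
      exact F.left_inv hF.zero_mem
    have ht : Tendsto (fun y => F.symm (e.symm y)) (𝓝 0) (𝓝 0) := by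
      have h2 : Tendsto F.symm (𝓝 0) (𝓝 0) := by simpa [ContinuousAt, hF0] using hcF
      have h3 : Tendsto e.symm (𝓝 0) (𝓝 0) := by simpa [ContinuousAt, hs0] using hc
      exact h2.comp h3
    have hFt : ∀ᶠ y in 𝓝 0, e.symm y ∈ F.target := by
      refine hc.eventually (F.open_target.mem_nhds ?_)
      rw [hs0]
      simpa [hF.map_zero] using F.map_source hF.zero_mem
    filter_upwards [ht.eventually (hB.isOpen.mem_nhds hB.zero_mem), hFt,
      e.open_target.mem_nhds (show (0 : Cn n) ∈ e.target by
        simpa [hφ0] using e.map_source h0e)] with y hy hy' hye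
    have h := hconj _ hy
    rw [F.right_inv hy', e.right_inv hye] at h
    rw [h]
    exact hAP _
  have hgG : g ∈ subResonantAffineGroup (linearPart F) :=
    (mem_subResonantAffineGroup_iff b h0 hw g).2 hP
  have hcd : ∀ h ∈ subResonantAffineGroup (linearPart F), ContDiff ℂ ω (h : Equiv.Perm (Cn n)) :=
    fun h hh => hV.contDiff _ ((mem_subResonantAffineGroup_iff b h0 hw h).1 hh)
  have hSB : ∀ z ∈ F.source, ∃ k₀, ∀ k ≥ k₀, F^[k] z ∈ e.source := by
    intro z hz
    obtain ⟨ε, hε, hball⟩ := Metric.mem_nhds_iff.1 (e.open_source.mem_nhds h0e)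
    obtain ⟨k₀, hk₀⟩ := hF.eventually_norm_iterate_lt hz hε
    exact ⟨k₀, fun k hk => hball (by simpa using hk₀.self_of_nhds k hk)⟩
  have hiter : ∀ (l : ℕ), ∀ z ∈ B, F^[l] z ∈ B ∧ e (F^[l] z) = (g ^ l) (e z) := by
    intro l z hz
    induction l with
    | zero => exact ⟨hz, rfl⟩
    | succ l ih =>
      rw [Function.iterate_succ_apply', hconj _ ih.1, ih.2, pow_succ', Equiv.Perm.mul_apply]
      exact ⟨hB.mapsTo ih.1, rfl⟩
  choose! κ hκ using fun z (hz : z ∈ F.source) => hF.exists_iterate_mem hB hz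
  -- Push z into B, apply the local conjugacy there, and undo the iterates with g. Once the orbit is
  -- in B the conjugacy relation makes the result independent of the number of iterates.
  let ψ : Cn n → Cn n := fun z => (g ^ κ z)⁻¹ (e (F^[κ z] z))
  have hψ : ∀ z ∈ F.source, ∀ k, F^[k] z ∈ B → (g ^ k) (ψ z) = e (F^[k] z) := by
    intro z hz k hk
    have key : ∀ a c, F^[a] z ∈ B → a ≤ c → (g ^ c)⁻¹ (e (F^[c] z)) = (g ^ a)⁻¹ (e (F^[a] z)) := by
      intro a c ha hac
      obtain ⟨d, rfl⟩ := Nat.exists_eq_add_of_le' hac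
      rw [Function.iterate_add_apply, (hiter d _ ha).2, Equiv.Perm.inv_eq_iff_eq, pow_add,
        Equiv.Perm.mul_apply]
      exact congrArg (g ^ d) ((g ^ a).apply_symm_apply _).symm
    have hψk : ψ z = (g ^ k)⁻¹ (e (F^[k] z)) := by
      rcases le_total (κ z) k with h | h
      · exact (key _ _ (hκ z hz) h).symm
      · exact key _ _ hk h
    rw [hψk, ← Equiv.Perm.eq_inv_iff_eq]
  -- At a common late time both orbits lie where the local conjugacy is injective, and iterates of F
  -- are injective on U.
  have hinj : InjOn ψ F.source := by
    intro z hz w hw hzw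
    obtain ⟨k₁, hk₁⟩ := hSB z hz
    obtain ⟨k₂, hk₂⟩ := hSB w hw
    have hz' := hk₁ (k₁ + k₂) (by omega)
    have hw' := hk₂ (k₁ + k₂) (by omega)
    refine hF.iterate_injOn (k₁ + k₂) hz hw (e.injOn hz' hw' ?_)
    rw [← hψ z hz _ (heB hz'), ← hψ w hw _ (heB hw'), hzw]
  obtain ⟨Ψ, hΨ, hΨs, hΨψ⟩ := (contDiffGroupoid ω 𝓘(ℂ, Cn n)).exists_mem_of_injOn F.open_source hinj
    fun z hz => by
      obtain ⟨k, hk⟩ := hSB z hz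
      obtain ⟨f, hf, hfs, hfk⟩ := hF.exists_iterate k
      have hgk := (subResonantAffineGroup (linearPart F)).pow_mem hgG k
      obtain ⟨γ, hγ, hγs, hγk⟩ := exists_mem_contDiffGroupoid_coe_eq (g := (g ^ k)⁻¹)
        (hcd _ (Subgroup.inv_mem _ hgk)) (hcd _ (by rwa [inv_inv]))
      refine ⟨((f.restr F.source).trans e).trans γ, StructureGroupoid.trans _
        (StructureGroupoid.trans _ (closedUnderRestriction' hf F.open_source) he) hγ, ?_, ?_⟩
      · simp only [OpenPartialHomeomorph.trans_source, OpenPartialHomeomorph.restr_source, hγs,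
          F.open_source.interior_eq, preimage_univ, inter_univ]
        exact ⟨⟨hfs hz, hz⟩, by simpa [hfk] using hk k le_rfl⟩
      · intro y hy
        simp only [OpenPartialHomeomorph.trans_source, OpenPartialHomeomorph.restr_source, hγs,
          F.open_source.interior_eq, preimage_univ, inter_univ] at hy
        have hy' : F^[k] y ∈ e.source := by simpa [hfk] using hy.2
        simp only [OpenPartialHomeomorph.coe_trans, Function.comp_apply, hγk,
          OpenPartialHomeomorph.restr_apply, hfk]
        rw [Equiv.Perm.eq_inv_iff_eq]
        exact hψ y hy.1.2 k (heB hy')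
  rw [← hΨψ] at hψ
  refine ⟨g, hgG, Ψ, hΨ, hΨs, fun z hz => ?_⟩
  obtain ⟨k, hk⟩ := hSB z hz
  have hFz := hψ (F z) (hF.mapsTo hz) k (by
    rw [← Function.iterate_succ_apply]
    exact heB (hk _ (Nat.le_succ k)))
  rw [← Function.iterate_succ_apply, ← hψ z hz (k + 1) (heB (hk _ (Nat.le_succ k))), pow_succ,
    Equiv.Perm.mul_apply] at hFz
  exact (g ^ k).injective hFz

end DevelopingMap

/-! ### Geometric structures on quotients -/

section QuotientStructure

open Filter Set

variable {X M H : Type*} [TopologicalSpace X] [TopologicalSpace M] [TopologicalSpace H]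
  {π : X → M}

/-- The charts of the base of a local homeomorphism `π : X → M` that a globally defined chart `D` of
`X` induces: a local inverse of `π` followed by `D`. -/
noncomputable def IsLocalHomeomorph.developingChart (hπ : IsLocalHomeomorph π)
    (D : OpenPartialHomeomorph X H) (x : X) : OpenPartialHomeomorph M H :=
  (hπ x).choose.symm.trans D

lemma IsLocalHomeomorph.mem_source_choose (hπ : IsLocalHomeomorph π) (x : X) :
    x ∈ (hπ x).choose.source := (hπ x).choose_spec.1

lemma IsLocalHomeomorph.coe_choose (hπ : IsLocalHomeomorph π) (x : X) : ⇑(hπ x).choose = π :=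
  (hπ x).choose_spec.2.symm

/-- The atlas of developing charts. -/
noncomputable abbrev IsLocalHomeomorph.developingChartedSpace (hπ : IsLocalHomeomorph π)
    (hs : Function.Surjective π) (D : OpenPartialHomeomorph X H) (hD : D.source = univ) :
    ChartedSpace H M where
  atlas := range (hπ.developingChart D)
  chartAt m := hπ.developingChart D (Function.surjInv hs m)
  mem_chart_source m := by
    have h1 := (hπ (Function.surjInv hs m)).choose.map_source (hπ.mem_source_choose _)
    rw [hπ.coe_choose, Function.surjInv_eq hs] at h1
    simpa [developingChart, hD] using h1
  chart_mem_atlas _ := mem_range_self _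

/-- The developing charts form a `(G, H)`-structure if points of a fibre of `π` differ, locally, by
elements of `G`. -/
theorem IsLocalHomeomorph.hasGroupoid_developingChartedSpace (hπ : IsLocalHomeomorph π)
    (hs : Function.Surjective π) (D : OpenPartialHomeomorph X H) (hD : D.source = univ)
    {G : Subgroup (Equiv.Perm H)}
    (hG : ∀ x y, π x = π y → ∃ g ∈ G, ∀ᶠ p in 𝓝 (x, y), π p.1 = π p.2 → D p.2 = g (D p.1)) :
    @HasGroupoid H _ M _ (hπ.developingChartedSpace hs D hD) (transformationGroupoid G) := by
  let _ := hπ.developingChartedSpace hs D hD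
  refine ⟨?_⟩
  rintro _ _ ⟨a, rfl⟩ ⟨b, rfl⟩ u hu
  set A := (hπ a).choose
  set B := (hπ b).choose
  have hA : ⇑A = π := hπ.coe_choose a
  have hB : ⇑B = π := hπ.coe_choose b
  have hu' : u ∈ D.target ∧ D.symm u ∈ A.source ∧ A (D.symm u) ∈ B.target := by
    have : hπ.developingChart D a = A.symm.trans D := rfl
    have : hπ.developingChart D b = B.symm.trans D := rfl
    simpa [*, hD, and_assoc] using hu
  obtain ⟨huD, huA, huB⟩ := hu'
  have hc1 : ContinuousAt D.symm u := D.symm.continuousAt huD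
  have hc2 : ContinuousAt (fun y => A (D.symm y)) u :=
    ContinuousAt.comp (f := D.symm) (A.continuousAt huA) hc1
  have hc3 : ContinuousAt (fun y => B.symm (A (D.symm y))) u :=
    ContinuousAt.comp (f := fun y => A (D.symm y)) (B.symm.continuousAt huB) hc2
  -- The change of charts is D∘B⁻¹∘A∘D⁻¹, and B⁻¹∘A moves points within fibres of π, so the
  -- hypothesis `hG` compares the two developments.
  have hfib : ∀ y, A (D.symm y) ∈ B.target → π (D.symm y) = π (B.symm (A (D.symm y))) := by
    intro y hy
    have := B.right_inv hy
    rw [hB] at this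
    rw [this, hA]
  obtain ⟨g, hg, hgev⟩ := hG _ _ (hfib u huB)
  refine ⟨g, hg, ?_⟩
  filter_upwards [(hc1.prodMk hc3).eventually hgev, hc2.eventually (B.open_target.mem_nhds huB),
    D.open_target.mem_nhds huD] with y hy hyB hyD
  have h := hy (hfib y hyB)
  rw [D.right_inv hyD] at h
  exact h

variable {E : Type*} [NormedAddCommGroup E] [NormedSpace ℂ E] [ChartedSpace E X]

/-- If the developing charts form a complex manifold and `D` is biholomorphic, then `π` is a local
biholomorphism. -/
theorem IsLocalHomeomorph.isLocalDiffeomorph_developingChartedSpace (hπ : IsLocalHomeomorph π)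
    (hs : Function.Surjective π) (D : OpenPartialHomeomorph X E) (hD : D.source = univ)
    (hM : @IsManifold ℂ _ E _ _ E _ 𝓘(ℂ, E) ω M _ (hπ.developingChartedSpace hs D hD))
    (hDs : ContMDiff 𝓘(ℂ, E) 𝓘(ℂ, E) ω D)
    (hDt : ContMDiffOn 𝓘(ℂ, E) 𝓘(ℂ, E) ω D.symm D.target) :
    @IsLocalDiffeomorph ℂ _ E _ _ E _ _ E _ E _ 𝓘(ℂ, E) 𝓘(ℂ, E) X _ _ M _
      (hπ.developingChartedSpace hs D hD) ω π := by
  let _ := hπ.developingChartedSpace hs D hD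
  intro x
  set A := (hπ x).choose
  have hA : ⇑A = π := hπ.coe_choose x
  have hmax : hπ.developingChart D x ∈ IsManifold.maximalAtlas 𝓘(ℂ, E) ω M :=
    IsManifold.subset_maximalAtlas (mem_range_self x)
  have hch : hπ.developingChart D x = A.symm.trans D := rfl
  refine ⟨{ toPartialEquiv := A.toPartialEquiv
            open_source := A.open_source
            open_target := A.open_target
            contMDiffOn_toFun := ?_
            contMDiffOn_invFun := ?_ }, hπ.mem_source_choose x, fun y _ => ?_⟩
  -- Near x, π is D followed by the inverse of the developing chart at x.
  · refine ((contMDiffOn_symm_of_mem_maximalAtlas hmax).comp (t := (A.symm.trans D).target)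
      (hDs.contMDiffOn (s := A.source)) fun y hy => ?_).congr fun y hy => ?_
    · have : D.symm (D y) = y := D.left_inv (by simp [hD])
      simpa [OpenPartialHomeomorph.trans_target, this, hD] using
        And.intro (D.map_source (x := y) (by simp [hD])) hy
    · have : D.symm (D y) = y := D.left_inv (by simp [hD])
      simp only [Function.comp_apply, hch, OpenPartialHomeomorph.trans_symm_eq_symm_trans_symm,
        OpenPartialHomeomorph.coe_trans, OpenPartialHomeomorph.symm_symm, this]
      rfl
  · refine (hDt.comp ((contMDiffOn_of_mem_maximalAtlas hmax).mono (t := A.target)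
      fun y hy => ?_) fun y hy => ?_).congr fun y hy => ?_
    · simpa [hch, hD] using hy
    · rw [hch]
      exact D.map_source (by simp [hD])
    · have : D.symm (D (A.symm y)) = A.symm y := D.left_inv (by simp [hD])
      exact this.symm
  · exact congrFun hA.symm y

end QuotientStructure

/-! ### Hopf manifolds -/

section Hopf

open Filter Set

variable {n : ℕ} {F : OpenPartialHomeomorph (Cn n) (Cn n)}

namespace IsHopfContraction

/-- A Hopf contraction as a self-map of its punctured domain. -/
noncomputable def puncturedMap (hF : IsHopfContraction F) (z : puncturedSource F) : puncturedSource F :=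
  ⟨F z, hF.mapsTo z.2.1, fun h => z.2.2 (F.injOn z.2.1 hF.zero_mem
    ((mem_singleton_iff.1 h).trans hF.map_zero.symm))⟩

lemma coe_iterate_puncturedMap (hF : IsHopfContraction F) (k : ℕ) (z : puncturedSource F) :
    (hF.puncturedMap^[k] z : Cn n) = F^[k] z := by
  induction k with
  | zero => rfl
  | succ k ih =>
    rw [Function.iterate_succ_apply', Function.iterate_succ_apply', ← ih]
    rfl

lemma injective_puncturedMap (hF : IsHopfContraction F) : Function.Injective hF.puncturedMap :=
  fun z w h => Subtype.ext (F.injOn z.2.1 w.2.1 (congrArg Subtype.val h))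

lemma continuous_puncturedMap (hF : IsHopfContraction F) : Continuous hF.puncturedMap :=
  (F.continuousOn.comp_continuous continuous_subtype_val fun z => z.2.1).subtype_mk _

lemma isOpenMap_puncturedMap (hF : IsHopfContraction F) : IsOpenMap hF.puncturedMap := by
  refine (puncturedSource F).isOpenEmbedding'.isOpenMap_iff.2 fun O hO => ?_
  have h1 : IsOpen ((Subtype.val : puncturedSource F → Cn n) '' O) :=
    (puncturedSource F).isOpenEmbedding'.isOpenMap O hO
  have h2 := F.isOpen_image_of_subset_source h1 (by
    rintro _ ⟨z, -, rfl⟩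
    exact z.2.1)
  rw [← image_comp] at h2
  exact h2

/-- Points near z eventually stay in the ball of radius |w|/2 about 0, which misses a neighbourhood
of w. Removing the origin is what makes |w| positive. -/
lemma isWandering_puncturedMap (hF : IsHopfContraction F) : IsWandering hF.puncturedMap := by
  intro z w
  have hw : (0 : ℝ) < ‖(w : Cn n)‖ / 2 := half_pos (norm_pos_iff.2 w.2.2)
  obtain ⟨k₀, hk₀⟩ := hF.eventually_norm_iterate_lt z.2.1 hw
  refine ⟨k₀, ?_⟩
  have h1 : ∀ᶠ p : puncturedSource F × puncturedSource F in 𝓝 (z, w),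
      ∀ k ≥ k₀, ‖F^[k] (p.1 : Cn n)‖ < ‖(w : Cn n)‖ / 2 :=
    ((continuous_subtype_val.comp continuous_fst).tendsto (z, w)).eventually hk₀
  have h2 : ∀ᶠ p : puncturedSource F × puncturedSource F in 𝓝 (z, w),
      ‖(w : Cn n)‖ / 2 < ‖(p.2 : Cn n)‖ :=
    ((continuous_norm.comp (continuous_subtype_val.comp continuous_snd)).tendsto
      (z, w)).eventually_const_lt (half_lt_self (norm_pos_iff.2 w.2.2))
  filter_upwards [h1, h2] with p hp hp' k hk h
  have := hp k hk
  rw [← hF.coe_iterate_puncturedMap, h] at this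
  exact lt_asymm this hp'

lemma hopfManifold_rel_eq (hF : IsHopfContraction F) :
    (fun z w : puncturedSource F => (w : Cn n) = F z) = fun z w => w = hF.puncturedMap z := by
  funext z w
  exact propext (Subtype.ext_iff (a1 := w) (a2 := hF.puncturedMap z)).symm

lemma hopfProj_eq_iff (hF : IsHopfContraction F) {z w : puncturedSource F} :
    hopfProj F z = hopfProj F w ↔
      ∃ k, hF.puncturedMap^[k] z = w ∨ hF.puncturedMap^[k] w = z := by
  rw [← quot_mk_eq_iff hF.injective_puncturedMap, ← hF.hopfManifold_rel_eq]
  rfl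

lemma isOpenQuotientMap_hopfProj (hF : IsHopfContraction F) : IsOpenQuotientMap (hopfProj F) := by
  have h := isOpenQuotientMap_quot_mk hF.injective_puncturedMap hF.continuous_puncturedMap
    hF.isOpenMap_puncturedMap
  rw [← hF.hopfManifold_rel_eq] at h
  exact h

lemma t2Space_hopfManifold (hF : IsHopfContraction F) : T2Space (HopfManifold F) := by
  have h := hF.isWandering_puncturedMap.t2Space_quot hF.injective_puncturedMap
    hF.continuous_puncturedMap hF.isOpenMap_puncturedMap
  rw [← hF.hopfManifold_rel_eq] at h
  exact h

lemma isLocalHomeomorph_hopfProj (hF : IsHopfContraction F) : IsLocalHomeomorph (hopfProj F) := by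
  have h := hF.isWandering_puncturedMap.isLocalHomeomorph_quot_mk hF.injective_puncturedMap
    hF.continuous_puncturedMap hF.isOpenMap_puncturedMap
  rw [← hF.hopfManifold_rel_eq] at h
  exact h

lemma secondCountableTopology_hopfManifold (hF : IsHopfContraction F) :
    SecondCountableTopology (HopfManifold F) :=
  hF.isOpenQuotientMap_hopfProj.isQuotientMap.secondCountableTopology
    hF.isOpenQuotientMap_hopfProj.isOpenMap

/-- Nearby points with the same projection are related by the same iterate. -/
lemma eventually_iterate_eq (hF : IsHopfContraction F) {x y : puncturedSource F} {k : ℕ}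
    (h : hF.puncturedMap^[k] x = y) :
    ∀ᶠ p in 𝓝 (x, y), hopfProj F p.1 = hopfProj F p.2 → hF.puncturedMap^[k] p.1 = p.2 := by
  obtain ⟨A, hy, hA⟩ := hF.isLocalHomeomorph_hopfProj y
  have h1 : ∀ᶠ p : puncturedSource F × puncturedSource F in 𝓝 (x, y),
      hF.puncturedMap^[k] p.1 ∈ A.source := by
    refine (((hF.continuous_puncturedMap.iterate k).comp continuous_fst).tendsto (x, y)).eventually
      (A.open_source.mem_nhds ?_)
    simpa [h] using hy
  have h2 : ∀ᶠ p : puncturedSource F × puncturedSource F in 𝓝 (x, y), p.2 ∈ A.source :=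
    (continuous_snd.tendsto (x, y)).eventually (A.open_source.mem_nhds hy)
  filter_upwards [h1, h2] with p hp1 hp2 hp
  refine A.injOn hp1 hp2 ?_
  rw [← hA, ← hp]
  exact hF.hopfProj_eq_iff.2 ⟨k, Or.inr rfl⟩

end IsHopfContraction

lemma transformationGroupoid_le_contDiffGroupoid {G : Subgroup (Equiv.Perm (Cn n))}
    (hG : ∀ g ∈ G, ContDiff ℂ ω (g : Cn n → Cn n)) :
    transformationGroupoid G ≤ contDiffGroupoid ω 𝓘(ℂ, Cn n) := by
  have key : ∀ e ∈ transformationGroupoid G, ContDiffOn ℂ ω e e.source := by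
    intro e he x hx
    obtain ⟨g, hg, hgx⟩ := he x hx
    exact ((hG g hg).contDiffAt.congr_of_eventuallyEq hgx).contDiffWithinAt
  intro e he
  exact mem_contDiffGroupoid_self_iff.2
    ⟨key e he, key e.symm ((transformationGroupoid G).symm he)⟩

namespace IsHopfContraction

/-- Points of a fibre of the projection onto the Hopf manifold have, locally, developments that
differ by a power of `g`. -/
lemma exists_eventually_eq (hF : IsHopfContraction F) {G : Subgroup (Equiv.Perm (Cn n))}
    {g : Equiv.Perm (Cn n)} (hg : g ∈ G) {ψ : Cn n → Cn n}
    (hψ : ∀ z ∈ F.source, ψ (F z) = g (ψ z)) {x y : puncturedSource F}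
    (hxy : hopfProj F x = hopfProj F y) :
    ∃ h ∈ G, ∀ᶠ p in 𝓝 (x, y), hopfProj F p.1 = hopfProj F p.2 → ψ p.2 = h (ψ p.1) := by
  have hiter : ∀ (k : ℕ) (z : puncturedSource F), ψ (hF.puncturedMap^[k] z) = (g ^ k) (ψ z) := by
    intro k z
    induction k with
    | zero => rfl
    | succ k ih =>
      rw [Function.iterate_succ_apply', pow_succ', Equiv.Perm.mul_apply, ← ih]
      exact hψ _ (hF.puncturedMap^[k] z).2.1
  obtain ⟨k, hk | hk⟩ := hF.hopfProj_eq_iff.1 hxy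
  · refine ⟨g ^ k, G.pow_mem hg k, ?_⟩
    filter_upwards [hF.eventually_iterate_eq hk] with p hp hpp
    rw [← hp hpp, hiter]
  · refine ⟨(g ^ k)⁻¹, G.inv_mem (G.pow_mem hg k), ?_⟩
    filter_upwards [(continuous_swap.tendsto (x, y)).eventually (hF.eventually_iterate_eq hk)]
      with p hp hpp
    rw [Equiv.Perm.eq_inv_iff_eq, ← hiter]
    exact congrArg (fun z : puncturedSource F => ψ z) (hp hpp.symm)

/-- The Hopf manifold carries a structure modelled on any analytic transformation group to an
element of which the contraction is globally conjugate. -/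
theorem exists_chartedSpace_hopfManifold (hF : IsHopfContraction F)
    {G : Subgroup (Equiv.Perm (Cn n))} (hG : ∀ g ∈ G, ContDiff ℂ ω (g : Cn n → Cn n))
    {g : Equiv.Perm (Cn n)} (hg : g ∈ G) {Ψ : OpenPartialHomeomorph (Cn n) (Cn n)}
    (hΨ : Ψ ∈ contDiffGroupoid ω 𝓘(ℂ, Cn n)) (hΨs : Ψ.source = F.source)
    (hΨF : ∀ z ∈ F.source, Ψ (F z) = g (Ψ z)) :
    ∃ _ : ChartedSpace (Cn n) (HopfManifold F),
      HasGroupoid (HopfManifold F) (transformationGroupoid G) ∧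
      IsManifold 𝓘(ℂ, Cn n) ω (HopfManifold F) ∧
      IsLocalDiffeomorph 𝓘(ℂ, Cn n) 𝓘(ℂ, Cn n) ω (hopfProj F) := by
  have hle := transformationGroupoid_le_contDiffGroupoid hG
  have hsurj : Function.Surjective (hopfProj F) := hF.isOpenQuotientMap_hopfProj.surjective
  -- The empty case is n = 0: an open set is {0} only in dimension 0.
  rcases isEmpty_or_nonempty (puncturedSource F) with hX | hX
  · have : IsEmpty (HopfManifold F) := hsurj.isEmpty
    let _ := ChartedSpace.empty (Cn n) (HopfManifold F)
    have hgr : HasGroupoid (HopfManifold F) (transformationGroupoid G) := ⟨fun {e} _ he => he.elim⟩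
    have := hasGroupoid_of_le hgr hle
    exact ⟨_, hgr, IsManifold.mk' _ _ _, fun x => isEmptyElim x⟩
  let D : OpenPartialHomeomorph (puncturedSource F) (Cn n) :=
    ((puncturedSource F).openPartialHomeomorphSubtypeCoe hX).trans Ψ
  have hD : D.source = univ := by
    ext z
    simpa [D, hΨs] using z.2.1
  obtain ⟨hΨ1, hΨ2⟩ := mem_contDiffGroupoid_self_iff.1 hΨ
  let _ := hF.isLocalHomeomorph_hopfProj.developingChartedSpace hsurj D hD
  have hgr : HasGroupoid (HopfManifold F) (transformationGroupoid G) :=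
    hF.isLocalHomeomorph_hopfProj.hasGroupoid_developingChartedSpace hsurj D hD
      fun x y hxy => hF.exists_eventually_eq hg hΨF hxy
  have := hasGroupoid_of_le hgr hle
  have hM : IsManifold 𝓘(ℂ, Cn n) ω (HopfManifold F) := IsManifold.mk' _ _ _
  refine ⟨_, hgr, hM, hF.isLocalHomeomorph_hopfProj.isLocalDiffeomorph_developingChartedSpace
    hsurj D hD hM ?_ ?_⟩
  · exact hΨ1.contMDiffOn.comp_contMDiff contMDiff_subtype_val fun z =>
      hΨs.ge z.2.1
  · intro y hy
    refine (ChartedSpace.liftPropWithinAt_subtypeVal_comp_iff (U := puncturedSource F) ..).1 ?_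
    have hsub : D.target ⊆ Ψ.target := fun y hy => by
      simp only [D, OpenPartialHomeomorph.trans_target] at hy
      exact hy.1
    refine ((hΨ2.contMDiffOn.mono hsub) y hy).congr_of_mem (fun w hw => ?_) hy
    rw [← Ψ.injOn.eq_iff (s := Ψ.source) (hΨs ▸ (D.symm w).2.1) (Ψ.map_target (hsub hw))]
    rw [Ψ.right_inv (hsub hw)]
    exact D.right_inv hw

end IsHopfContraction

end Hopf

theorem theorem4p3 (n : ℕ) (F : OpenPartialHomeomorph (Cn n) (Cn n)) (hF : IsHopfContraction F) :
    IsHolomorphicHomogeneousSpace (subResonantAffineGroup (linearPart F)) ∧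
    T2Space (HopfManifold F) ∧ SecondCountableTopology (HopfManifold F) ∧
    ∃ _ : ChartedSpace (Cn n) (HopfManifold F),
      -- the atlas is a `(G, X)`-structure, `X = ℂⁿ`, `G = ⟨SR*(L), ℂⁿ⟩`
      HasGroupoid (HopfManifold F)
        (transformationGroupoid (subResonantAffineGroup (linearPart F))) ∧
      -- it is holomorphic, and its complex structure is the quotient one
      IsManifold 𝓘(ℂ, Cn n) ω (HopfManifold F) ∧
      IsLocalDiffeomorph 𝓘(ℂ, Cn n) 𝓘(ℂ, Cn n) ω (hopfProj F) := by
  obtain ⟨ι, _, ⟨b⟩⟩ := exists_adaptedBasis (linearPart F)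
  have h0 := hF.eigenvalue_ne_zero
  -- Invertibility and contraction together place every eigenvalue in 0 < |λ| < 1.
  have hw : ∀ k, 0 < b.weight k := fun k => neg_pos.2
    (Real.log_neg (norm_pos_iff.2 (h0 (b.ev k))) (hF.contracting _ (b.ev k).2))
  obtain ⟨g, hg, Ψ, hΨ, hΨs, hΨF⟩ := hF.exists_developingMap b hw
  exact ⟨isHolomorphicHomogeneousSpace_subResonantAffineGroup b h0 hw, hF.t2Space_hopfManifold,
    hF.secondCountableTopology_hopfManifold, hF.exists_chartedSpace_hopfManifold
      (fun g hg => (isCompositionMonoid_weightedMaps hw).contDiff _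
        ((mem_subResonantAffineGroup_iff b h0 hw g).1 hg)) hg hΨ hΨs hΨF⟩
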